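/- **Setting.** A *pointed homotopical category* $\mathbf A$ is a category with: homotopies $\alpha : f \simeq g$ between parallel maps; trivial homotopies, reverse homotopies, concatenation; whisker composition $v\alpha u$ with maps (strictly functorial and preserving trivial homotopies); an equivalence relation $\simeq_2$ (2-homotopy) between parallel homotopies, compatible with concatenation and whisker composition, up to which the groupoid laws for concatenation, the distributivity of whisker composition over concatenation, and the reduced interchange law hold; a zero object $0$ such that every homotopy between maps to $0$ or from $0$ is trivial; and, for each map $f : A \to B$, a homotopy kernel $(Kf,\ kf : Kf \to A,\ \kappa f : 0 \simeq f\cdot kf)$ and a homotopy cokernel $(Cf,\ cf : B \to Cf,\ \gamma f : 0 \simeq cf\cdot f)$. The homotopy kernel is universal in dimension 1 (each $(x : W\to A,\ \xi : 0 \simeq fx)$ equals $(kf\cdot m,\ \kappa f\cdot m)$ for a unique $m : W \to Kf$) and in dimension 2 (if $x,y : W \to Kf$ and $\varphi : kf\cdot x \simeq kf\cdot y$ satisfy $\kappa f\cdot x + f\varphi \simeq_2 \kappa f\cdot y$, there is $\psi : x \simeq y$ with $kf\cdot\psi = \varphi$); the homotopy cokernel has the dual properties. Put $\Omega B = K(0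 \to B)$ and $\Sigma A = C(A \to 0)$; these are adjoint functors $\Sigma \dashv \Omega$. Let $p \ge 0$ and suppose $\Omega^{p+1} = 0 = \Sigma^{p+1}$ in $\mathbf A$. Let $H_0,\dots,H_p : \mathbf A \to \mathbf D$ be functors to an abelian category such that: (i) $f \simeq g$ implies $H_n(f) = H_n(g)$; (ii) for every $f : A \to B$ the sequences $H_0(Kf) \to H_0(A) \to H_0(B)$ and $H_p(A) \to H_p(B) \to H_p(Cf)$ are exact; (iii) there are natural isomorphisms $\omega : H_n(\Omega A) \to H_{n+1}(A)$ and $\sigma : H_n(A) \to H_{n+1}(\Sigma A)$ $(0 \le n < p)$ such that $\omega_{\Sigma A}\circ H_n(\eta_A) = \sigma_A$ and $H_{n+1}(\varepsilon_A)\circ\sigma_{\Omega A} = \omega_A$, where $\eta : 1 \to \Omega\Sigma$ and $\varepsilon : \Sigma\Omega \to 1$ are the unit and counit. A map is a *weak equivalence* if every $H_n$ $(0\le n\le p)$ sends it to an isomorphism; an object $A$ is *weakly null* if $H_n(A) = 0$ for all $0\le n\le p$. An *h-differential sequence* $(f,g;\alpha)$ consists of maps $f : X \to A$, $g : A \to Y$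 and a homotopy $\alpha : 0 \simeq gf$. It determines $u_\alpha : X \to Kg$ with $kg\cdot u_\alpha = f$, $\kappa g\cdot u_\alpha = \alpha$; $v_\alpha : Cf \to Y$ with $v_\alpha\cdot cf = g$, $v_\alpha\cdot\gamma f = \alpha$; $u : K(cf) \to Kg$ with $kg\cdot u = k(cf)$, $\kappa g\cdot u = v_\alpha\cdot\kappa(cf)$; and $v : Cf \to C(kg)$ with $v\cdot cf = c(kg)$, $v\cdot\gamma f = \gamma(kg)\cdot u_\alpha$. It is *h-exact* if $u$ and $v$ are homotopy equivalences. **Theorem and Definition (weak exactness).** For every h-differential sequence $(f,g;\alpha)$ in $\mathbf A$ the following conditions are equivalent: - (a) $v : Cf \to C(kg)$ is a weak equivalence; - (b) $H_n(u_\alpha) : H_n(X) \to H_n(Kg)$ is an isomorphism for $n < p$ and an epimorphism for $n = p$; - (c) $Cu_\alpha$ is weakly null; - (a') $u : K(cf) \to Kg$ is a weak equivalence; - (b') $H_n(v_\alpha) : H_n(Cf) \to H_n(Y)$ is an isomorphism for $n > 0$ and a monomorphism for $n = 0$; - (c') $Kv_\alpha$ is weakly null. If they hold, the sequence is called *w-exact*.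 Every h-exact sequence is w-exact. Moreover, w-exactness is strictly weaker than h-exactness in the following sense. For every abelian category $\mathbf D$ and every $p\ge 0$, the category $\mathrm{Ch}_0^p\mathbf D$ of chain complexes in $\mathbf D$ concentrated in degrees $0,\dots,p$, with the usual chain homotopies (where parallel homotopies $\alpha,\beta$ are 2-homotopic iff $\beta-\alpha = \partial h - h\partial$ for some maps $h$ of degree $2$) and the usual homology functors $H_0,\dots,H_p$, is an instance of the setting above. If $p \ge 2$ and $\mathbf D$ has a non-split short exact sequence, then in $\mathrm{Ch}_0^p\mathbf D$ there is a w-exact sequence which is not h-exact. -/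

import Mathlib

open CategoryTheory CategoryTheory.Limits

universe w v u v' u'

noncomputable section

namespace HomotopicalCat

/-! ### Categories with homotopies -/

/-- A category with homotopies (an h4-category): a sort of lax 2-category.  The 2-cells, called
homotopies, form types `Htpy X Y` with faces `src`, `tgt` in `X ⟶ Y`.  There are trivial
homotopies `refl`, reverse homotopies `symm`, concatenation of consecutive homotopies, a whisker
composition `whisker u α v` (first `u`, then `α`, then `v`), and an equivalence relation `TwoHtpy`
(2-homotopy) between parallel homotopies.  The whisker composition is strictly functorial and
preserves trivial homotopies; the vertical laws and the reduced interchange hold up to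
2-homotopy. -/
class HCategory (A : Type u) [Category.{v} A] where
  Htpy : A → A → Type w
  src {X Y : A} : Htpy X Y → (X ⟶ Y)
  tgt {X Y : A} : Htpy X Y → (X ⟶ Y)
  refl {X Y : A} : (X ⟶ Y) → Htpy X Y
  symm {X Y : A} : Htpy X Y → Htpy X Y
  concat {X Y : A} (α β : Htpy X Y) (h : tgt α = src β) : Htpy X Y
  whisker {X' X Y Y' : A} (u : X' ⟶ X) (α : Htpy X Y) (v : Y ⟶ Y') : Htpy X' Y'
  TwoHtpy {X Y : A} : Htpy X Y → Htpy X Y → Prop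
  src_refl {X Y : A} (f : X ⟶ Y) : src (refl f) = f
  tgt_refl {X Y : A} (f : X ⟶ Y) : tgt (refl f) = f
  src_symm {X Y : A} (α : Htpy X Y) : src (symm α) = tgt α
  tgt_symm {X Y : A} (α : Htpy X Y) : tgt (symm α) = src α
  src_concat {X Y : A} (α β : Htpy X Y) (h : tgt α = src β) : src (concat α β h) = src α
  tgt_concat {X Y : A} (α β : Htpy X Y) (h : tgt α = src β) : tgt (concat α β h) = tgt β
  src_whisker {X' X Y Y' : A} (u : X' ⟶ X) (α : Htpy X Y) (v : Y ⟶ Y') :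
    src (whisker u α v) = u ≫ src α ≫ v
  tgt_whisker {X' X Y Y' : A} (u : X' ⟶ X) (α : Htpy X Y) (v : Y ⟶ Y') :
    tgt (whisker u α v) = u ≫ tgt α ≫ v
  whisker_id {X Y : A} (α : Htpy X Y) : whisker (𝟙 X) α (𝟙 Y) = α
  whisker_whisker {X'' X' X Y Y' Y'' : A} (u' : X'' ⟶ X') (u : X' ⟶ X) (α : Htpy X Y)
    (v : Y ⟶ Y') (v' : Y' ⟶ Y'') :
    whisker u' (whisker u α v) v' = whisker (u' ≫ u) α (v ≫ v')
  whisker_refl {X' X Y Y' : A} (u : X' ⟶ X) (f : X ⟶ Y) (v : Y ⟶ Y') :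
    whisker u (refl f) v = refl (u ≫ f ≫ v)
  two_equivalence (X Y : A) : Equivalence (TwoHtpy (X := X) (Y := Y))
  two_src {X Y : A} {α β : Htpy X Y} : TwoHtpy α β → src α = src β
  two_tgt {X Y : A} {α β : Htpy X Y} : TwoHtpy α β → tgt α = tgt β
  two_whisker {X' X Y Y' : A} (u : X' ⟶ X) {α β : Htpy X Y} (v : Y ⟶ Y') :
    TwoHtpy α β → TwoHtpy (whisker u α v) (whisker u β v)
  two_concat {X Y : A} {α α' β β' : Htpy X Y} (h : tgt α = src β) (h' : tgt α' = src β') :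
    TwoHtpy α α' → TwoHtpy β β' → TwoHtpy (concat α β h) (concat α' β' h')
  two_assoc {X Y : A} (α β γ : Htpy X Y) (h : tgt α = src β) (k : tgt β = src γ) :
    TwoHtpy (concat (concat α β h) γ ((tgt_concat α β h).trans k))
      (concat α (concat β γ k) (h.trans (src_concat β γ k).symm))
  two_refl_concat {X Y : A} (α : Htpy X Y) :
    TwoHtpy (concat (refl (src α)) α (tgt_refl _)) α
  two_concat_refl {X Y : A} (α : Htpy X Y) :
    TwoHtpy (concat α (refl (tgt α)) (src_refl _).symm) α
  two_concat_symm {X Y : A} (α : Htpy X Y) :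
    TwoHtpy (concat α (symm α) (src_symm α).symm) (refl (src α))
  two_symm_concat {X Y : A} (α : Htpy X Y) :
    TwoHtpy (concat (symm α) α (tgt_symm α)) (refl (tgt α))
  two_whisker_concat {X' X Y Y' : A} (u : X' ⟶ X) (α β : Htpy X Y) (h : tgt α = src β)
    (v : Y ⟶ Y') :
    TwoHtpy (whisker u (concat α β h) v)
      (concat (whisker u α v) (whisker u β v) (by rw [tgt_whisker, src_whisker, h]))
  /-- Reduced interchange: for `α : f ≃ f'` and `β : g ≃ g'` consecutive,
  `gα + βf'` and `βf + g'α` are 2-homotopic. -/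
  two_interchange {X Y Z : A} (α : Htpy X Y) (β : Htpy Y Z) :
    TwoHtpy
      (concat (whisker (𝟙 X) α (src β)) (whisker (tgt α) β (𝟙 Z))
        (by rw [tgt_whisker, src_whisker, Category.id_comp, Category.comp_id]))
      (concat (whisker (src α) β (𝟙 Z)) (whisker (𝟙 X) α (tgt β))
        (by rw [tgt_whisker, src_whisker, Category.id_comp, Category.comp_id]))

open HCategory

section Basic

variable {A : Type u} [Category.{v} A] [HCategory.{w} A]

/-- The whisker composition `α.u` of a map `u` followed by a homotopy `α`. -/
def wl {X' X Y : A} (u : X' ⟶ X) (α : Htpy X Y) : Htpy X' Y := whisker u α (𝟙 Y)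

/-- The whisker composition `v.α` of a homotopy `α` followed by a map `v`. -/
def wr {X Y Y' : A} (α : Htpy X Y) (v : Y ⟶ Y') : Htpy X Y' := whisker (𝟙 X) α v

lemma src_wl {X' X Y : A} (u : X' ⟶ X) (α : Htpy X Y) : src (wl u α) = u ≫ src α := by
  simp [wl, src_whisker]

lemma tgt_wl {X' X Y : A} (u : X' ⟶ X) (α : Htpy X Y) : tgt (wl u α) = u ≫ tgt α := by
  simp [wl, tgt_whisker]

lemma src_wr {X Y Y' : A} (α : Htpy X Y) (v : Y ⟶ Y') : src (wr α v) = src α ≫ v := by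
  simp [wr, src_whisker]

lemma tgt_wr {X Y Y' : A} (α : Htpy X Y) (v : Y ⟶ Y') : tgt (wr α v) = tgt α ≫ v := by
  simp [wr, tgt_whisker]

lemma wl_wl {X'' X' X Y : A} (u' : X'' ⟶ X') (u : X' ⟶ X) (α : Htpy X Y) :
    wl u' (wl u α) = wl (u' ≫ u) α := by
  simp [wl, whisker_whisker]

lemma wr_wr {X Y Y' Y'' : A} (α : Htpy X Y) (v : Y ⟶ Y') (v' : Y' ⟶ Y'') :
    wr (wr α v) v' = wr α (v ≫ v') := by
  simp [wr, whisker_whisker]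

lemma wl_wr {X' X Y Y' : A} (u : X' ⟶ X) (α : Htpy X Y) (v : Y ⟶ Y') :
    wl u (wr α v) = wr (wl u α) v := by
  simp [wl, wr, whisker_whisker]

lemma wl_id {X Y : A} (α : Htpy X Y) : wl (𝟙 X) α = α := whisker_id α

lemma wr_id {X Y : A} (α : Htpy X Y) : wr α (𝟙 Y) = α := whisker_id α

/-- Two maps are homotopic if there is a homotopy between them. -/
def Homotopic {X Y : A} (f g : X ⟶ Y) : Prop := ∃ α : Htpy X Y, src α = f ∧ tgt α = g

/-- Homotopy equivalences. -/
def IsHomotopyEquiv {X Y : A} (f : X ⟶ Y) : Prop :=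
  ∃ g : Y ⟶ X, Homotopic (f ≫ g) (𝟙 X) ∧ Homotopic (g ≫ f) (𝟙 Y)

/-! ### Homotopy kernels and cokernels -/

variable [HasZeroMorphisms A]

/-- A homotopy kernel `(Kf, kf, κf)` of `f`, where `κf : 0 ≃ f.kf`. -/
structure HKernel {X Y : A} (f : X ⟶ Y) where
  obj : A
  ι : obj ⟶ X
  κ : Htpy obj Y
  src_κ : src κ = 0
  tgt_κ : tgt κ = ι ≫ f
  /-- The 1-dimensional universal property. -/
  existsUnique {W : A} (x : W ⟶ X) (ξ : Htpy W Y) (h₀ : src ξ = 0) (h₁ : tgt ξ = x ≫ f) :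
    ∃! m : W ⟶ obj, m ≫ ι = x ∧ wl m κ = ξ
  /-- The 2-dimensional universal property: given `x, y : W ⟶ Kf` and `φ : kf.x ≃ kf.y` with
  `κf.x + f.φ` 2-homotopic to `κf.y`, there is `ψ : x ≃ y` with `kf.ψ = φ`. -/
  exists_htpy {W : A} (x y : W ⟶ obj) (φ : Htpy W X) (h₀ : src φ = x ≫ ι) (h₁ : tgt φ = y ≫ ι)
    (h : TwoHtpy (concat (wl x κ) (wr φ f) (by rw [tgt_wl, src_wr, tgt_κ, h₀, Category.assoc]))
      (wl y κ)) :
    ∃ ψ : Htpy W obj, src ψ = x ∧ tgt ψ = y ∧ wr ψ ι = φ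

/-- A homotopy cokernel `(Cf, cf, γf)` of `f`, where `γf : 0 ≃ cf.f`. -/
structure HCokernel {X Y : A} (f : X ⟶ Y) where
  obj : A
  π : Y ⟶ obj
  γ : Htpy X obj
  src_γ : src γ = 0
  tgt_γ : tgt γ = f ≫ π
  /-- The 1-dimensional universal property. -/
  existsUnique {W : A} (x : Y ⟶ W) (ξ : Htpy X W) (h₀ : src ξ = 0) (h₁ : tgt ξ = f ≫ x) :
    ∃! m : obj ⟶ W, π ≫ m = x ∧ wr γ m = ξ
  /-- The 2-dimensional universal property: given `x, y : Cf ⟶ W` and `φ : x.cf ≃ y.cf` with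
  `x.γf + φ.f` 2-homotopic to `y.γf`, there is `ψ : x ≃ y` with `ψ.cf = φ`. -/
  exists_htpy {W : A} (x y : obj ⟶ W) (φ : Htpy Y W) (h₀ : src φ = π ≫ x) (h₁ : tgt φ = π ≫ y)
    (h : TwoHtpy (concat (wr γ x) (wl f φ) (by rw [tgt_wr, src_wl, tgt_γ, h₀, Category.assoc]))
      (wr γ y)) :
    ∃ ψ : Htpy obj W, src ψ = x ∧ tgt ψ = y ∧ wl π ψ = φ

/-- The map into a homotopy kernel determined by `x : W ⟶ X` and `ξ : 0 ≃ f.x`. -/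
def HKernel.lift {X Y : A} {f : X ⟶ Y} (K : HKernel f) {W : A} (x : W ⟶ X) (ξ : Htpy W Y)
    (h₀ : src ξ = 0) (h₁ : tgt ξ = x ≫ f) : W ⟶ K.obj :=
  (K.existsUnique x ξ h₀ h₁).choose

lemma HKernel.lift_ι {X Y : A} {f : X ⟶ Y} (K : HKernel f) {W : A} (x : W ⟶ X) (ξ : Htpy W Y)
    (h₀ : src ξ = 0) (h₁ : tgt ξ = x ≫ f) : K.lift x ξ h₀ h₁ ≫ K.ι = x :=
  (K.existsUnique x ξ h₀ h₁).choose_spec.1.1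

lemma HKernel.lift_κ {X Y : A} {f : X ⟶ Y} (K : HKernel f) {W : A} (x : W ⟶ X) (ξ : Htpy W Y)
    (h₀ : src ξ = 0) (h₁ : tgt ξ = x ≫ f) : wl (K.lift x ξ h₀ h₁) K.κ = ξ :=
  (K.existsUnique x ξ h₀ h₁).choose_spec.1.2

lemma HKernel.hom_ext {X Y : A} {f : X ⟶ Y} (K : HKernel f) {W : A} {m n : W ⟶ K.obj}
    (h : m ≫ K.ι = n ≫ K.ι) (h' : wl m K.κ = wl n K.κ) : m = n :=
  (K.existsUnique (n ≫ K.ι) (wl n K.κ) (by rw [src_wl, K.src_κ, comp_zero])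
    (by rw [tgt_wl, K.tgt_κ, Category.assoc])).unique ⟨h, h'⟩ ⟨rfl, rfl⟩

/-- The map out of a homotopy cokernel determined by `x : Y ⟶ W` and `ξ : 0 ≃ x.f`. -/
def HCokernel.desc {X Y : A} {f : X ⟶ Y} (C : HCokernel f) {W : A} (x : Y ⟶ W) (ξ : Htpy X W)
    (h₀ : src ξ = 0) (h₁ : tgt ξ = f ≫ x) : C.obj ⟶ W :=
  (C.existsUnique x ξ h₀ h₁).choose

lemma HCokernel.π_desc {X Y : A} {f : X ⟶ Y} (C : HCokernel f) {W : A} (x : Y ⟶ W)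
    (ξ : Htpy X W) (h₀ : src ξ = 0) (h₁ : tgt ξ = f ≫ x) : C.π ≫ C.desc x ξ h₀ h₁ = x :=
  (C.existsUnique x ξ h₀ h₁).choose_spec.1.1

lemma HCokernel.γ_desc {X Y : A} {f : X ⟶ Y} (C : HCokernel f) {W : A} (x : Y ⟶ W)
    (ξ : Htpy X W) (h₀ : src ξ = 0) (h₁ : tgt ξ = f ≫ x) : wr C.γ (C.desc x ξ h₀ h₁) = ξ :=
  (C.existsUnique x ξ h₀ h₁).choose_spec.1.2

lemma HCokernel.hom_ext {X Y : A} {f : X ⟶ Y} (C : HCokernel f) {W : A} {m n : C.obj ⟶ W}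
    (h : C.π ≫ m = C.π ≫ n) (h' : wr C.γ m = wr C.γ n) : m = n :=
  (C.existsUnique (C.π ≫ n) (wr C.γ n) (by rw [src_wr, C.src_γ, zero_comp])
    (by rw [tgt_wr, C.tgt_γ, Category.assoc])).unique ⟨h, h'⟩ ⟨rfl, rfl⟩

end Basic

/-- A pointed homotopical category: a category with homotopies, with a zero object which is also
2-dimensionally terminal and initial, and with (chosen) homotopy kernels and cokernels of all
maps. -/
class PointedHomotopicalCategory (A : Type u) [Category.{v} A] [HCategory.{w} A]
    [HasZeroMorphisms A] [HasZeroObject A] where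
  htpy_to_zero {X Z : A} (hZ : IsZero Z) (α : Htpy X Z) : α = refl (src α)
  htpy_from_zero {X Z : A} (hZ : IsZero Z) (α : Htpy Z X) : α = refl (src α)
  hker {X Y : A} (f : X ⟶ Y) : HKernel f
  hcok {X Y : A} (f : X ⟶ Y) : HCokernel f

open PointedHomotopicalCategory

open scoped ZeroObject

section Pointed

variable {A : Type u} [Category.{v} A] [HCategory.{w} A] [HasZeroMorphisms A] [HasZeroObject A]
  [PointedHomotopicalCategory A]

/-! ### Loops and suspension -/

/-- The homotopy kernel of `0 ⟶ B`, i.e. the loop-object of `B` with `ω_B : 0 ≃ 0 : ΩB ⟶ B`. -/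
abbrev hloop (B : A) : HKernel (0 : (0 : A) ⟶ B) := hker _

/-- The homotopy cokernel of `B ⟶ 0`, i.e. the suspension of `B` with `σ_B : 0 ≃ 0 : B ⟶ ΣB`. -/
abbrev hsusp (B : A) : HCokernel (0 : B ⟶ (0 : A)) := hcok _

/-- The map into `ΩB` determined by a homotopy `ξ : 0 ≃ 0 : W ⟶ B`. -/
def loopLift {W B : A} (ξ : Htpy W B) (h₀ : src ξ = 0) (h₁ : tgt ξ = 0) : W ⟶ (hloop B).obj :=
  (hloop B).lift 0 ξ h₀ (by rw [h₁, zero_comp])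

lemma loopLift_κ {W B : A} (ξ : Htpy W B) (h₀ : src ξ = 0) (h₁ : tgt ξ = 0) :
    wl (loopLift ξ h₀ h₁) (hloop B).κ = ξ :=
  HKernel.lift_κ _ _ _ _ _

lemma loop_hom_ext {W B : A} {m n : W ⟶ (hloop B).obj}
    (h : wl m (hloop B).κ = wl n (hloop B).κ) : m = n :=
  (hloop B).hom_ext ((isZero_zero A).eq_of_tgt _ _) h

/-- The map out of `ΣB` determined by a homotopy `ξ : 0 ≃ 0 : B ⟶ W`. -/
def suspDesc {B W : A} (ξ : Htpy B W) (h₀ : src ξ = 0) (h₁ : tgt ξ = 0) : (hsusp B).obj ⟶ W :=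
  (hsusp B).desc 0 ξ h₀ (by rw [h₁, comp_zero])

lemma γ_suspDesc {B W : A} (ξ : Htpy B W) (h₀ : src ξ = 0) (h₁ : tgt ξ = 0) :
    wr (hsusp B).γ (suspDesc ξ h₀ h₁) = ξ :=
  HCokernel.γ_desc _ _ _ _ _

lemma susp_hom_ext {B W : A} {m n : (hsusp B).obj ⟶ W}
    (h : wr (hsusp B).γ m = wr (hsusp B).γ n) : m = n :=
  (hsusp B).hom_ext ((isZero_zero A).eq_of_src _ _) h

lemma tgt_loop (B : A) : tgt (hloop B).κ = 0 := by rw [HKernel.tgt_κ, comp_zero]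

lemma tgt_susp (B : A) : tgt (hsusp B).γ = 0 := by rw [HCokernel.tgt_γ, zero_comp]

variable (A) in
/-- The loop functor `Ω`; `Ωf` is determined by `ω_Y.Ωf = f.ω_X`. -/
@[simps]
def loop : A ⥤ A where
  obj B := (hloop B).obj
  map {X Y} f := loopLift (wr (hloop X).κ f) (by rw [src_wr, HKernel.src_κ, zero_comp])
    (by rw [tgt_wr, tgt_loop, zero_comp])
  map_id X := loop_hom_ext (by rw [loopLift_κ, wr_id, wl_id])
  map_comp f g := loop_hom_ext (by
    rw [loopLift_κ, ← wl_wl, loopLift_κ, wl_wr, loopLift_κ, wr_wr])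

variable (A) in
/-- The suspension functor `Σ`; `Σf` is determined by `Σf.σ_X = σ_Y.f`. -/
@[simps]
def susp : A ⥤ A where
  obj B := (hsusp B).obj
  map {X Y} f := suspDesc (wl f (hsusp Y).γ) (by rw [src_wl, HCokernel.src_γ, comp_zero])
    (by rw [tgt_wl, tgt_susp, comp_zero])
  map_id X := susp_hom_ext (by rw [γ_suspDesc, wr_id, wl_id])
  map_comp f g := susp_hom_ext (by
    rw [γ_suspDesc, ← wr_wr, γ_suspDesc, ← wl_wr, γ_suspDesc, wl_wl])

/-- The unit `X ⟶ ΩΣX` of the suspension-loop adjunction. -/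
def loopUnit (X : A) : X ⟶ (loop A).obj ((susp A).obj X) :=
  loopLift (hsusp X).γ (HCokernel.src_γ _) (tgt_susp X)

/-- The counit `ΣΩX ⟶ X` of the suspension-loop adjunction. -/
def loopCounit (X : A) : (susp A).obj ((loop A).obj X) ⟶ X :=
  suspDesc (hloop X).κ (HKernel.src_κ _) (tgt_loop X)

variable (A) in
/-- The condition `Ω^{p+1} = 0 = Σ^{p+1}`. -/
def LoopSuspNilpotent (p : ℕ) : Prop :=
  ∀ X : A, IsZero ((loop A).obj^[p + 1] X) ∧ IsZero ((susp A).obj^[p + 1] X)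

/-! ### Homology theories -/

variable (A) in
/-- A homology theory `H_0, …, H_p` on a pointed homotopical category, with values in an abelian
category: homotopy invariance, exactness and stability. -/
structure HomologyTheory (D : Type u') [Category.{v'} D] [Abelian D] (p : ℕ) where
  H : Fin (p + 1) → (A ⥤ D)
  homotopy_invariance (n : Fin (p + 1)) {X Y : A} {f g : X ⟶ Y} :
    Homotopic f g → (H n).map f = (H n).map g
  /-- `H_0(Kf) ⟶ H_0(X) ⟶ H_0(Y)` is exact. -/
  exact_hker {X Y : A} (f : X ⟶ Y) :
    ∃ h : (H 0).map (hker f).ι ≫ (H 0).map f = 0,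
      (ShortComplex.mk ((H 0).map (hker f).ι) ((H 0).map f) h).Exact
  /-- `H_p(X) ⟶ H_p(Y) ⟶ H_p(Cf)` is exact. -/
  exact_hcok {X Y : A} (f : X ⟶ Y) :
    ∃ h : (H (Fin.last p)).map f ≫ (H (Fin.last p)).map (hcok f).π = 0,
      (ShortComplex.mk ((H (Fin.last p)).map f) ((H (Fin.last p)).map (hcok f).π) h).Exact
  /-- `H_n(ΩX) ≅ H_{n+1}(X)` for `0 ≤ n < p`. -/
  ω (n : Fin p) : loop A ⋙ H n.castSucc ≅ H n.succ
  /-- `H_n(X) ≅ H_{n+1}(ΣX)` for `0 ≤ n < p`. -/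
  σ (n : Fin p) : H n.castSucc ≅ susp A ⋙ H n.succ
  unit_ω (n : Fin p) (X : A) :
    (H n.castSucc).map (loopUnit X) ≫ (ω n).hom.app ((susp A).obj X) = (σ n).hom.app X
  σ_counit (n : Fin p) (X : A) :
    (σ n).hom.app ((loop A).obj X) ≫ (H n.succ).map (loopCounit X) = (ω n).hom.app X

section Weak

variable {D : Type u'} [Category.{v'} D] [Abelian D] {p : ℕ}

/-- Weak equivalences with respect to `H_0, …, H_p`. -/
def IsWeakEquiv (H : Fin (p + 1) → (A ⥤ D)) {X Y : A} (f : X ⟶ Y) : Prop :=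
  ∀ n, IsIso ((H n).map f)

/-- Weakly null objects with respect to `H_0, …, H_p`. -/
def IsWeaklyNull (H : Fin (p + 1) → (A ⥤ D)) (X : A) : Prop :=
  ∀ n, IsZero ((H n).obj X)

end Weak

/-! ### Homotopically differential sequences -/

variable (A) in
/-- An h-differential sequence `(f, g; α)`, with `α : 0 ≃ gf`. -/
structure HDiffSeq where
  (X M Y : A)
  f : X ⟶ M
  g : M ⟶ Y
  α : Htpy X Y
  src_α : src α = 0
  tgt_α : tgt α = f ≫ g

namespace HDiffSeq

variable (S : HDiffSeq A)

/-- `u_α : X ⟶ Kg`, with `kg.u_α = f` and `κg.u_α = α`. -/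
def uα : S.X ⟶ (hker S.g).obj := (hker S.g).lift S.f S.α S.src_α S.tgt_α

/-- `v_α : Cf ⟶ Y`, with `v_α.cf = g` and `v_α.γf = α`. -/
def vα : (hcok S.f).obj ⟶ S.Y := (hcok S.f).desc S.g S.α S.src_α S.tgt_α

/-- `u = k(v_α) : Kcf ⟶ Kg`, with `kg.u = kcf` and `κg.u = v_α.κcf`. -/
def u : (hker (hcok S.f).π).obj ⟶ (hker S.g).obj :=
  (hker S.g).lift (hker (hcok S.f).π).ι (wr (hker (hcok S.f).π).κ S.vα)
    (by rw [src_wr, HKernel.src_κ, zero_comp])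
    (by rw [tgt_wr, HKernel.tgt_κ, Category.assoc, vα, HCokernel.π_desc])

/-- `v = c(u_α) : Cf ⟶ Ckg`, with `v.cf = ckg` and `v.γf = γkg.u_α`. -/
def v : (hcok S.f).obj ⟶ (hcok (hker S.g).ι).obj :=
  (hcok S.f).desc (hcok (hker S.g).ι).π (wl S.uα (hcok (hker S.g).ι).γ)
    (by rw [src_wl, HCokernel.src_γ, comp_zero])
    (by rw [tgt_wl, HCokernel.tgt_γ, ← Category.assoc, uα, HKernel.lift_ι])

/-- The sequence is h-exact if `u` and `v` are homotopy equivalences. -/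
def HExact : Prop := IsHomotopyEquiv S.u ∧ IsHomotopyEquiv S.v

/-- The sequence is w-exact with respect to `H_0, …, H_p` if `v` is a weak equivalence. -/
def WExact {D : Type u'} [Category.{v'} D] [Abelian D] {p : ℕ} (H : Fin (p + 1) → (A ⥤ D)) :
    Prop := IsWeakEquiv H S.v

end HDiffSeq

end Pointed

/-! ### Chain complexes in degrees `0, …, p` -/

section Chain

variable (D : Type u) [Category.{v} D] [Abelian D] (p : ℕ)

/-- Chain complexes null outside the degrees `0, …, p`. -/
def boundedProp : ObjectProperty (ChainComplex D ℕ) := fun X => ∀ n, p < n → IsZero (X.X n)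

/-- The category `Ch_0^p D` of chain complexes in degrees `0, …, p`. -/
abbrev BoundedCh := (boundedProp D p).FullSubcategory

instance : (boundedProp D p).ContainsZero where
  exists_zero := ⟨0, isZero_zero _, fun n _ =>
    (HomologicalComplex.eval D _ n).map_isZero (isZero_zero _)⟩

/-- The homology functors `H_0, …, H_p` of `Ch_0^p D`. -/
def boundedHomology (n : Fin (p + 1)) : BoundedCh D p ⥤ D :=
  (boundedProp D p).ι ⋙ HomologicalComplex.homologyFunctor D (ComplexShape.down ℕ) n

variable {D p}

/-- The usual homotopies of chain maps, with their faces: `tgt - src = dα + αd`. -/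
structure ChHtpy (X Y : BoundedCh D p) where
  src : X ⟶ Y
  tgt : X ⟶ Y
  htpy : Homotopy tgt.hom src.hom

/-- 2-homotopy of chain homotopies: they have the same faces, and their difference is `hd - dh`
for a family `h` of maps `X_n ⟶ Y_{n+2}` (for `n = 0`, the map `X.d 0 (0 - 1)` is zero). -/
def ChTwoHtpy {X Y : BoundedCh D p} (α β : ChHtpy X Y) : Prop :=
  α.src = β.src ∧ α.tgt = β.tgt ∧
    ∃ h : ∀ i j : ℕ, X.obj.X i ⟶ Y.obj.X j, ∀ n,
      β.htpy.hom n (n + 1) - α.htpy.hom n (n + 1) =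
        h n (n + 2) ≫ Y.obj.d (n + 2) (n + 1) - X.obj.d n (n - 1) ≫ h (n - 1) (n + 1)

lemma ChHtpy.ext' {X Y : BoundedCh D p} {α β : ChHtpy X Y} (h₀ : α.src = β.src)
    (h₁ : α.tgt = β.tgt) (h : ∀ n, α.htpy.hom n (n + 1) = β.htpy.hom n (n + 1)) : α = β := by
  obtain ⟨s, t, a⟩ := α
  obtain ⟨s', t', b⟩ := β
  dsimp at h₀ h₁
  subst h₀ h₁
  congr 1
  ext i j
  by_cases hij : (ComplexShape.down ℕ).Rel j i
  · have : i + 1 = j := hij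
    subst this
    exact h i
  · rw [a.zero i j hij, b.zero i j hij]

instance : HCategory (BoundedCh D p) where
  Htpy := ChHtpy
  src α := α.src
  tgt α := α.tgt
  refl f := ⟨f, f, Homotopy.refl _⟩
  symm α := ⟨α.tgt, α.src, α.htpy.symm⟩
  concat α β h := ⟨α.src, β.tgt, β.htpy.trans ((Homotopy.ofEq (by rw [h])).trans α.htpy)⟩
  whisker u α v := ⟨u ≫ α.src ≫ v, u ≫ α.tgt ≫ v, (α.htpy.compRight v.hom).compLeft u.hom⟩
  TwoHtpy := ChTwoHtpy
  src_refl _ := rfl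
  tgt_refl _ := rfl
  src_symm _ := rfl
  tgt_symm _ := rfl
  src_concat _ _ _ := rfl
  tgt_concat _ _ _ := rfl
  src_whisker _ _ _ := rfl
  tgt_whisker _ _ _ := rfl
  whisker_id α := ChHtpy.ext' (by simp) (by simp) (by simp)
  whisker_whisker u' u α v v' := ChHtpy.ext' (by simp) (by simp) (by simp)
  whisker_refl u f v := ChHtpy.ext' (by simp) (by simp) (by simp)
  two_equivalence X Y :=
    { refl := fun α => ⟨rfl, rfl, fun _ _ => 0, fun n => by simp⟩
      symm := by
        rintro α β ⟨h₀, h₁, h, hh⟩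
        refine ⟨h₀.symm, h₁.symm, fun i j => - h i j, fun n => ?_⟩
        rw [← neg_sub, hh]
        simp only [Preadditive.neg_comp, Preadditive.comp_neg]
        abel
      trans := by
        rintro α β γ ⟨h₀, h₁, h, hh⟩ ⟨k₀, k₁, k, kk⟩
        refine ⟨h₀.trans k₀, h₁.trans k₁, fun i j => h i j + k i j, fun n => ?_⟩
        rw [← sub_add_sub_cancel _ (β.htpy.hom n (n + 1)), hh, kk]
        simp only [Preadditive.add_comp, Preadditive.comp_add]
        abel }
  two_src h := h.1
  two_tgt h := h.2.1
  two_whisker := by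
    rintro X' X Y Y' u α β v ⟨h₀, h₁, h, hh⟩
    refine ⟨by simp only [h₀], by simp only [h₁],
      fun i j => u.hom.f i ≫ h i j ≫ v.hom.f j, fun n => ?_⟩
    have := congrArg (fun z => u.hom.f n ≫ z ≫ v.hom.f (n + 1)) (hh n)
    simpa [Preadditive.sub_comp, Preadditive.comp_sub] using this
  two_concat := by
    rintro X Y α α' β β' h h' ⟨a₀, a₁, a, aa⟩ ⟨b₀, b₁, b, bb⟩
    refine ⟨a₀, b₁, fun i j => a i j + b i j, fun n => ?_⟩
    have e1 := aa n
    have e2 := bb n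
    simp only [Homotopy.trans_hom, Homotopy.ofEq_hom, Pi.zero_apply, zero_add,
      Preadditive.add_comp, Preadditive.comp_add]
    rw [add_sub_add_comm, e1, e2]
    abel
  two_assoc α β γ h k := ⟨rfl, rfl, fun _ _ => 0, fun n => by simp; abel⟩
  two_refl_concat α := ⟨rfl, rfl, fun _ _ => 0, fun n => by simp⟩
  two_concat_refl α := ⟨rfl, rfl, fun _ _ => 0, fun n => by simp⟩
  two_concat_symm α := ⟨rfl, rfl, fun _ _ => 0, fun n => by simp⟩
  two_symm_concat α := ⟨rfl, rfl, fun _ _ => 0, fun n => by simp⟩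
  two_whisker_concat u α β h v := ⟨rfl, rfl, fun _ _ => 0, fun n => by simp⟩
  two_interchange {X Y Z} α β := by
    refine ⟨by simp, by simp, fun i j => α.htpy.hom i (i + 1) ≫ β.htpy.hom (i + 1) j,
      fun n => ?_⟩
    have e1 := α.htpy.comm n
    have e2 := β.htpy.comm (n + 1)
    rw [dNext_nat, prevD_eq _ (show (ComplexShape.down ℕ).Rel (n + 1) n from rfl)] at e1
    rw [dNext_eq _ (show (ComplexShape.down ℕ).Rel (n + 1) n from rfl),
      prevD_eq _ (show (ComplexShape.down ℕ).Rel (n + 2) (n + 1) from rfl)] at e2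
    have e3 : X.obj.d n (n - 1) ≫ α.htpy.hom (n - 1) (n - 1 + 1) ≫
        β.htpy.hom (n - 1 + 1) (n + 1) =
        X.obj.d n (n - 1) ≫ α.htpy.hom (n - 1) n ≫ β.htpy.hom n (n + 1) := by
      cases n <;> simp
    simp [e1, e2, e3]
    abel

end Chain

end HomotopicalCat

end

open HomotopicalCat PointedHomotopicalCategory

/-! The assumptions give exactness on homotopy kernels only for H_0 and on homotopy cokernels only
for H_p, but stability spreads both to every degree. Since H_{n+1} is H_n∘Ω, and K(Ωg) → ΩM factors
through Ω(kg), kernel exactness climbs from H_0 (`KerExact.of_loop`, `HomologyTheory.kerExact`);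
dually, cokernel exactness descends from H_p. Iterated homotopy kernels and cokernels then show that
each single H_n is exact on ΩM → ΩY → Kg → M → Y and on X → M → Cf → ΣX → ΣM, while nilpotency gives
H_p∘Ω = 0 = H_0∘Σ.

The heart of the matter is the comparison C(kg) → Y, which is an isomorphism on H_n for n > 0
(`isIso_map_cokKerDesc`) and a monomorphism on H_0; dually X → K(cf) is an isomorphism for n < p and
an epimorphism on H_p. This is where ω and σ must be linked by the unit and counit: the link makes
H_{n+1}(ε) and H_n(η) invertible, and ε factors through C(kg), η through K(cf).

As v_α is v followed by C(kg) → Y, (a) is equivalent to (b'); as u_α is X → K(cf) followed by u,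
(a') is equivalent to (b). The exact sequences of u_α and v_α give (b) ⇔ (c) and (b') ⇔ (c'). The
two halves are joined by (a) ⇔ (b), which is the four lemma on the map of cofibre sequences from
that of f to that of kg, with components u_α, 1, v, Σu_α, 1.

For complexes in degrees 0, …, p, the homotopy kernel is the usual X_n ⊕ Y_{n+1} cut down in degree
0, and the homotopy cokernel is Y_n ⊕ X_{n-1} with a quotient in degree p. A homotopy 0 ≃ 0 induces
a map raising the homology degree by one (`loopHom`); the universal ones give ω and σ.

The counterexample is 0 → M → 0: being w-exact follows from M being acyclic, whereas h-exact forces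
M to be contractible. A non-split short exact sequence, placed in degrees 2, 1, 0, is acyclic but
not contractible. -/

noncomputable section

namespace HomotopicalCat

/-! ### Exact pairs and diagram chases in an abelian category. -/

section Exact

variable {D : Type u'} [Category.{v'} D] [Abelian D]

/-- Two consecutive morphisms of an abelian category form an exact sequence. -/
def IsExactPair {X Y Z : D} (f : X ⟶ Y) (g : Y ⟶ Z) : Prop :=
  ∃ h : f ≫ g = 0, (ShortComplex.mk f g h).Exact

namespace IsExactPair

variable {X Y Z : D} {f : X ⟶ Y} {g : Y ⟶ Z}

lemma zero (h : IsExactPair f g) : f ≫ g = 0 := h.1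

/-- Elements are replaced by maps from a test object, and a lift exists only after an epimorphic
change of that object. The diagram chases rest on this. -/
lemma exists_lift (h : IsExactPair f g) {T : D} (x : T ⟶ Y) (hx : x ≫ g = 0) :
    ∃ (T' : D) (π : T' ⟶ T) (_ : Epi π) (y : T' ⟶ X), π ≫ x = y ≫ f :=
  h.2.exact_up_to_refinements x hx

lemma of_exists_lift (h₀ : f ≫ g = 0)
    (h : ∀ ⦃T : D⦄ (x : T ⟶ Y), x ≫ g = 0 →
      ∃ (T' : D) (π : T' ⟶ T) (_ : Epi π) (y : T' ⟶ X), π ≫ x = y ≫ f) : IsExactPair f g :=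
  ⟨h₀, (ShortComplex.exact_iff_exact_up_to_refinements _).2 h⟩

lemma op (h : IsExactPair f g) : IsExactPair g.op f.op :=
  ⟨by rw [← op_comp, h.zero, op_zero], h.2.op⟩

lemma unop {X Y Z : Dᵒᵖ} {f : X ⟶ Y} {g : Y ⟶ Z} (h : IsExactPair f g) :
    IsExactPair g.unop f.unop :=
  ⟨by rw [← unop_comp, h.zero, unop_zero], h.2.unop⟩

/-- If `ker g` is covered by a map factoring through `f`, then `(f, g)` is exact. -/
lemma of_factor_left (h : IsExactPair f g) {X' : D} {f' : X' ⟶ Y} (b : X ⟶ X')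
    (hb : b ≫ f' = f) (h₀ : f' ≫ g = 0) : IsExactPair f' g :=
  of_exists_lift h₀ fun T x hx => by
    obtain ⟨T', π, hπ, y, hy⟩ := h.exists_lift x hx
    exact ⟨T', π, hπ, y ≫ b, by rw [hy, Category.assoc, hb]⟩

/-- The opposite of `of_factor_left`. These two transfer exactness from an iterated homotopy kernel
or cokernel to a loop-object or suspension. -/
lemma of_factor_right (h : IsExactPair f g) {Z' : D} {g' : Y ⟶ Z'} (b : Z' ⟶ Z)
    (hb : g' ≫ b = g) (h₀ : f ≫ g' = 0) : IsExactPair f g' :=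
  (h.op.of_factor_left (f' := g'.op) b.op (by rw [← op_comp, hb])
    (by rw [← op_comp, h₀, op_zero])).unop

lemma of_iso (h : IsExactPair f g) {X' Y' Z' : D} {f' : X' ⟶ Y'} {g' : Y' ⟶ Z'}
    (e₁ : X ≅ X') (e₂ : Y ≅ Y') (e₃ : Z ≅ Z') (h₁ : e₁.hom ≫ f' = f ≫ e₂.hom)
    (h₂ : e₂.hom ≫ g' = g ≫ e₃.hom) : IsExactPair f' g' := by
  have h₀ : f' ≫ g' = 0 := by
    rw [← cancel_epi e₁.hom, reassoc_of% h₁, h₂, reassoc_of% h.zero, zero_comp, comp_zero]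
  exact ⟨h₀, ShortComplex.exact_of_iso (S₁ := ShortComplex.mk f g h.zero)
    (ShortComplex.isoMk e₁ e₂ e₃ h₁ h₂) h.2⟩

lemma mono_of_zero (h : IsExactPair f g) (hf : f = 0) : Mono g := by
  subst hf
  exact h.2.mono_g rfl

lemma epi_of_zero (h : IsExactPair f g) (hg : g = 0) : Epi f := by
  subst hg
  exact h.2.epi_f rfl

lemma isZero_of_zero (h : IsExactPair f g) (hf : f = 0) (hg : g = 0) : IsZero Y := by
  have := h.mono_of_zero hf
  rw [IsZero.iff_id_eq_zero, ← cancel_mono g, hg, comp_zero, comp_zero]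

lemma eq_zero_of_epi (h : IsExactPair f g) [Epi f] : g = 0 := by
  rw [← cancel_epi f, h.zero, comp_zero]

lemma eq_zero_of_mono (h : IsExactPair f g) [Mono g] : f = 0 := by
  rw [← cancel_mono g, h.zero, zero_comp]

end IsExactPair

/-- The four lemma, for monomorphisms. -/
lemma mono_of_four {X₁ X₂ X₃ X₄ Y₁ Y₂ Y₃ Y₄ : D} {f₁ : X₁ ⟶ X₂} {f₂ : X₂ ⟶ X₃} {f₃ : X₃ ⟶ X₄}
    {g₁ : Y₁ ⟶ Y₂} {g₂ : Y₂ ⟶ Y₃} {g₃ : Y₃ ⟶ Y₄} {a₁ : X₁ ⟶ Y₁} {a₂ : X₂ ⟶ Y₂} {a₃ : X₃ ⟶ Y₃}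
    {a₄ : X₄ ⟶ Y₄} (hX : f₁ ≫ f₂ = 0) (hX' : IsExactPair f₂ f₃) (hY : IsExactPair g₁ g₂)
    (h₁ : f₁ ≫ a₂ = a₁ ≫ g₁) (h₂ : f₂ ≫ a₃ = a₂ ≫ g₂) (h₃ : f₃ ≫ a₄ = a₃ ≫ g₃)
    (_ : Epi a₁) (_ : Mono a₂) (_ : Mono a₄) : Mono a₃ := by
  rw [Preadditive.mono_iff_cancel_zero]
  intro T x hx
  obtain ⟨T₁, π₁, _, y, hy⟩ := hX'.exists_lift x (by
    rw [← cancel_mono a₄, Category.assoc, h₃, reassoc_of% hx, zero_comp, zero_comp])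
  obtain ⟨T₂, π₂, _, z, hz⟩ := hY.exists_lift (y ≫ a₂) (by
    rw [Category.assoc, ← h₂, ← reassoc_of% hy, hx, comp_zero])
  obtain ⟨T₃, π₃, _, t, ht⟩ := surjective_up_to_refinements_of_epi a₁ z
  have : π₃ ≫ π₂ ≫ y = t ≫ f₁ := by
    rw [← cancel_mono a₂, Category.assoc, Category.assoc, hz, reassoc_of% ht, Category.assoc, h₁]
  rw [← cancel_epi π₁, ← cancel_epi π₂, ← cancel_epi π₃, hy, reassoc_of% this, hX]
  simp only [comp_zero]

/-- The four lemma, for epimorphisms. -/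
lemma epi_of_four {X₁ X₂ X₃ X₄ Y₁ Y₂ Y₃ Y₄ : D} {f₁ : X₁ ⟶ X₂} {f₂ : X₂ ⟶ X₃} {f₃ : X₃ ⟶ X₄}
    {g₁ : Y₁ ⟶ Y₂} {g₂ : Y₂ ⟶ Y₃} {g₃ : Y₃ ⟶ Y₄} {a₁ : X₁ ⟶ Y₁} {a₂ : X₂ ⟶ Y₂} {a₃ : X₃ ⟶ Y₃}
    {a₄ : X₄ ⟶ Y₄} (hX : IsExactPair f₂ f₃) (hY : IsExactPair g₁ g₂) (hY' : g₂ ≫ g₃ = 0)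
    (h₁ : f₁ ≫ a₂ = a₁ ≫ g₁) (h₂ : f₂ ≫ a₃ = a₂ ≫ g₂) (h₃ : f₃ ≫ a₄ = a₃ ≫ g₃)
    (_ : Epi a₁) (_ : Epi a₃) (_ : Mono a₄) : Epi a₂ := by
  have : Mono a₂.op := mono_of_four (f₁ := g₃.op) (f₂ := g₂.op) (f₃ := g₁.op) (g₁ := f₃.op)
    (g₂ := f₂.op) (g₃ := f₁.op) (a₁ := a₄.op) (a₂ := a₃.op) (a₄ := a₁.op)
    (by rw [← op_comp, hY', op_zero]) hY.op hX.op
    (by rw [← op_comp, ← op_comp, h₃]) (by rw [← op_comp, ← op_comp, h₂])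
    (by rw [← op_comp, ← op_comp, h₁]) inferInstance inferInstance inferInstance
  exact unop_epi_of_mono a₂.op

/-- Comparison of the cokernel-type object `C` of `k` with the target of `g`, where `k` is of
kernel type with respect to `g`. -/
lemma isIso_of_comparison {K M Y C S S' L : D} {k : K ⟶ M} {g : M ⟶ Y} {c : M ⟶ C} {w : C ⟶ Y}
    {d : C ⟶ S} {δ : S ⟶ S'} {j : L ⟶ C} {s : L ⟶ S} {e : L ⟶ Y} [IsIso e]
    (hkg : IsExactPair k g) (hcd : IsExactPair c d) (hdδ : d ≫ δ = 0) (hsδ : IsExactPair s δ)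
    (hkc : k ≫ c = 0) (hcw : c ≫ w = g) (hjw : j ≫ w = e) (hjd : j ≫ d = s)
    (hgs : g ≫ inv e ≫ s = 0) : IsIso w := by
  -- Every element of C is locally a sum of one from M and one from L, and the formula is checked on
  -- both parts: `hgs` kills the first, and on the second it reads j ≫ d = s.
  have hd : d = w ≫ inv e ≫ s := by
    obtain ⟨T₁, π₁, _, l, hl⟩ := hsδ.exists_lift d hdδ
    obtain ⟨T₂, π₂, _, z, hz⟩ := hcd.exists_lift (π₁ - l ≫ j) (by
      rw [Preadditive.sub_comp, hl, Category.assoc, hjd, sub_self])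
    have h₁ : π₂ ≫ π₁ = z ≫ c + π₂ ≫ l ≫ j := by
      rw [← hz, Preadditive.comp_sub, sub_add_cancel]
    have h₂ : π₂ ≫ π₁ ≫ w = z ≫ g + π₂ ≫ l ≫ e := by
      rw [← Category.assoc, h₁]
      simp only [Preadditive.add_comp, Category.assoc, hcw, hjw]
    have h₃ := h₂ =≫ (inv e ≫ s)
    simp only [Preadditive.add_comp, Category.assoc, hgs, comp_zero, zero_add,
      IsIso.hom_inv_id_assoc] at h₃
    rw [← cancel_epi π₁, ← cancel_epi π₂, hl, h₃]
  have : Epi w := epi_of_epi_fac hjw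
  have : Mono w := by
    rw [Preadditive.mono_iff_cancel_zero]
    intro T x hx
    obtain ⟨T₁, π₁, _, z, hz⟩ := hcd.exists_lift x (by rw [hd, reassoc_of% hx, zero_comp])
    obtain ⟨T₂, π₂, _, t, ht⟩ := hkg.exists_lift z (by
      rw [← hcw, ← reassoc_of% hz, hx, comp_zero])
    rw [← cancel_epi π₁, ← cancel_epi π₂, hz, reassoc_of% ht, hkc]
    simp only [comp_zero]
  exact isIso_of_mono_of_epi w

/-- With c epi, elements of C lift directly to M, so no connecting map has to be controlled. This
serves degree 0. -/
lemma mono_of_comparison {K M Y C : D} {k : K ⟶ M} {g : M ⟶ Y} {c : M ⟶ C} {w : C ⟶ Y}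
    (hkg : IsExactPair k g) [Epi c] (hkc : k ≫ c = 0) (hcw : c ≫ w = g) : Mono w := by
  rw [Preadditive.mono_iff_cancel_zero]
  intro T x hx
  obtain ⟨T₁, π₁, _, z, hz⟩ := surjective_up_to_refinements_of_epi c x
  obtain ⟨T₂, π₂, _, t, ht⟩ := hkg.exists_lift z (by
    rw [← hcw, ← reassoc_of% hz, hx, comp_zero])
  rw [← cancel_epi π₁, ← cancel_epi π₂, hz, reassoc_of% ht, hkc]
  simp only [comp_zero]

/-- The dual of `isIso_of_comparison`. -/
lemma isIso_of_comparison' {X M C K S S' L : D} {f : X ⟶ M} {c : M ⟶ C} {k : K ⟶ M} {w : X ⟶ K}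
    {d : S ⟶ K} {δ : S' ⟶ S} {j : K ⟶ L} {s : S ⟶ L} {e : X ⟶ L} [IsIso e]
    (hfc : IsExactPair f c) (hdk : IsExactPair d k) (hδd : δ ≫ d = 0) (hδs : IsExactPair δ s)
    (hkc : k ≫ c = 0) (hwk : w ≫ k = f) (hwj : w ≫ j = e) (hdj : d ≫ j = s)
    (hsf : s ≫ inv e ≫ f = 0) : IsIso w := by
  have : IsIso w.op := isIso_of_comparison (k := c.op) (g := f.op) (c := k.op) (d := d.op)
    (δ := δ.op) (j := j.op) (s := s.op) (e := e.op) hfc.op hdk.op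
    (by rw [← op_comp, hδd, op_zero]) hδs.op (by rw [← op_comp, hkc, op_zero])
    (by rw [← op_comp, hwk]) (by rw [← op_comp, hwj]) (by rw [← op_comp, hdj])
    (by rw [← op_inv, ← op_comp, ← op_comp, Category.assoc, hsf, op_zero])
  exact isIso_of_op w

lemma epi_of_comparison {X M C K : D} {f : X ⟶ M} {c : M ⟶ C} {k : K ⟶ M} {w : X ⟶ K}
    (hfc : IsExactPair f c) [Mono k] (hkc : k ≫ c = 0) (hwk : w ≫ k = f) : Epi w := by
  have : Mono w.op := mono_of_comparison (k := c.op) (g := f.op) (c := k.op) hfc.op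
    (by rw [← op_comp, hkc, op_zero]) (by rw [← op_comp, hwk])
  exact unop_epi_of_mono w.op

end Exact

open HCategory ZeroObject

/-! ### Calculus of homotopies up to 2-homotopy. -/

section Calculus

variable {A : Type u} [Category.{v} A] [HCategory.{w} A]

lemma two_refl {X Y : A} (α : Htpy X Y) : TwoHtpy α α := (two_equivalence X Y).refl α

lemma two_of_eq {X Y : A} {α β : Htpy X Y} (h : α = β) : TwoHtpy α β := h ▸ two_refl α

lemma two_symm {X Y : A} {α β : Htpy X Y} (h : TwoHtpy α β) : TwoHtpy β α :=
  (two_equivalence X Y).symm h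

lemma two_trans {X Y : A} {α β γ : Htpy X Y} (h : TwoHtpy α β) (h' : TwoHtpy β γ) :
    TwoHtpy α γ :=
  (two_equivalence X Y).trans h h'

lemma Homotopic.trans {X Y : A} {f g h : X ⟶ Y} (H : Homotopic f g) (H' : Homotopic g h) :
    Homotopic f h := by
  obtain ⟨α, h₀, h₁⟩ := H
  obtain ⟨β, k₀, k₁⟩ := H'
  exact ⟨concat α β (by rw [h₁, k₀]), by rw [src_concat, h₀], by rw [tgt_concat, k₁]⟩

lemma Homotopic.whisker {X' X Y Y' : A} {f g : X ⟶ Y} (h : Homotopic f g) (a : X' ⟶ X)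
    (b : Y ⟶ Y') : Homotopic (a ≫ f ≫ b) (a ≫ g ≫ b) := by
  obtain ⟨α, rfl, rfl⟩ := h
  exact ⟨HCategory.whisker a α b, src_whisker _ _ _, tgt_whisker _ _ _⟩

/-- Triviality of β is an equation rather than a literal `refl`, because the proof of composability
in `concat` depends on β and obstructs rewriting. -/
lemma two_concat_of_eq_refl {X Y : A} {α β : Htpy X Y} {f : X ⟶ Y} (hβ : β = refl f)
    (h : tgt α = src β) : TwoHtpy (concat α β h) α := by
  subst hβ
  obtain rfl : f = tgt α := by rw [h, src_refl]
  exact two_concat_refl α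

lemma two_refl_concat_of_eq {X Y : A} {α β : Htpy X Y} {f : X ⟶ Y} (hα : α = refl f)
    (h : tgt α = src β) : TwoHtpy (concat α β h) β := by
  subst hα
  obtain rfl : f = src β := by rw [← h, tgt_refl]
  exact two_refl_concat β

/-- Cancellation (α − β) + β = α, with γ kept as a variable so that it can be a whiskering known
only to equal the difference. -/
lemma two_concat_symm_concat {X Y : A} {α β γ : Htpy X Y} (h : tgt α = src (symm β))
    (hγ : γ = concat α (symm β) h) (h' : tgt γ = src β) : TwoHtpy (concat γ β h') α := by
  subst hγ
  refine two_trans (two_assoc α (symm β) β h (tgt_symm β)) ?_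
  have h₁ : tgt α = src (refl (tgt β)) := by rw [h, src_symm, src_refl]
  exact two_trans (two_concat _ h₁ (two_refl α) (two_symm_concat β)) (two_concat_of_eq_refl rfl h₁)

lemma wl_refl {W X Y : A} (u : W ⟶ X) (f : X ⟶ Y) : wl u (refl f) = refl (u ≫ f) := by
  rw [wl, whisker_refl, Category.comp_id]

lemma wr_refl {X Y Z : A} (f : X ⟶ Y) (u : Y ⟶ Z) : wr (refl f) u = refl (f ≫ u) := by
  rw [wr, whisker_refl, Category.id_comp]

end Calculus

/-! ### Consequences of the zero object, and Puppe sequences. -/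

section Pointed

variable {A : Type u} [Category.{v} A] [HCategory.{w} A] [HasZeroMorphisms A] [HasZeroObject A]
  [PointedHomotopicalCategory A]

/-- The zero map factors through the zero object, where every homotopy is trivial. -/
lemma wr_zero {X Y Z : A} (α : Htpy X Y) : wr α (0 : Y ⟶ Z) = HCategory.refl 0 := by
  rw [← zero_comp (X := Y) (f := (0 : (0 : A) ⟶ Z)), ← wr_wr,
    htpy_to_zero (isZero_zero A) (wr α (0 : Y ⟶ (0 : A))), wr_refl, comp_zero]

lemma wl_zero {X Y Z : A} (α : Htpy Y Z) : wl (0 : X ⟶ Y) α = HCategory.refl 0 := by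
  rw [← zero_comp (X := X) (f := (0 : (0 : A) ⟶ Y)), ← wl_wl,
    htpy_from_zero (isZero_zero A) (wl (0 : (0 : A) ⟶ Y) α), wl_refl, zero_comp]

/-- The interchange law for homotopies starting at zero maps. -/
lemma two_interchange_zero {X Y Z : A} (α : Htpy X Y) (β : Htpy Y Z) (hα : src α = 0)
    (hβ : src β = 0) : TwoHtpy (wl (tgt α) β) (wr α (tgt β)) := by
  have h₁ : wr α (src β) = HCategory.refl 0 := by rw [hβ, wr_zero]
  have h₂ : wl (src α) β = HCategory.refl 0 := by rw [hα, wl_zero]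
  exact two_trans (two_symm (two_refl_concat_of_eq h₁ _))
    (two_trans (two_interchange α β) (two_refl_concat_of_eq h₂ _))

/-! ### The universal homotopies of loop-objects and suspensions -/

/-- The universal homotopy `0 ≃ 0 : ΩB ⟶ B`. -/
def loopHtpy (B : A) : Htpy ((loop A).obj B) B := (hloop B).κ

/-- The universal homotopy `0 ≃ 0 : B ⟶ ΣB`. -/
def suspHtpy (B : A) : Htpy B ((susp A).obj B) := (hsusp B).γ

lemma src_loopHtpy (B : A) : src (loopHtpy B) = 0 := HKernel.src_κ _

lemma tgt_loopHtpy (B : A) : tgt (loopHtpy B) = 0 := tgt_loop B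

lemma src_suspHtpy (B : A) : src (suspHtpy B) = 0 := HCokernel.src_γ _

lemma tgt_suspHtpy (B : A) : tgt (suspHtpy B) = 0 := tgt_susp B

lemma exists_loop_lift {W B : A} (ξ : Htpy W B) (h₀ : src ξ = 0) (h₁ : tgt ξ = 0) :
    ∃ m : W ⟶ (loop A).obj B, wl m (loopHtpy B) = ξ :=
  ⟨loopLift ξ h₀ h₁, loopLift_κ _ _ _⟩

lemma exists_susp_desc {B W : A} (ξ : Htpy B W) (h₀ : src ξ = 0) (h₁ : tgt ξ = 0) :
    ∃ m : (susp A).obj B ⟶ W, wr (suspHtpy B) m = ξ :=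
  ⟨suspDesc ξ h₀ h₁, γ_suspDesc _ _ _⟩

lemma loopHtpy_ext {W B : A} {m n : W ⟶ (loop A).obj B}
    (h : wl m (loopHtpy B) = wl n (loopHtpy B)) : m = n := loop_hom_ext h

lemma suspHtpy_ext {B W : A} {m n : (susp A).obj B ⟶ W}
    (h : wr (suspHtpy B) m = wr (suspHtpy B) n) : m = n := susp_hom_ext h

/-- The 2-dimensional universal property of ΩB applies with the trivial homotopy between maps to 0.
-/
lemma loop_homotopic {W B : A} {m n : W ⟶ (loop A).obj B}
    (h : TwoHtpy (wl m (loopHtpy B)) (wl n (loopHtpy B))) : Homotopic m n := by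
  obtain ⟨ψ, h₀, h₁, -⟩ := (hloop B).exists_htpy m n (HCategory.refl 0)
    (by rw [src_refl]; exact (isZero_zero A).eq_of_tgt _ _)
    (by rw [tgt_refl]; exact (isZero_zero A).eq_of_tgt _ _)
    (two_trans (two_concat_of_eq_refl (wr_refl _ _) _) h)
  exact ⟨ψ, h₀, h₁⟩

lemma susp_homotopic {B W : A} {m n : (susp A).obj B ⟶ W}
    (h : TwoHtpy (wr (suspHtpy B) m) (wr (suspHtpy B) n)) : Homotopic m n := by
  obtain ⟨ψ, h₀, h₁, -⟩ := (hsusp B).exists_htpy m n (HCategory.refl 0)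
    (by rw [src_refl]; exact (isZero_zero A).eq_of_src _ _)
    (by rw [tgt_refl]; exact (isZero_zero A).eq_of_src _ _)
    (two_trans (two_concat_of_eq_refl (wl_refl _ _) _) h)
  exact ⟨ψ, h₀, h₁⟩

lemma loop_map_loopHtpy {X Y : A} (f : X ⟶ Y) :
    wl ((loop A).map f) (loopHtpy Y) = wr (loopHtpy X) f :=
  loopLift_κ (wr (hloop X).κ f) (by rw [src_wr, HKernel.src_κ, zero_comp])
    (by rw [tgt_wr, tgt_loop, zero_comp])

lemma suspHtpy_susp_map {X Y : A} (f : X ⟶ Y) :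
    wr (suspHtpy X) ((susp A).map f) = wl f (suspHtpy Y) :=
  γ_suspDesc (wl f (hsusp Y).γ) (by rw [src_wl, HCokernel.src_γ, comp_zero])
    (by rw [tgt_wl, tgt_susp, comp_zero])

lemma loopUnit_loopHtpy (X : A) : wl (loopUnit X) (loopHtpy ((susp A).obj X)) = suspHtpy X :=
  loopLift_κ _ _ _

lemma suspHtpy_loopCounit (X : A) : wr (suspHtpy ((loop A).obj X)) (loopCounit X) = loopHtpy X :=
  γ_suspDesc _ _ _

lemma loop_map_zero (X Y : A) : (loop A).map (0 : X ⟶ Y) = 0 :=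
  loopHtpy_ext (by rw [loop_map_loopHtpy, wr_zero, wl_zero])

lemma susp_map_zero (X Y : A) : (susp A).map (0 : X ⟶ Y) = 0 :=
  suspHtpy_ext (by rw [suspHtpy_susp_map, wr_zero, wl_zero])

/-! ### The fibre sequence of a map -/

section Fibre

variable {M Y : A} (g : M ⟶ Y)

/-- The connecting map `ΩY ⟶ Kg`. -/
def fibreConn : (loop A).obj Y ⟶ (hker g).obj :=
  (hker g).lift 0 (loopHtpy Y) (src_loopHtpy _) (by rw [tgt_loopHtpy, zero_comp])

lemma fibreConn_ι : fibreConn g ≫ (hker g).ι = 0 := HKernel.lift_ι _ _ _ _ _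

lemma fibreConn_κ : wl (fibreConn g) (hker g).κ = loopHtpy Y := HKernel.lift_κ _ _ _ _ _

/-- On K(kg) there are two homotopies from 0 to the same map to Y: one whiskered from κg, the other
the image under g of the structural homotopy. Their difference is a loop in Y, hence a map to ΩY.
The structural homotopy itself, lifted by the 2-dimensional property of Kg, makes the triangle
commute up to homotopy. -/
lemma exists_lift_fibreConn :
    ∃ b : (hker (hker g).ι).obj ⟶ (loop A).obj Y,
      Homotopic (b ≫ fibreConn g) (hker (hker g).ι).ι := by
  have hc : tgt (wl (hker (hker g).ι).ι (hker g).κ) =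
      src (HCategory.symm (wr (hker (hker g).ι).κ g)) := by
    rw [tgt_wl, src_symm, tgt_wr, HKernel.tgt_κ, HKernel.tgt_κ, Category.assoc]
  obtain ⟨b, hb⟩ := exists_loop_lift (concat _ _ hc)
    (by rw [src_concat, src_wl, HKernel.src_κ, comp_zero])
    (by rw [tgt_concat, tgt_symm, src_wr, HKernel.src_κ, zero_comp])
  obtain ⟨ψ, h₀, h₁, -⟩ := (hker g).exists_htpy (b ≫ fibreConn g)
    (hker (hker g).ι).ι (hker (hker g).ι).κ
    (by rw [HKernel.src_κ, Category.assoc, fibreConn_ι, comp_zero]) (by rw [HKernel.tgt_κ])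
    (two_concat_symm_concat hc (by rw [← wl_wl, fibreConn_κ, hb]) _)
  exact ⟨b, ψ, h₀, h₁⟩

/-- The universal loop of M, seen as a homotopy between two maps ΩM → Kg whose projections to M are
both zero, satisfies the lifting condition. -/
lemma homotopic_zero_loop_map_fibreConn : Homotopic 0 ((loop A).map g ≫ fibreConn g) := by
  obtain ⟨ψ, h₀, h₁, -⟩ := (hker g).exists_htpy 0 ((loop A).map g ≫ fibreConn g) (loopHtpy M)
    (by rw [src_loopHtpy, zero_comp])
    (by rw [tgt_loopHtpy, Category.assoc, fibreConn_ι, comp_zero])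
    (two_trans (two_refl_concat_of_eq (wl_zero _) _)
      (two_of_eq (by rw [← wl_wl, fibreConn_κ, loop_map_loopHtpy])))
  exact ⟨ψ, h₀, h₁⟩

/-- Projecting the structural homotopy of K(ΩY → Kg) to M yields a loop, because ΩY → Kg → M is
strictly zero. Interchange with κg identifies its image under g with the given loop in Y. -/
lemma exists_lift_loop_map :
    ∃ b : (hker (fibreConn g)).obj ⟶ (loop A).obj M,
      Homotopic (b ≫ (loop A).map g) (hker (fibreConn g)).ι := by
  obtain ⟨b, hb⟩ := exists_loop_lift (wr (hker (fibreConn g)).κ (hker g).ι)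
    (by rw [src_wr, HKernel.src_κ, zero_comp])
    (by rw [tgt_wr, HKernel.tgt_κ, Category.assoc, fibreConn_ι, comp_zero])
  refine ⟨b, loop_homotopic ?_⟩
  rw [← wl_wl, loop_map_loopHtpy, wl_wr, hb, wr_wr, ← fibreConn_κ g, wl_wl,
    ← HKernel.tgt_κ (hker g), ← HKernel.tgt_κ (hker (fibreConn g))]
  exact two_symm (two_interchange_zero _ _ (HKernel.src_κ _) (HKernel.src_κ _))

/-- A loop in M whose image under g is 2-homotopic to the trivial one lifts to a loop in Kg. Over
K(Ωg) the required 2-homotopy comes from interchange. The resulting factorization is strict. -/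
lemma exists_lift_loop_map_ι :
    ∃ b : (hker ((loop A).map g)).obj ⟶ (loop A).obj (hker g).obj,
      b ≫ (loop A).map (hker g).ι = (hker ((loop A).map g)).ι := by
  have h : TwoHtpy (wr (wl (hker ((loop A).map g)).ι (loopHtpy M)) g) (HCategory.refl 0) := by
    rw [← wl_wr, ← loop_map_loopHtpy, wl_wl, ← HKernel.tgt_κ]
    refine two_trans (two_interchange_zero _ _ (HKernel.src_κ _) (src_loopHtpy _)) ?_
    rw [tgt_loopHtpy, wr_zero]
    exact two_refl _
  obtain ⟨ψ, h₀, h₁, h₂⟩ := (hker g).exists_htpy 0 0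
    (wl (hker ((loop A).map g)).ι (loopHtpy M))
    (by rw [src_wl, src_loopHtpy, comp_zero, zero_comp])
    (by rw [tgt_wl, tgt_loopHtpy, comp_zero, zero_comp])
    (two_trans (two_refl_concat_of_eq (wl_zero _) _)
      (two_trans h (two_of_eq (wl_zero _).symm)))
  obtain ⟨b, hb⟩ := exists_loop_lift ψ h₀ h₁
  exact ⟨b, loopHtpy_ext (by rw [← wl_wl, loop_map_loopHtpy, wl_wr, hb, h₂])⟩

end Fibre

/-! ### The cofibre sequence of a map -/

section Cofibre

variable {X M : A} (f : X ⟶ M)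

/-- The connecting map `Cf ⟶ ΣX`. -/
def cofibreConn : (hcok f).obj ⟶ (susp A).obj X :=
  (hcok f).desc 0 (suspHtpy X) (src_suspHtpy _) (by rw [tgt_suspHtpy, comp_zero])

lemma π_cofibreConn : (hcok f).π ≫ cofibreConn f = 0 := HCokernel.π_desc _ _ _ _ _

lemma γ_cofibreConn : wr (hcok f).γ (cofibreConn f) = suspHtpy X := HCokernel.γ_desc _ _ _ _ _

/-- Dual to `exists_lift_fibreConn`: two nullhomotopies of the same map X → C(cf) differ by a map
out of ΣX. -/
lemma exists_desc_cofibreConn :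
    ∃ b : (susp A).obj X ⟶ (hcok (hcok f).π).obj,
      Homotopic (cofibreConn f ≫ b) (hcok (hcok f).π).π := by
  have hc : tgt (wr (hcok f).γ (hcok (hcok f).π).π) =
      src (HCategory.symm (wl f (hcok (hcok f).π).γ)) := by
    rw [tgt_wr, src_symm, tgt_wl, HCokernel.tgt_γ, HCokernel.tgt_γ, Category.assoc]
  obtain ⟨b, hb⟩ := exists_susp_desc (concat _ _ hc)
    (by rw [src_concat, src_wr, HCokernel.src_γ, zero_comp])
    (by rw [tgt_concat, tgt_symm, src_wl, HCokernel.src_γ, comp_zero])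
  obtain ⟨ψ, h₀, h₁, -⟩ := (hcok f).exists_htpy (cofibreConn f ≫ b)
    (hcok (hcok f).π).π (hcok (hcok f).π).γ
    (by rw [HCokernel.src_γ, ← Category.assoc, π_cofibreConn, zero_comp])
    (by rw [HCokernel.tgt_γ])
    (two_concat_symm_concat hc (by rw [← wr_wr, γ_cofibreConn, hb]) _)
  exact ⟨b, ψ, h₀, h₁⟩

lemma homotopic_zero_cofibreConn_susp_map :
    Homotopic 0 (cofibreConn f ≫ (susp A).map f) := by
  obtain ⟨ψ, h₀, h₁, -⟩ := (hcok f).exists_htpy 0 (cofibreConn f ≫ (susp A).map f) (suspHtpy M)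
    (by rw [src_suspHtpy, comp_zero])
    (by rw [tgt_suspHtpy, ← Category.assoc, π_cofibreConn, zero_comp])
    (two_trans (two_refl_concat_of_eq (wr_zero _) _)
      (two_of_eq (by rw [← wr_wr, γ_cofibreConn, suspHtpy_susp_map])))
  exact ⟨ψ, h₀, h₁⟩

lemma exists_desc_susp_map :
    ∃ b : (susp A).obj M ⟶ (hcok (cofibreConn f)).obj,
      Homotopic ((susp A).map f ≫ b) (hcok (cofibreConn f)).π := by
  obtain ⟨b, hb⟩ := exists_susp_desc (wl (hcok f).π (hcok (cofibreConn f)).γ)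
    (by rw [src_wl, HCokernel.src_γ, comp_zero])
    (by rw [tgt_wl, HCokernel.tgt_γ, ← Category.assoc, π_cofibreConn, zero_comp])
  refine ⟨b, susp_homotopic ?_⟩
  rw [← wr_wr, suspHtpy_susp_map, ← wl_wr, hb, wl_wl, ← γ_cofibreConn f, wr_wr,
    ← HCokernel.tgt_γ (hcok f), ← HCokernel.tgt_γ (hcok (cofibreConn f))]
  exact two_interchange_zero _ _ (HCokernel.src_γ _) (HCokernel.src_γ _)

lemma exists_desc_susp_map_π :
    ∃ b : (susp A).obj (hcok f).obj ⟶ (hcok ((susp A).map f)).obj,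
      (susp A).map (hcok f).π ≫ b = (hcok ((susp A).map f)).π := by
  have h : TwoHtpy (wl f (wr (suspHtpy M) (hcok ((susp A).map f)).π)) (HCategory.refl 0) := by
    rw [wl_wr, ← suspHtpy_susp_map, wr_wr, ← HCokernel.tgt_γ]
    refine two_trans (two_symm
      (two_interchange_zero _ _ (src_suspHtpy _) (HCokernel.src_γ _))) ?_
    rw [tgt_suspHtpy, wl_zero]
    exact two_refl _
  obtain ⟨ψ, h₀, h₁, h₂⟩ := (hcok f).exists_htpy 0 0
    (wr (suspHtpy M) (hcok ((susp A).map f)).π)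
    (by rw [src_wr, src_suspHtpy, comp_zero, zero_comp])
    (by rw [tgt_wr, tgt_suspHtpy, comp_zero, zero_comp])
    (two_trans (two_refl_concat_of_eq (wr_zero _) _)
      (two_trans h (two_of_eq (wr_zero _).symm)))
  obtain ⟨b, hb⟩ := exists_susp_desc ψ h₀ h₁
  exact ⟨b, suspHtpy_ext (by rw [← wr_wr, suspHtpy_susp_map, ← wl_wr, hb, h₂])⟩

end Cofibre

end Pointed

open HCategory ZeroObject

lemma isZero_obj_of_map_zero {A : Type u} [Category.{v} A] [HasZeroMorphisms A] {D : Type u'}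
    [Category.{v'} D] [HasZeroMorphisms D] {F : A ⥤ D}
    (h : ∀ X Y : A, F.map (0 : X ⟶ Y) = 0) {X : A} (hX : IsZero X) : IsZero (F.obj X) := by
  rw [IsZero.iff_id_eq_zero, ← F.map_id, hX.eq_of_src (𝟙 X) 0, h]

/-! ### Homotopy invariant functors exact on homotopy kernels or cokernels. -/

section Functors

variable {A : Type u} [Category.{v} A] [HCategory.{w} A] [HasZeroMorphisms A] [HasZeroObject A]
  [PointedHomotopicalCategory A] {D : Type u'} [Category.{v'} D] [Abelian D]

/-- Functors identifying homotopic maps. -/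
def HomotopyInvariant (F : A ⥤ D) : Prop :=
  ∀ ⦃X Y : A⦄ ⦃f g : X ⟶ Y⦄, Homotopic f g → F.map f = F.map g

/-- Functors which are exact on the sequences `Kf ⟶ X ⟶ Y`. -/
def KerExact (F : A ⥤ D) : Prop :=
  ∀ ⦃X Y : A⦄ (f : X ⟶ Y), IsExactPair (F.map (hker f).ι) (F.map f)

/-- Functors which are exact on the sequences `X ⟶ Y ⟶ Cf`. -/
def CokExact (F : A ⥤ D) : Prop :=
  ∀ ⦃X Y : A⦄ (f : X ⟶ Y), IsExactPair (F.map f) (F.map (hcok f).π)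

namespace KerExact

variable {F : A ⥤ D}

/-- The homotopy kernel of a zero map projects onto X with a section, given by the trivial homotopy,
so exactness kills F(0). -/
lemma map_zero (hK : KerExact F) (X Y : A) : F.map (0 : X ⟶ Y) = 0 := by
  have h : (hker (0 : X ⟶ Y)).lift (𝟙 X) (HCategory.refl 0) (src_refl _)
      (by rw [tgt_refl, comp_zero]) ≫ (hker (0 : X ⟶ Y)).ι = 𝟙 X := HKernel.lift_ι _ _ _ _ _
  rw [← Category.id_comp (F.map (0 : X ⟶ Y)), ← F.map_id, ← h, F.map_comp, Category.assoc,
    (hK _).zero, comp_zero]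

/-- Exactness is known at Kg for K(kg) → Kg → M; its first map factors through ΩY up to homotopy,
which F does not see. -/
lemma exact_fibreConn_ι (hK : KerExact F) (hF : HomotopyInvariant F) {M Y : A} (g : M ⟶ Y) :
    IsExactPair (F.map (fibreConn g)) (F.map (hker g).ι) := by
  obtain ⟨b, hb⟩ := exists_lift_fibreConn g
  exact (hK (hker g).ι).of_factor_left (F.map b) (by rw [← F.map_comp, hF hb])
    (by rw [← F.map_comp, fibreConn_ι, hK.map_zero])

lemma exact_loop_map_fibreConn (hK : KerExact F) (hF : HomotopyInvariant F) {M Y : A}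
    (g : M ⟶ Y) : IsExactPair (F.map ((loop A).map g)) (F.map (fibreConn g)) := by
  obtain ⟨b, hb⟩ := exists_lift_loop_map g
  exact (hK (fibreConn g)).of_factor_left (F.map b) (by rw [← F.map_comp, hF hb])
    (by rw [← F.map_comp, ← hF (homotopic_zero_loop_map_fibreConn g), hK.map_zero])

/-- The inductive step from H_n to H_{n+1}. Exactness of F on K(Ωg) → ΩM → ΩY passes to Ω(Kg) → ΩM →
ΩY, since the former kernel factors through Ω(Kg). -/
lemma of_loop (hK : KerExact F) {G : A ⥤ D} (hG : HomotopyInvariant G)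
    (e : loop A ⋙ F ≅ G) : KerExact G := by
  intro X Y g
  have h₀ : G.map (0 : (hker g).obj ⟶ Y) = 0 := by
    rw [← cancel_epi (e.hom.app _), ← e.hom.naturality, Functor.comp_map, loop_map_zero,
      hK.map_zero, zero_comp, comp_zero]
  have h₁ : G.map (hker g).ι ≫ G.map g = 0 := by
    rw [← G.map_comp, ← h₀]
    exact (hG ⟨(hker g).κ, (hker g).src_κ, (hker g).tgt_κ⟩).symm
  obtain ⟨b, hb⟩ := exists_lift_loop_map_ι g
  have h₂ : IsExactPair (F.map ((loop A).map (hker g).ι)) (F.map ((loop A).map g)) :=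
    (hK ((loop A).map g)).of_factor_left (F.map b) (by rw [← F.map_comp, hb]) (by
      have h := e.hom.naturality ((hker g).ι ≫ g)
      rw [G.map_comp, h₁, comp_zero, Functor.comp_map, Functor.map_comp, Functor.map_comp] at h
      rw [← cancel_mono (e.hom.app Y), zero_comp]
      exact h)
  exact h₂.of_iso (e.app _) (e.app _) (e.app _) (e.hom.naturality _).symm
    (e.hom.naturality _).symm

end KerExact

namespace CokExact

variable {F : A ⥤ D}

lemma map_zero (hC : CokExact F) (X Y : A) : F.map (0 : X ⟶ Y) = 0 := by
  have h : (hcok (0 : X ⟶ Y)).π ≫ (hcok (0 : X ⟶ Y)).desc (𝟙 Y) (HCategory.refl 0) (src_refl _)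
      (by rw [tgt_refl, zero_comp]) = 𝟙 Y := HCokernel.π_desc _ _ _ _ _
  rw [← Category.comp_id (F.map (0 : X ⟶ Y)), ← F.map_id, ← h, F.map_comp, ← Category.assoc,
    (hC _).zero, zero_comp]

lemma exact_π_cofibreConn (hC : CokExact F) (hF : HomotopyInvariant F) {X M : A} (f : X ⟶ M) :
    IsExactPair (F.map (hcok f).π) (F.map (cofibreConn f)) := by
  obtain ⟨b, hb⟩ := exists_desc_cofibreConn f
  exact (hC (hcok f).π).of_factor_right (F.map b) (by rw [← F.map_comp, hF hb])
    (by rw [← F.map_comp, π_cofibreConn, hC.map_zero])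

lemma exact_cofibreConn_susp_map (hC : CokExact F) (hF : HomotopyInvariant F) {X M : A}
    (f : X ⟶ M) : IsExactPair (F.map (cofibreConn f)) (F.map ((susp A).map f)) := by
  obtain ⟨b, hb⟩ := exists_desc_susp_map f
  exact (hC (cofibreConn f)).of_factor_right (F.map b) (by rw [← F.map_comp, hF hb])
    (by rw [← F.map_comp, ← hF (homotopic_zero_cofibreConn_susp_map f), hC.map_zero])

lemma of_susp (hC : CokExact F) {G : A ⥤ D} (hG : HomotopyInvariant G)
    (e : susp A ⋙ F ≅ G) : CokExact G := by
  intro X Y f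
  have h₀ : G.map (0 : X ⟶ (hcok f).obj) = 0 := by
    rw [← cancel_epi (e.hom.app _), ← e.hom.naturality, Functor.comp_map, susp_map_zero,
      hC.map_zero, zero_comp, comp_zero]
  have h₁ : G.map f ≫ G.map (hcok f).π = 0 := by
    rw [← G.map_comp, ← h₀]
    exact (hG ⟨(hcok f).γ, (hcok f).src_γ, (hcok f).tgt_γ⟩).symm
  obtain ⟨b, hb⟩ := exists_desc_susp_map_π f
  have h₂ : IsExactPair (F.map ((susp A).map f)) (F.map ((susp A).map (hcok f).π)) :=
    (hC ((susp A).map f)).of_factor_right (F.map b) (by rw [← F.map_comp, hb]) (by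
      have h := e.hom.naturality (f ≫ (hcok f).π)
      rw [G.map_comp, h₁, comp_zero, Functor.comp_map, Functor.map_comp, Functor.map_comp] at h
      rw [← cancel_mono (e.hom.app _), zero_comp]
      exact h)
  exact h₂.of_iso (e.app _) (e.app _) (e.app _) (e.hom.naturality _).symm
    (e.hom.naturality _).symm

end CokExact

/-- The comparison `C(kg) ⟶ Y`. -/
def cokKerDesc {M Y : A} (g : M ⟶ Y) : (hcok (hker g).ι).obj ⟶ Y :=
  (hcok (hker g).ι).desc g (hker g).κ (hker g).src_κ (hker g).tgt_κ

lemma π_cokKerDesc {M Y : A} (g : M ⟶ Y) : (hcok (hker g).ι).π ≫ cokKerDesc g = g :=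
  HCokernel.π_desc _ _ _ _ _

lemma γ_cokKerDesc {M Y : A} (g : M ⟶ Y) : wr (hcok (hker g).ι).γ (cokKerDesc g) = (hker g).κ :=
  HCokernel.γ_desc _ _ _ _ _

/-- The comparison `X ⟶ K(cf)`. -/
def kerCokLift {X M : A} (f : X ⟶ M) : X ⟶ (hker (hcok f).π).obj :=
  (hker (hcok f).π).lift f (hcok f).γ (hcok f).src_γ (hcok f).tgt_γ

lemma kerCokLift_ι {X M : A} (f : X ⟶ M) : kerCokLift f ≫ (hker (hcok f).π).ι = f :=
  HKernel.lift_ι _ _ _ _ _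

lemma kerCokLift_κ {X M : A} (f : X ⟶ M) :
    wl (kerCokLift f) (hker (hcok f).π).κ = (hcok f).γ :=
  HKernel.lift_κ _ _ _ _ _

/-- Restricting γ(kg) along ΩY → Kg gives a loop, as that map vanishes in M; j is the induced map
out of ΣΩY. It makes the counit factor through C(kg), which tests the comparison with Y. -/
lemma exists_desc_cofibreConn_cokKerDesc {M Y : A} (g : M ⟶ Y) :
    ∃ j : (susp A).obj ((loop A).obj Y) ⟶ (hcok (hker g).ι).obj,
      j ≫ cokKerDesc g = loopCounit Y ∧
      j ≫ cofibreConn (hker g).ι = (susp A).map (fibreConn g) := by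
  obtain ⟨j, hj⟩ := exists_susp_desc (wl (fibreConn g) (hcok (hker g).ι).γ)
    (by rw [src_wl, HCokernel.src_γ, comp_zero])
    (by rw [tgt_wl, HCokernel.tgt_γ, ← Category.assoc, fibreConn_ι, zero_comp])
  refine ⟨j, suspHtpy_ext ?_, suspHtpy_ext ?_⟩
  · rw [← wr_wr, hj, ← wl_wr, γ_cokKerDesc, fibreConn_κ, suspHtpy_loopCounit]
  · rw [← wr_wr, hj, ← wl_wr, γ_cofibreConn, suspHtpy_susp_map]

lemma exists_lift_fibreConn_kerCokLift {X M : A} (f : X ⟶ M) :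
    ∃ j : (hker (hcok f).π).obj ⟶ (loop A).obj ((susp A).obj X),
      kerCokLift f ≫ j = loopUnit X ∧
      fibreConn (hcok f).π ≫ j = (loop A).map (cofibreConn f) := by
  obtain ⟨j, hj⟩ := exists_loop_lift (wr (hker (hcok f).π).κ (cofibreConn f))
    (by rw [src_wr, HKernel.src_κ, zero_comp])
    (by rw [tgt_wr, HKernel.tgt_κ, Category.assoc, π_cofibreConn, comp_zero])
  refine ⟨j, loopHtpy_ext ?_, loopHtpy_ext ?_⟩
  · rw [← wl_wl, hj, wl_wr, kerCokLift_κ, γ_cofibreConn, loopUnit_loopHtpy]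
  · rw [← wl_wl, hj, wl_wr, fibreConn_κ, loop_map_loopHtpy]

end Functors

/-! ### Exactness in all degrees, vanishing at the extremes, and the two comparison maps. -/

namespace HomologyTheory

variable {A : Type u} [Category.{v} A] [HCategory.{w} A] [HasZeroMorphisms A] [HasZeroObject A]
  [PointedHomotopicalCategory A] {D : Type u'} [Category.{v'} D] [Abelian D] {p : ℕ}
  (T : HomologyTheory A D p)

lemma homotopyInvariant (n : Fin (p + 1)) : HomotopyInvariant (T.H n) :=
  fun _ _ _ _ h => T.homotopy_invariance n h

/-- Upward induction from degree 0 through ω; `cokExact` goes downward from degree p through σ. -/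
lemma kerExact (n : Fin (p + 1)) : KerExact (T.H n) := by
  induction n using Fin.induction with
  | zero => exact fun _ _ f => T.exact_hker f
  | succ n ih => exact ih.of_loop (T.homotopyInvariant _) (T.ω n)

lemma cokExact (n : Fin (p + 1)) : CokExact (T.H n) := by
  induction n using Fin.reverseInduction with
  | last => exact fun _ _ f => T.exact_hcok f
  | cast n ih => exact ih.of_susp (T.homotopyInvariant _) (T.σ n).symm

lemma isZero_obj (n : Fin (p + 1)) {X : A} (hX : IsZero X) : IsZero ((T.H n).obj X) :=
  isZero_obj_of_map_zero (T.kerExact n).map_zero hX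

/-- H_n(X) is H_0(Ω^n X). -/
lemma isZero_of_loop_iterate (n : Fin (p + 1)) :
    ∀ X : A, IsZero ((loop A).obj^[n] X) → IsZero ((T.H n).obj X) := by
  induction n using Fin.induction with
  | zero => exact fun X hX => T.isZero_obj 0 hX
  | succ n ih => exact fun X hX => (ih _ hX).of_iso ((T.ω n).app X).symm

lemma isZero_of_susp_iterate (n : Fin (p + 1)) :
    ∀ X : A, IsZero ((susp A).obj^[p - n] X) → IsZero ((T.H n).obj X) := by
  induction n using Fin.reverseInduction with
  | last => exact fun X hX => T.isZero_obj _ (by simpa using hX)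
  | cast n ih =>
    intro X hX
    -- One more suspension is needed in degree n than in degree n + 1; the truncated subtraction is
    -- harmless because n < p.
    have h : p - (n.castSucc : ℕ) = p - (n.succ : ℕ) + 1 := by
      simp only [Fin.val_castSucc, Fin.val_succ]
      omega
    rw [h] at hX
    exact (ih _ hX).of_iso ((T.σ n).app X)

lemma isZero_last_loop (hA : LoopSuspNilpotent A p) (X : A) : IsZero ((T.H (Fin.last p)).obj ((loop A).obj X)) :=
  -- An iterate applies its first step innermost, so Ω^{p+1}X is by definition Ω^p(ΩX).
  T.isZero_of_loop_iterate _ _ (hA X).1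

lemma isZero_zero_susp (hA : LoopSuspNilpotent A p) (X : A) : IsZero ((T.H 0).obj ((susp A).obj X)) :=
  T.isZero_of_susp_iterate _ _ (hA X).2

/-- The preceding term H_p(ΩY) of the fibre sequence is zero. -/
lemma mono_last_ι (hA : LoopSuspNilpotent A p) {M Y : A} (g : M ⟶ Y) : Mono ((T.H (Fin.last p)).map (hker g).ι) :=
  ((T.kerExact _).exact_fibreConn_ι (T.homotopyInvariant _) g).mono_of_zero
    ((T.isZero_last_loop hA Y).eq_of_src _ _)

lemma epi_zero_π (hA : LoopSuspNilpotent A p) {X M : A} (f : X ⟶ M) : Epi ((T.H 0).map (hcok f).π) :=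
  ((T.cokExact _).exact_π_cofibreConn (T.homotopyInvariant _) f).epi_of_zero
    ((T.isZero_zero_susp hA X).eq_of_tgt _ _)

/-- The coherence between ω and σ exhibits H_{n+1}(ε) as σ⁻¹ followed by ω. -/
lemma isIso_map_loopCounit (n : Fin p) (X : A) : IsIso ((T.H n.succ).map (loopCounit X)) := by
  have h : (T.H n.succ).map (loopCounit X) =
      (T.σ n).inv.app ((loop A).obj X) ≫ (T.ω n).hom.app X := by
    rw [← T.σ_counit, Iso.inv_hom_id_app_assoc]
  rw [h]
  infer_instance

lemma isIso_map_loopUnit (n : Fin p) (X : A) : IsIso ((T.H n.castSucc).map (loopUnit X)) := by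
  have h : (T.H n.castSucc).map (loopUnit X) =
      (T.σ n).hom.app X ≫ (T.ω n).inv.app ((susp A).obj X) := by
    rw [← T.unit_ω, Category.assoc, Iso.hom_inv_id_app]
    exact (Category.comp_id _).symm
  rw [h]
  infer_instance

/-- Suspension is not assumed to respect fibre sequences; exactness of H_n at Kg is transported by
σ. -/
lemma exact_susp_map_fibreConn (n : Fin p) {M Y : A} (g : M ⟶ Y) :
    IsExactPair ((T.H n.succ).map ((susp A).map (fibreConn g)))
      ((T.H n.succ).map ((susp A).map (hker g).ι)) :=
  ((T.kerExact n.castSucc).exact_fibreConn_ι (T.homotopyInvariant _) g).of_iso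
    ((T.σ n).app _) ((T.σ n).app _) ((T.σ n).app _) ((T.σ n).hom.naturality _).symm
    ((T.σ n).hom.naturality _).symm

lemma exact_loop_map_cofibreConn (n : Fin p) {X M : A} (f : X ⟶ M) :
    IsExactPair ((T.H n.castSucc).map ((loop A).map (hcok f).π))
      ((T.H n.castSucc).map ((loop A).map (cofibreConn f))) :=
  ((T.cokExact n.succ).exact_π_cofibreConn (T.homotopyInvariant _) f).of_iso
    ((T.ω n).symm.app _) ((T.ω n).symm.app _) ((T.ω n).symm.app _)
    ((T.ω n).inv.naturality _).symm ((T.ω n).inv.naturality _).symm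

/-- `isIso_of_comparison` applied with L = ΣΩY, S = ΣKg, S' = ΣM, and with the invertible counit as
e. -/
lemma isIso_map_cokKerDesc (n : Fin p) {M Y : A} (g : M ⟶ Y) :
    IsIso ((T.H n.succ).map (cokKerDesc g)) := by
  obtain ⟨j, hw, hd⟩ := exists_desc_cofibreConn_cokKerDesc g
  have := T.isIso_map_loopCounit n Y
  refine isIso_of_comparison (k := (T.H n.succ).map (hker g).ι) (g := (T.H n.succ).map g)
    (c := (T.H n.succ).map (hcok (hker g).ι).π)
    (d := (T.H n.succ).map (cofibreConn (hker g).ι))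
    (δ := (T.H n.succ).map ((susp A).map (hker g).ι)) (j := (T.H n.succ).map j)
    (s := (T.H n.succ).map ((susp A).map (fibreConn g)))
    (e := (T.H n.succ).map (loopCounit Y)) (T.kerExact _ g)
    ((T.cokExact _).exact_π_cofibreConn (T.homotopyInvariant _) _)
    ((T.cokExact _).exact_cofibreConn_susp_map (T.homotopyInvariant _) _).zero
    (T.exact_susp_map_fibreConn n g) (T.cokExact _ _).zero
    (by rw [← Functor.map_comp, π_cokKerDesc]) (by rw [← Functor.map_comp, hw])
    (by rw [← Functor.map_comp, hd]) ?_
  -- Writing ε⁻¹ as ω⁻¹ followed by σ turns the required vanishing, by naturality, into that of ΩM →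
  -- ΩY → Kg in degree n.
  have h₁ : inv ((T.H n.succ).map (loopCounit Y)) =
      (T.ω n).inv.app Y ≫ (T.σ n).hom.app ((loop A).obj Y) := by
    rw [IsIso.inv_eq_of_hom_inv_id]
    rw [← cancel_epi ((T.σ n).hom.app ((loop A).obj Y)), reassoc_of% T.σ_counit n Y,
      Iso.hom_inv_id_app_assoc]
    exact (Category.comp_id _).symm
  have h₂ := (T.σ n).hom.naturality (fibreConn g)
  have h₃ := (T.ω n).inv.naturality g
  dsimp only [Functor.comp_map] at h₂ h₃
  rw [h₁, Category.assoc, ← h₂, reassoc_of% h₃,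
    reassoc_of% ((T.kerExact _).exact_loop_map_fibreConn (T.homotopyInvariant _) g).zero,
    zero_comp, comp_zero]

lemma isIso_map_kerCokLift (n : Fin p) {X M : A} (f : X ⟶ M) :
    IsIso ((T.H n.castSucc).map (kerCokLift f)) := by
  obtain ⟨j, hw, hd⟩ := exists_lift_fibreConn_kerCokLift f
  have := T.isIso_map_loopUnit n X
  refine isIso_of_comparison' (f := (T.H n.castSucc).map f)
    (c := (T.H n.castSucc).map (hcok f).π) (k := (T.H n.castSucc).map (hker (hcok f).π).ι)
    (d := (T.H n.castSucc).map (fibreConn (hcok f).π))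
    (δ := (T.H n.castSucc).map ((loop A).map (hcok f).π)) (j := (T.H n.castSucc).map j)
    (s := (T.H n.castSucc).map ((loop A).map (cofibreConn f)))
    (e := (T.H n.castSucc).map (loopUnit X)) (T.cokExact _ f)
    ((T.kerExact _).exact_fibreConn_ι (T.homotopyInvariant _) _)
    ((T.kerExact _).exact_loop_map_fibreConn (T.homotopyInvariant _) _).zero
    (T.exact_loop_map_cofibreConn n f) (T.kerExact _ _).zero
    (by rw [← Functor.map_comp, kerCokLift_ι]) (by rw [← Functor.map_comp, hw])
    (by rw [← Functor.map_comp, hd]) ?_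
  have h₁ : inv ((T.H n.castSucc).map (loopUnit X)) =
      (T.ω n).hom.app ((susp A).obj X) ≫ (T.σ n).inv.app X := by
    rw [IsIso.inv_eq_of_hom_inv_id]
    rw [reassoc_of% T.unit_ω n X, Iso.hom_inv_id_app]
  have h₂ := (T.ω n).hom.naturality (cofibreConn f)
  have h₃ := (T.σ n).inv.naturality f
  dsimp only [Functor.comp_map] at h₂ h₃
  rw [h₁, Category.assoc, ← h₃, reassoc_of% h₂,
    reassoc_of% ((T.cokExact _).exact_cofibreConn_susp_map (T.homotopyInvariant _) f).zero,
    zero_comp, comp_zero]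

end HomologyTheory

open HCategory ZeroObject

/-! ### Strict identities between the maps attached to an h-differential sequence. -/

namespace HDiffSeq

variable {A : Type u} [Category.{v} A] [HCategory.{w} A] [HasZeroMorphisms A] [HasZeroObject A]
  [PointedHomotopicalCategory A] (S : HDiffSeq A)

lemma uα_ι : S.uα ≫ (hker S.g).ι = S.f := HKernel.lift_ι _ _ _ _ _

lemma π_vα : (hcok S.f).π ≫ S.vα = S.g := HCokernel.π_desc _ _ _ _ _

lemma π_v : (hcok S.f).π ≫ S.v = (hcok (hker S.g).ι).π := HCokernel.π_desc _ _ _ _ _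

lemma γ_v : wr (hcok S.f).γ S.v = wl S.uα (hcok (hker S.g).ι).γ := HCokernel.γ_desc _ _ _ _ _

lemma u_ι : S.u ≫ (hker S.g).ι = (hker (hcok S.f).π).ι := HKernel.lift_ι _ _ _ _ _

/-- Both sides restrict to g on M and to α on the structural homotopy of Cf. This reduces (b') to a
statement about v. -/
lemma v_cokKerDesc : S.v ≫ cokKerDesc S.g = S.vα :=
  (hcok S.f).hom_ext (by rw [← Category.assoc, π_v, π_cokKerDesc, π_vα])
    (by rw [← wr_wr, γ_v, ← wl_wr, γ_cokKerDesc]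
        exact (HKernel.lift_κ _ _ _ _ _).trans (HCokernel.γ_desc _ _ _ _ _).symm)

lemma kerCokLift_u : kerCokLift S.f ≫ S.u = S.uα :=
  (hker S.g).hom_ext (by rw [Category.assoc, u_ι, kerCokLift_ι, uα_ι])
    (by
      have h₁ : wl S.u (hker S.g).κ = wr (hker (hcok S.f).π).κ S.vα := HKernel.lift_κ _ _ _ _ _
      rw [← wl_wl, h₁, wl_wr, kerCokLift_κ]
      exact (HCokernel.γ_desc _ _ _ _ _).trans (HKernel.lift_κ _ _ _ _ _).symm)

/-- The third square of the ladder between the cofibre sequences of f and of kg. -/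
lemma v_cofibreConn :
    S.v ≫ cofibreConn (hker S.g).ι = cofibreConn S.f ≫ (susp A).map S.uα :=
  (hcok S.f).hom_ext
    (by rw [← Category.assoc, π_v, π_cofibreConn, ← Category.assoc, π_cofibreConn, zero_comp])
    (by rw [← wr_wr, γ_v, ← wl_wr, γ_cofibreConn, ← wr_wr, γ_cofibreConn, suspHtpy_susp_map])

end HDiffSeq

/-! ### The six equivalent conditions of weak exactness. -/

namespace HomologyTheory

variable {A : Type u} [Category.{v} A] [HCategory.{w} A] [HasZeroMorphisms A] [HasZeroObject A]
  [PointedHomotopicalCategory A] {D : Type u'} [Category.{v'} D] [Abelian D] {p : ℕ}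
  (T : HomologyTheory A D p)

/-- `H_n(f)` is an isomorphism for `n < p` and an epimorphism for `n = p`. -/
def IsLeftConnected {X Y : A} (f : X ⟶ Y) : Prop :=
  (∀ n : Fin (p + 1), n ≠ Fin.last p → IsIso ((T.H n).map f)) ∧ Epi ((T.H (Fin.last p)).map f)

/-- `H_n(f)` is an isomorphism for `n > 0` and a monomorphism for `n = 0`. -/
def IsRightConnected {X Y : A} (f : X ⟶ Y) : Prop :=
  (∀ n : Fin (p + 1), n ≠ 0 → IsIso ((T.H n).map f)) ∧ Mono ((T.H 0).map f)

variable {T}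

lemma isLeftConnected_iff {X Y : A} {f : X ⟶ Y} : T.IsLeftConnected f ↔
    (∀ n : Fin p, IsIso ((T.H n.castSucc).map f)) ∧ Epi ((T.H (Fin.last p)).map f) := by
  refine and_congr_left fun _ => ⟨fun h n => h _ (Fin.castSucc_lt_last n).ne, fun h n hn => ?_⟩
  obtain ⟨m, rfl⟩ := Fin.exists_castSucc_eq.2 hn
  exact h m

lemma isRightConnected_iff {X Y : A} {f : X ⟶ Y} : T.IsRightConnected f ↔
    (∀ n : Fin p, IsIso ((T.H n.succ).map f)) ∧ Mono ((T.H 0).map f) := by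
  refine and_congr_left fun _ => ⟨fun h n => h _ (Fin.succ_ne_zero n), fun h n hn => ?_⟩
  obtain ⟨m, rfl⟩ := Fin.exists_succ_eq.2 hn
  exact h m

lemma IsLeftConnected.epi {X Y : A} {f : X ⟶ Y} (h : T.IsLeftConnected f) (n : Fin (p + 1)) :
    Epi ((T.H n).map f) := by
  by_cases hn : n = Fin.last p
  · subst hn
    exact h.2
  · have := h.1 n hn
    infer_instance

lemma IsRightConnected.mono {X Y : A} {f : X ⟶ Y} (h : T.IsRightConnected f) (n : Fin (p + 1)) :
    Mono ((T.H n).map f) := by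
  by_cases hn : n = 0
  · subst hn
    exact h.2
  · have := h.1 n hn
    infer_instance

lemma isIso_susp_map_iff (n : Fin p) {X Y : A} (f : X ⟶ Y) :
    IsIso ((T.H n.succ).map ((susp A).map f)) ↔ IsIso ((T.H n.castSucc).map f) :=
  (NatIso.isIso_map_iff (T.σ n) f).symm

lemma isIso_loop_map_iff (n : Fin p) {X Y : A} (f : X ⟶ Y) :
    IsIso ((T.H n.castSucc).map ((loop A).map f)) ↔ IsIso ((T.H n.succ).map f) :=
  NatIso.isIso_map_iff (T.ω n) f

lemma IsLeftConnected.isIso_susp_map (hA : LoopSuspNilpotent A p) {X Y : A} {f : X ⟶ Y}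
    (h : T.IsLeftConnected f) (n : Fin (p + 1)) : IsIso ((T.H n).map ((susp A).map f)) := by
  cases n using Fin.cases with
  -- Degree 0 sees no suspension, so the map is trivially invertible there.
  | zero => exact ⟨0, (T.isZero_zero_susp hA X).eq_of_src _ _, (T.isZero_zero_susp hA Y).eq_of_src _ _⟩
  | succ n => exact (isIso_susp_map_iff n f).2 ((isLeftConnected_iff.1 h).1 n)

lemma IsRightConnected.isIso_loop_map (hA : LoopSuspNilpotent A p) {X Y : A} {f : X ⟶ Y}
    (h : T.IsRightConnected f) (n : Fin (p + 1)) : IsIso ((T.H n).map ((loop A).map f)) := by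
  cases n using Fin.lastCases with
  | last => exact ⟨0, (T.isZero_last_loop hA X).eq_of_src _ _, (T.isZero_last_loop hA Y).eq_of_src _ _⟩
  | cast n => exact (isIso_loop_map_iff n f).2 ((isRightConnected_iff.1 h).1 n)

/-- In X → Y → Cf → ΣX → ΣY, the object Cf is null in degree n exactly when H_n(f) is epi and
H_n(Σf) is mono. The latter means H_{n-1}(f) mono for n > 0, and is automatic for n = 0. -/
lemma isWeaklyNull_hcok_iff (hA : LoopSuspNilpotent A p) {X Y : A} (f : X ⟶ Y) :
    IsWeaklyNull T.H (hcok f).obj ↔ T.IsLeftConnected f := by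
  have h₁ (n) := (T.cokExact n).exact_π_cofibreConn (T.homotopyInvariant n) f
  have h₂ (n) := (T.cokExact n).exact_cofibreConn_susp_map (T.homotopyInvariant n) f
  constructor
  · intro h
    have hepi (n) : Epi ((T.H n).map f) := (T.cokExact n f).epi_of_zero ((h n).eq_of_tgt _ _)
    refine isLeftConnected_iff.2 ⟨fun n => ?_, hepi _⟩
    have := (h₂ n.succ).mono_of_zero ((h _).eq_of_src _ _)
    have : Mono ((T.H n.castSucc).map f) := by
      have h₃ := (T.σ n).hom.naturality f
      rw [Functor.comp_map] at h₃
      have : Mono ((T.H n.castSucc).map f ≫ (T.σ n).hom.app Y) := by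
        rw [h₃]
        infer_instance
      exact mono_of_mono _ ((T.σ n).hom.app Y)
    have := hepi n.castSucc
    exact isIso_of_mono_of_epi _
  · intro h n
    have := h.epi n
    have := h.isIso_susp_map hA n
    exact (h₁ n).isZero_of_zero (T.cokExact n f).eq_zero_of_epi (h₂ n).eq_zero_of_mono

lemma isWeaklyNull_hker_iff (hA : LoopSuspNilpotent A p) {X Y : A} (f : X ⟶ Y) :
    IsWeaklyNull T.H (hker f).obj ↔ T.IsRightConnected f := by
  have h₁ (n) := (T.kerExact n).exact_fibreConn_ι (T.homotopyInvariant n) f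
  have h₂ (n) := (T.kerExact n).exact_loop_map_fibreConn (T.homotopyInvariant n) f
  constructor
  · intro h
    have hmono (n) : Mono ((T.H n).map f) := (T.kerExact n f).mono_of_zero ((h n).eq_of_src _ _)
    refine isRightConnected_iff.2 ⟨fun n => ?_, hmono _⟩
    have := (h₂ n.castSucc).epi_of_zero ((h _).eq_of_tgt _ _)
    have : Epi ((T.H n.succ).map f) := by
      have h₃ := (T.ω n).hom.naturality f
      rw [Functor.comp_map] at h₃
      have : Epi ((T.ω n).hom.app X ≫ (T.H n.succ).map f) := by
        rw [← h₃]
        infer_instance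
      exact epi_of_epi ((T.ω n).hom.app X) _
    have := hmono n.succ
    exact isIso_of_mono_of_epi _
  · intro h n
    have := h.mono n
    have := h.isIso_loop_map hA n
    exact (h₁ n).isZero_of_zero (h₂ n).eq_zero_of_epi (T.kerExact n f).eq_zero_of_mono

variable (S : HDiffSeq A)

/-- In positive degrees v and v_α differ by an invertible comparison. In degree 0 the comparison is
only mono, and v is epi because M already maps onto C(kg). -/
lemma isWeakEquiv_v_iff_isRightConnected (hA : LoopSuspNilpotent A p) :
    IsWeakEquiv T.H S.v ↔ T.IsRightConnected S.vα := by
  have hv (n) : (T.H n).map S.v ≫ (T.H n).map (cokKerDesc S.g) = (T.H n).map S.vα := by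
    rw [← Functor.map_comp, S.v_cokKerDesc]
  constructor
  · intro h
    refine isRightConnected_iff.2 ⟨fun n => ?_, ?_⟩
    · have := h n.succ
      have := T.isIso_map_cokKerDesc n S.g
      rw [← hv]
      infer_instance
    · have := h 0
      have := T.epi_zero_π hA (hker S.g).ι
      have : Mono ((T.H 0).map (cokKerDesc S.g)) := mono_of_comparison (T.kerExact 0 S.g)
        (T.cokExact 0 (hker S.g).ι).zero (by rw [← Functor.map_comp, π_cokKerDesc])
      rw [← hv]
      infer_instance
  · intro h n
    cases n using Fin.cases with
    | zero =>
      have := h.2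
      have : Mono ((T.H 0).map S.v) := mono_of_mono_fac (hv 0)
      have := T.epi_zero_π hA (hker S.g).ι
      have : Epi ((T.H 0).map S.v) := by
        have h₁ : (T.H 0).map (hcok S.f).π ≫ (T.H 0).map S.v =
            (T.H 0).map (hcok (hker S.g).ι).π := by rw [← Functor.map_comp, S.π_v]
        exact epi_of_epi_fac h₁
      exact isIso_of_mono_of_epi _
    | succ n =>
      have h₁ := (isRightConnected_iff.1 h).1 n
      have := T.isIso_map_cokKerDesc n S.g
      rw [← hv] at h₁
      exact IsIso.of_isIso_comp_right _ ((T.H n.succ).map (cokKerDesc S.g))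

lemma isWeakEquiv_u_iff_isLeftConnected (hA : LoopSuspNilpotent A p) :
    IsWeakEquiv T.H S.u ↔ T.IsLeftConnected S.uα := by
  have hu (n) : (T.H n).map (kerCokLift S.f) ≫ (T.H n).map S.u = (T.H n).map S.uα := by
    rw [← Functor.map_comp, S.kerCokLift_u]
  constructor
  · intro h
    refine isLeftConnected_iff.2 ⟨fun n => ?_, ?_⟩
    · have := h n.castSucc
      have := T.isIso_map_kerCokLift n S.f
      rw [← hu]
      infer_instance
    · have := h (Fin.last p)
      have := T.mono_last_ι hA (hcok S.f).π
      have : Epi ((T.H (Fin.last p)).map (kerCokLift S.f)) :=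
        epi_of_comparison (T.cokExact _ S.f) (T.kerExact _ (hcok S.f).π).zero
          (by rw [← Functor.map_comp, kerCokLift_ι])
      rw [← hu]
      exact epi_comp _ _
  · intro h n
    cases n using Fin.lastCases with
    | last =>
      have := h.2
      have : Epi ((T.H (Fin.last p)).map S.u) := epi_of_epi_fac (hu _)
      have := T.mono_last_ι hA (hcok S.f).π
      have : Mono ((T.H (Fin.last p)).map S.u) := by
        have h₁ : (T.H (Fin.last p)).map S.u ≫ (T.H (Fin.last p)).map (hker S.g).ι =
            (T.H (Fin.last p)).map (hker (hcok S.f).π).ι := by rw [← Functor.map_comp, S.u_ι]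
        exact mono_of_mono_fac h₁
      exact isIso_of_mono_of_epi _
    | cast n =>
      have h₁ := (isLeftConnected_iff.1 h).1 n
      have := T.isIso_map_kerCokLift n S.f
      rw [← hu] at h₁
      exact IsIso.of_isIso_comp_left ((T.H n.castSucc).map (kerCokLift S.f)) _

/-- The bridge between the dual halves, obtained by four-lemma arguments on the ladder of the
cofibre sequences of f and kg. -/
lemma isWeakEquiv_v_iff_isLeftConnected (hA : LoopSuspNilpotent A p) :
    IsWeakEquiv T.H S.v ↔ T.IsLeftConnected S.uα := by
  have h₁ (n) {X M : A} (f : X ⟶ M) :=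
    (T.cokExact n).exact_π_cofibreConn (T.homotopyInvariant n) f
  have h₂ (n) {X M : A} (f : X ⟶ M) :=
    (T.cokExact n).exact_cofibreConn_susp_map (T.homotopyInvariant n) f
  have e₁ (n) : (T.H n).map S.f ≫ 𝟙 _ = (T.H n).map S.uα ≫ (T.H n).map (hker S.g).ι := by
    rw [Category.comp_id, ← Functor.map_comp, S.uα_ι]
  have e₂ (n) : (T.H n).map (hcok S.f).π ≫ (T.H n).map S.v =
      𝟙 _ ≫ (T.H n).map (hcok (hker S.g).ι).π := by
    rw [Category.id_comp, ← Functor.map_comp, S.π_v]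
  have e₃ (n) : (T.H n).map (cofibreConn S.f) ≫ (T.H n).map ((susp A).map S.uα) =
      (T.H n).map S.v ≫ (T.H n).map (cofibreConn (hker S.g).ι) := by
    rw [← Functor.map_comp, ← Functor.map_comp, S.v_cofibreConn]
  have e₄ (n) : (T.H n).map ((susp A).map S.f) ≫ 𝟙 _ =
      (T.H n).map ((susp A).map S.uα) ≫ (T.H n).map ((susp A).map (hker S.g).ι) := by
    rw [Category.comp_id, ← Functor.map_comp, ← Functor.map_comp, S.uα_ι]
  constructor
  · intro h
    refine isLeftConnected_iff.2 ⟨fun n => ?_, ?_⟩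
    · rw [← isIso_susp_map_iff]
      have := h n.succ
      have hmono : Mono ((T.H n.succ).map ((susp A).map S.uα)) :=
        mono_of_four (h₁ _ _).zero (h₂ _ _) (h₁ _ _) (e₂ _) (e₃ _) (e₄ _) inferInstance
          inferInstance inferInstance
      have hσ {X M : A} (f : X ⟶ M) : IsExactPair ((T.H n.succ).map ((susp A).map f))
          ((T.H n.succ).map ((susp A).map (hcok f).π)) :=
        (T.cokExact n.castSucc f).of_iso ((T.σ n).app _) ((T.σ n).app _) ((T.σ n).app _)
          ((T.σ n).hom.naturality _).symm ((T.σ n).hom.naturality _).symm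
      have : IsIso ((T.H n.succ).map ((susp A).map S.v)) :=
        (isIso_susp_map_iff n S.v).2 (h n.castSucc)
      -- The ladder is prolonged by Σv on the right; in degree n + 1 this is v in degree n.
      have hepi : Epi ((T.H n.succ).map ((susp A).map S.uα)) :=
        epi_of_four (hσ _) (h₂ _ _) (hσ _).zero (e₃ _) (e₄ _)
          (by rw [Category.id_comp, ← Functor.map_comp, ← Functor.map_comp, S.π_v])
          inferInstance inferInstance (a₄ := (T.H n.succ).map ((susp A).map S.v)) inferInstance
      exact isIso_of_mono_of_epi _
    · have := h (Fin.last p)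
      -- In degree p there is no higher degree to pass to. The lower row is instead extended to the
      -- left by H_p(ΩY) = 0, and the upper row by the same zero object.
      exact epi_of_four (f₁ := 0) (g₁ := (T.H (Fin.last p)).map (fibreConn S.g)) (a₁ := 𝟙 _)
        (T.cokExact _ S.f) ((T.kerExact _).exact_fibreConn_ι (T.homotopyInvariant _) S.g)
        (T.cokExact _ _).zero ((T.isZero_last_loop hA _).eq_of_src _ _) (e₁ _) (e₂ _)
        inferInstance inferInstance inferInstance
  · intro h n
    have := h.epi n
    have := h.isIso_susp_map hA n
    have hepi : Epi ((T.H n).map S.v) :=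
      epi_of_four (h₂ _ _) (h₁ _ _) (h₂ _ _).zero (e₂ _) (e₃ _) (e₄ _) inferInstance
        inferInstance inferInstance
    have hmono : Mono ((T.H n).map S.v) :=
      mono_of_four (T.cokExact _ _).zero (h₁ _ _) (T.cokExact _ _) (e₁ _) (e₂ _) (e₃ _)
        inferInstance inferInstance inferInstance
    exact isIso_of_mono_of_epi _

variable (T)

theorem tfae_weak_exactness (hA : LoopSuspNilpotent A p) :
    List.TFAE [
      IsWeakEquiv T.H S.v,
      T.IsLeftConnected S.uα,
      IsWeaklyNull T.H (hcok S.uα).obj,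
      IsWeakEquiv T.H S.u,
      T.IsRightConnected S.vα,
      IsWeaklyNull T.H (hker S.vα).obj] := by
  tfae_have 1 ↔ 2 := isWeakEquiv_v_iff_isLeftConnected S hA
  tfae_have 3 ↔ 2 := isWeaklyNull_hcok_iff hA S.uα
  tfae_have 4 ↔ 2 := isWeakEquiv_u_iff_isLeftConnected S hA
  tfae_have 1 ↔ 5 := isWeakEquiv_v_iff_isRightConnected S hA
  tfae_have 6 ↔ 5 := isWeaklyNull_hker_iff hA S.vα
  tfae_finish

lemma isWeakEquiv_of_isHomotopyEquiv {X Y : A} {f : X ⟶ Y} (hf : IsHomotopyEquiv f) :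
    IsWeakEquiv T.H f := by
  obtain ⟨g, h₁, h₂⟩ := hf
  refine fun n => ⟨(T.H n).map g, ?_, ?_⟩
  · rw [← Functor.map_comp, T.homotopy_invariance n h₁, CategoryTheory.Functor.map_id]
  · rw [← Functor.map_comp, T.homotopy_invariance n h₂, CategoryTheory.Functor.map_id]

end HomologyTheory

open HCategory

/-! ### Chain maps and homotopies by components, and homotopy kernels of bounded complexes. -/

section Chain

variable {D : Type u} [Category.{v} D] [Abelian D] {p : ℕ}

namespace BoundedCh

lemma hom_ext {X Y : BoundedCh D p} {f g : X ⟶ Y} (h : ∀ n, f.hom.f n = g.hom.f n) : f = g :=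
  ObjectProperty.hom_ext _ (HomologicalComplex.hom_ext _ _ h)

lemma comm {X Y : BoundedCh D p} (f : X ⟶ Y) (i j : ℕ) :
    f.hom.f i ≫ Y.obj.d i j = X.obj.d i j ≫ f.hom.f j := f.hom.comm i j

@[simp]
lemma zero_f {X Y : BoundedCh D p} (n : ℕ) : (0 : X ⟶ Y).hom.f n = 0 := rfl

@[simp]
lemma comp_f {X Y Z : BoundedCh D p} (f : X ⟶ Y) (g : Y ⟶ Z) (n : ℕ) :
    (f ≫ g).hom.f n = f.hom.f n ≫ g.hom.f n := rfl

/-- A bounded chain complex from its objects and differentials. -/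
def mk' (X : ℕ → D) (d : ∀ n, X (n + 1) ⟶ X n) (sq : ∀ n, d (n + 1) ≫ d n = 0)
    (hX : ∀ n, p < n → IsZero (X n)) : BoundedCh D p :=
  ⟨ChainComplex.of X d sq, hX⟩

lemma mk'_d (X : ℕ → D) (d : ∀ n, X (n + 1) ⟶ X n) (sq : ∀ n, d (n + 1) ≫ d n = 0)
    (hX : ∀ n, p < n → IsZero (X n)) (n : ℕ) :
    (mk' X d sq hX).obj.d (n + 1) n = d n := ChainComplex.of_d _ _ _

/-- A morphism of bounded chain complexes from its components. -/
def homMk' {X Y : BoundedCh D p} (f : ∀ n, X.obj.X n ⟶ Y.obj.X n)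
    (hf : ∀ n, f (n + 1) ≫ Y.obj.d (n + 1) n = X.obj.d (n + 1) n ≫ f n) : X ⟶ Y :=
  ObjectProperty.homMk
    { f := f
      comm' := by
        rintro i j rfl
        exact hf j }

end BoundedCh

namespace ChHtpy

/-- The components of a chain homotopy. -/
def c {X Y : BoundedCh D p} (α : ChHtpy X Y) (n : ℕ) : X.obj.X n ⟶ Y.obj.X (n + 1) :=
  α.htpy.hom n (n + 1)

variable {X Y : BoundedCh D p}

lemma comm_zero (α : ChHtpy X Y) :
    α.tgt.hom.f 0 = α.c 0 ≫ Y.obj.d 1 0 + α.src.hom.f 0 := by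
  have h := α.htpy.comm 0
  rwa [dNext_nat, prevD_eq _ (show (ComplexShape.down ℕ).Rel 1 0 from rfl),
    X.obj.shape 0 (0 - 1) (by simp), zero_comp, zero_add] at h

lemma comm_succ (α : ChHtpy X Y) (n : ℕ) :
    α.tgt.hom.f (n + 1) = X.obj.d (n + 1) n ≫ α.c n + α.c (n + 1) ≫ Y.obj.d (n + 2) (n + 1) +
      α.src.hom.f (n + 1) := by
  have h := α.htpy.comm (n + 1)
  rwa [dNext_eq _ (show (ComplexShape.down ℕ).Rel (n + 1) n from rfl),
    prevD_eq _ (show (ComplexShape.down ℕ).Rel (n + 2) (n + 1) from rfl)] at h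

/-- A chain homotopy from its components. -/
def mk' (s t : X ⟶ Y) (h : ∀ n, X.obj.X n ⟶ Y.obj.X (n + 1))
    (h₀ : t.hom.f 0 = h 0 ≫ Y.obj.d 1 0 + s.hom.f 0)
    (h₁ : ∀ n, t.hom.f (n + 1) = X.obj.d (n + 1) n ≫ h n + h (n + 1) ≫ Y.obj.d (n + 2) (n + 1) +
      s.hom.f (n + 1)) : ChHtpy X Y where
  src := s
  tgt := t
  htpy :=
    -- The family is extended by zero off the pairs (i, i + 1); the `eqToHom` becomes an identity on
    -- them.
    { hom := fun i j => if hij : i + 1 = j then h i ≫ eqToHom (by rw [hij]) else 0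
      zero := fun i j hij => dif_neg hij
      comm := fun n => by
        cases n with
        | zero =>
          rw [dNext_nat, prevD_eq _ (show (ComplexShape.down ℕ).Rel 1 0 from rfl),
            X.obj.shape 0 (0 - 1) (by simp), zero_comp, zero_add, h₀]
          simp
        | succ n =>
          rw [dNext_eq _ (show (ComplexShape.down ℕ).Rel (n + 1) n from rfl),
            prevD_eq _ (show (ComplexShape.down ℕ).Rel (n + 2) (n + 1) from rfl), h₁]
          simp }

@[simp]
lemma mk'_c (s t : X ⟶ Y) (h : ∀ n, X.obj.X n ⟶ Y.obj.X (n + 1)) (h₀) (h₁) (n : ℕ) :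
    (mk' s t h h₀ h₁).c n = h n := by
  simp [mk', c]

lemma ext {α β : ChHtpy X Y} (h₀ : α.src = β.src) (h₁ : α.tgt = β.tgt)
    (h : ∀ n, α.c n = β.c n) : α = β := ext' h₀ h₁ h

lemma wl_c {W : BoundedCh D p} (a : W ⟶ X) (α : ChHtpy X Y) (n : ℕ) :
    c (wl a (α : Htpy X Y)) n = a.hom.f n ≫ α.c n := by
  change (_ ≫ _ ≫ _ = _)
  exact congrArg (a.hom.f n ≫ ·) (Category.comp_id _)

lemma wr_c {Z : BoundedCh D p} (α : ChHtpy X Y) (b : Y ⟶ Z) (n : ℕ) :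
    c (wr (α : Htpy X Y) b) n = α.c n ≫ b.hom.f (n + 1) :=
  Category.id_comp _

lemma concat_c (α β : Htpy X Y) (h : tgt α = src β) (n : ℕ) :
    c (concat α β h) n = c β n + c α n := by
  change (Homotopy.trans _ (Homotopy.trans _ _)).hom _ _ = _
  simp [c]

lemma eq_zero_of_isZero {W : D} {X : BoundedCh D p} {n : ℕ} (h : p < n) (f g : W ⟶ X.obj.X n) :
    f = g := (X.property n h).eq_of_tgt _ _

end ChHtpy


/-! ### Homotopy kernels of chain maps -/

/-- Explicit homotopy kernels of a chain map `f`: in degree `n`, the object represents the pairs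
`(x, y)` with values in `X_n` and `Y_{n+1}`, satisfying `f(x) = d(y)` if `n = 0`. -/
structure ChKernel {X Y : BoundedCh D p} (f : X ⟶ Y) where
  obj : BoundedCh D p
  ι : obj ⟶ X
  κ (n : ℕ) : obj.obj.X n ⟶ Y.obj.X (n + 1)
  ι_zero : ι.hom.f 0 ≫ f.hom.f 0 = κ 0 ≫ Y.obj.d 1 0
  d_κ (n : ℕ) : obj.obj.d (n + 1) n ≫ κ n =
    ι.hom.f (n + 1) ≫ f.hom.f (n + 1) - κ (n + 1) ≫ Y.obj.d (n + 2) (n + 1)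
  hom_ext {n : ℕ} {W : D} {a b : W ⟶ obj.obj.X n} : a ≫ ι.hom.f n = b ≫ ι.hom.f n →
    a ≫ κ n = b ≫ κ n → a = b
  exists_lift {n : ℕ} {W : D} (a : W ⟶ X.obj.X n) (b : W ⟶ Y.obj.X (n + 1)) :
    (n = 0 → a ≫ f.hom.f n = b ≫ Y.obj.d (n + 1) n) →
      ∃ m : W ⟶ obj.obj.X n, m ≫ ι.hom.f n = a ∧ m ≫ κ n = b

section Ker

variable {X Y : BoundedCh D p} (f : X ⟶ Y)

/-- The map whose kernel is the degree `n` part of the homotopy kernel. -/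
def kerMap (n : ℕ) : X.obj.X n ⊞ Y.obj.X (n + 1) ⟶ Y.obj.X n :=
  -- The summand Y_0 would sit in degree −1 of the untruncated fibre; cutting it off leaves the
  -- pairs (x, y) with f x = d y in degree 0.
  if n = 0 then biprod.desc (f.hom.f n) (-Y.obj.d (n + 1) n) else 0

/-- The degree `n` part of the homotopy kernel. -/
def kerX (n : ℕ) : D := kernel (kerMap f n)

/-- The projection of the homotopy kernel. -/
def kerι (n : ℕ) : kerX f n ⟶ X.obj.X n := kernel.ι (kerMap f n) ≫ biprod.fst

/-- The structural homotopy of the homotopy kernel. -/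
def kerκ (n : ℕ) : kerX f n ⟶ Y.obj.X (n + 1) := kernel.ι (kerMap f n) ≫ biprod.snd

variable {f} in
lemma ker_hom_ext {n : ℕ} {W : D} {a b : W ⟶ kerX f n} (h : a ≫ kerι f n = b ≫ kerι f n)
    (h' : a ≫ kerκ f n = b ≫ kerκ f n) : a = b := by
  refine (cancel_mono (kernel.ι (kerMap f n))).1 (biprod.hom_ext _ _ ?_ ?_)
  · exact (Category.assoc _ _ _).trans (h.trans (Category.assoc _ _ _).symm)
  · exact (Category.assoc _ _ _).trans (h'.trans (Category.assoc _ _ _).symm)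

lemma kerι_zero : kerι f 0 ≫ f.hom.f 0 = kerκ f 0 ≫ Y.obj.d 1 0 := by
  have h : kernel.ι (kerMap f 0) ≫ biprod.desc (f.hom.f 0) (-Y.obj.d 1 0) = 0 :=
    kernel.condition (kerMap f 0)
  rw [biprod.desc_eq, Preadditive.comp_add] at h
  simp only [Preadditive.comp_neg] at h
  rw [← sub_eq_add_neg, sub_eq_zero, ← Category.assoc, ← Category.assoc] at h
  exact h

lemma exists_ker_lift {n : ℕ} {W : D} (a : W ⟶ X.obj.X n) (b : W ⟶ Y.obj.X (n + 1))
    (h : n = 0 → a ≫ f.hom.f n = b ≫ Y.obj.d (n + 1) n) :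
    ∃ m : W ⟶ kerX f n, m ≫ kerι f n = a ∧ m ≫ kerκ f n = b := by
  have hz : biprod.lift a b ≫ kerMap f n = 0 := by
    rw [kerMap]
    split_ifs with hn
    · simp [h hn]
    · simp
  refine ⟨kernel.lift _ (biprod.lift a b) hz, ?_, ?_⟩
  · exact (kernel.lift_ι_assoc _ _ _ _).trans (biprod.lift_fst _ _)
  · exact (kernel.lift_ι_assoc _ _ _ _).trans (biprod.lift_snd _ _)

lemma exists_kerD (n : ℕ) : ∃ m : kerX f (n + 1) ⟶ kerX f n,
    m ≫ kerι f n = kerι f (n + 1) ≫ X.obj.d (n + 1) n ∧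
    m ≫ kerκ f n =
      kerι f (n + 1) ≫ f.hom.f (n + 1) - kerκ f (n + 1) ≫ Y.obj.d (n + 2) (n + 1) :=
  exists_ker_lift f _ _ (by
    intro
    simp)

/-- The differential of the homotopy kernel. -/
def kerD (n : ℕ) : kerX f (n + 1) ⟶ kerX f n := (exists_kerD f n).choose

lemma kerD_ι (n : ℕ) : kerD f n ≫ kerι f n = kerι f (n + 1) ≫ X.obj.d (n + 1) n :=
  (exists_kerD f n).choose_spec.1

lemma kerD_κ (n : ℕ) : kerD f n ≫ kerκ f n =
    kerι f (n + 1) ≫ f.hom.f (n + 1) - kerκ f (n + 1) ≫ Y.obj.d (n + 2) (n + 1) :=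
  (exists_kerD f n).choose_spec.2

lemma kerD_kerD (n : ℕ) : kerD f (n + 1) ≫ kerD f n = 0 := by
  refine ker_hom_ext ?_ ?_
  · rw [Category.assoc, kerD_ι, ← Category.assoc, kerD_ι, Category.assoc,
      HomologicalComplex.d_comp_d, comp_zero, zero_comp]
  · rw [Category.assoc, kerD_κ, Preadditive.comp_sub, ← Category.assoc, ← Category.assoc, kerD_ι,
      kerD_κ, Preadditive.sub_comp, Category.assoc, Category.assoc, Category.assoc,
      BoundedCh.comm, HomologicalComplex.d_comp_d, comp_zero, sub_zero, sub_self, zero_comp]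

lemma isZero_kerX {n : ℕ} (hn : p < n) : IsZero (kerX f n) := by
  rw [IsZero.iff_id_eq_zero]
  exact ker_hom_ext ((X.property n hn).eq_of_tgt _ _)
    ((Y.property _ (hn.trans n.lt_succ_self)).eq_of_tgt _ _)

/-- Explicit homotopy kernels exist. -/
def chKernel : ChKernel f where
  obj := BoundedCh.mk' (kerX f) (kerD f) (kerD_kerD f) fun _ => isZero_kerX f
  ι := BoundedCh.homMk' (kerι f) fun n => by
    rw [BoundedCh.mk'_d]
    exact (kerD_ι f n).symm
  κ := kerκ f
  ι_zero := kerι_zero f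
  d_κ n := by
    rw [BoundedCh.mk'_d]
    exact kerD_κ f n
  hom_ext := ker_hom_ext
  exists_lift := exists_ker_lift f

end Ker

namespace ChKernel

variable {X Y : BoundedCh D p} {f : X ⟶ Y} (K : ChKernel f)

/-- Maps to the degree `n` part of the homotopy kernel. -/
def lift {n : ℕ} {W : D} (a : W ⟶ X.obj.X n) (b : W ⟶ Y.obj.X (n + 1))
    (h : n = 0 → a ≫ f.hom.f n = b ≫ Y.obj.d (n + 1) n) : W ⟶ K.obj.obj.X n :=
  (K.exists_lift a b h).choose

@[simp]
lemma lift_ι {n : ℕ} {W : D} (a : W ⟶ X.obj.X n) (b : W ⟶ Y.obj.X (n + 1))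
    (h : n = 0 → a ≫ f.hom.f n = b ≫ Y.obj.d (n + 1) n) : K.lift a b h ≫ K.ι.hom.f n = a :=
  (K.exists_lift a b h).choose_spec.1

@[simp]
lemma lift_κ {n : ℕ} {W : D} (a : W ⟶ X.obj.X n) (b : W ⟶ Y.obj.X (n + 1))
    (h : n = 0 → a ≫ f.hom.f n = b ≫ Y.obj.d (n + 1) n) : K.lift a b h ≫ K.κ n = b :=
  (K.exists_lift a b h).choose_spec.2

/-- The structural homotopy. -/
def htpy : ChHtpy K.obj Y :=
  ChHtpy.mk' 0 (K.ι ≫ f) K.κ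
    (by rw [BoundedCh.zero_f, add_zero, BoundedCh.comp_f, K.ι_zero])
    (fun n => by rw [K.d_κ, BoundedCh.zero_f, add_zero, sub_add_cancel, BoundedCh.comp_f])

lemma htpy_c (n : ℕ) : K.htpy.c n = K.κ n := ChHtpy.mk'_c _ _ _ _ _ _

lemma existsUnique {W : BoundedCh D p} (x : W ⟶ X) (ξ : Htpy W Y) (h₀ : src ξ = 0)
    (h₁ : tgt ξ = x ≫ f) : ∃! m : W ⟶ K.obj, m ≫ K.ι = x ∧ wl m (K.htpy : Htpy K.obj Y) = ξ := by
  have hs (n) : (ChHtpy.src ξ).hom.f n = 0 := by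
    rw [show ChHtpy.src ξ = 0 from h₀, BoundedCh.zero_f]
  have ht (n) : (ChHtpy.tgt ξ).hom.f n = x.hom.f n ≫ f.hom.f n := by
    rw [show ChHtpy.tgt ξ = x ≫ f from h₁, BoundedCh.comp_f]
  -- The condition defining the kernel in degree 0 is the homotopy relation of ξ there, which has no
  -- term from degree −1.
  have hz (n) (hn : n = 0) :
      x.hom.f n ≫ f.hom.f n = ChHtpy.c ξ n ≫ Y.obj.d (n + 1) n := by
    subst hn
    have := ChHtpy.comm_zero ξ
    rwa [hs, ht, add_zero] at this
  let m : W ⟶ K.obj := BoundedCh.homMk' (fun n => K.lift (x.hom.f n) (ChHtpy.c ξ n) (hz n))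
    fun n => by
      refine K.hom_ext ?_ ?_
      · rw [Category.assoc, Category.assoc, ← BoundedCh.comm, ← Category.assoc, K.lift_ι,
          K.lift_ι, BoundedCh.comm]
      · have := ChHtpy.comm_succ ξ n
        rw [hs, ht, add_zero] at this
        rw [Category.assoc, Category.assoc, K.d_κ, Preadditive.comp_sub, ← Category.assoc,
          ← Category.assoc, K.lift_ι, K.lift_κ, K.lift_κ, this, add_sub_cancel_right]
  have hm : m ≫ K.ι = x := BoundedCh.hom_ext fun n => K.lift_ι _ _ (hz n)
  refine ⟨m, ⟨hm, ChHtpy.ext ?_ ?_ fun n => ?_⟩, ?_⟩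
  · change m ≫ (0 : K.obj ⟶ Y) ≫ 𝟙 Y = _
    rw [zero_comp, comp_zero]
    exact h₀.symm
  · change m ≫ (K.ι ≫ f) ≫ 𝟙 Y = _
    rw [Category.comp_id, ← Category.assoc, hm]
    exact h₁.symm
  · rw [ChHtpy.wl_c, htpy_c]
    exact K.lift_κ _ _ (hz n)
  · rintro m' ⟨h₂, h₃⟩
    refine BoundedCh.hom_ext fun n => K.hom_ext ?_ ?_
    · rw [← BoundedCh.comp_f, ← BoundedCh.comp_f, h₂, hm]
    · refine Eq.trans ?_ (K.lift_κ _ _ (hz n)).symm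
      rw [← h₃, ChHtpy.wl_c, htpy_c]

lemma exists_htpy {W : BoundedCh D p} (x y : W ⟶ K.obj) (φ : Htpy W X) (h₀ : src φ = x ≫ K.ι)
    (h₁ : tgt φ = y ≫ K.ι) (h₂ : tgt (wl x (K.htpy : Htpy K.obj Y)) = src (wr φ f))
    (h : TwoHtpy (concat (wl x (K.htpy : Htpy K.obj Y)) (wr φ f) h₂)
      (wl y (K.htpy : Htpy K.obj Y))) :
    ∃ ψ : Htpy W K.obj, src ψ = x ∧ tgt ψ = y ∧ wr ψ K.ι = φ := by
  obtain ⟨-, -, h, hh⟩ := h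
  have hs (n) : (ChHtpy.src φ).hom.f n = x.hom.f n ≫ K.ι.hom.f n := by
    rw [show ChHtpy.src φ = x ≫ K.ι from h₀, BoundedCh.comp_f]
  have ht (n) : (ChHtpy.tgt φ).hom.f n = y.hom.f n ≫ K.ι.hom.f n := by
    rw [show ChHtpy.tgt φ = y ≫ K.ι from h₁, BoundedCh.comp_f]
  have hh' (n) : y.hom.f n ≫ K.κ n = h n (n + 2) ≫ Y.obj.d (n + 2) (n + 1) -
      W.obj.d n (n - 1) ≫ h (n - 1) (n + 1) +
      (ChHtpy.c φ n ≫ f.hom.f (n + 1) + x.hom.f n ≫ K.κ n) := by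
    have h₂ := hh n
    change ChHtpy.c _ n - ChHtpy.c _ n = _ at h₂
    rw [ChHtpy.concat_c, ChHtpy.wl_c, ChHtpy.wl_c, ChHtpy.wr_c, htpy_c] at h₂
    rw [← h₂, sub_add_cancel]
  -- The lift consists of φ and minus the given 2-homotopy. It lands in degrees n + 1 > 0, where
  -- pairs are unconstrained; the sign matches the one in `d_κ`.
  refine ⟨ChHtpy.mk' x y (fun n => K.lift (ChHtpy.c φ n) (-h n (n + 2)) (by simp))
    (K.hom_ext ?_ ?_) fun n => K.hom_ext ?_ ?_, rfl, rfl, ?_⟩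
  · have := ChHtpy.comm_zero φ
    rw [hs, ht] at this
    rw [this, Preadditive.add_comp, Category.assoc, ← BoundedCh.comm, ← Category.assoc, K.lift_ι]
  · rw [hh', W.obj.shape 0 (0 - 1) (by simp), zero_comp, sub_zero, Preadditive.add_comp,
      Category.assoc, K.d_κ, Preadditive.comp_sub, ← Category.assoc, ← Category.assoc, K.lift_ι,
      K.lift_κ, Preadditive.neg_comp]
    abel
  · have := ChHtpy.comm_succ φ n
    rw [hs, ht] at this
    rw [this, Preadditive.add_comp, Preadditive.add_comp, Category.assoc, Category.assoc,
      ← BoundedCh.comm, ← Category.assoc (K.lift _ _ _), K.lift_ι, K.lift_ι]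
  -- The instance of `hh'` is restated so that n + 1 − 1 appears as n.
  · have e : y.hom.f (n + 1) ≫ K.κ (n + 1) = h (n + 1) (n + 3) ≫ Y.obj.d (n + 3) (n + 2) -
        W.obj.d (n + 1) n ≫ h n (n + 2) +
        (ChHtpy.c φ (n + 1) ≫ f.hom.f (n + 2) + x.hom.f (n + 1) ≫ K.κ (n + 1)) := hh' (n + 1)
    rw [e, Preadditive.add_comp, Preadditive.add_comp,
      Category.assoc, Category.assoc, K.d_κ, Preadditive.comp_sub, ← Category.assoc (K.lift _ _ _),
      ← Category.assoc (K.lift _ _ _), K.lift_ι, K.lift_κ, K.lift_κ, Preadditive.neg_comp,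
      Preadditive.comp_neg]
    abel
  · refine ChHtpy.ext ?_ ?_ fun n => ?_
    · exact (Category.id_comp (x ≫ K.ι)).trans h₀.symm
    · exact (Category.id_comp (y ≫ K.ι)).trans h₁.symm
    · rw [ChHtpy.wr_c, ChHtpy.mk'_c, K.lift_ι]

/-- Explicit homotopy kernels are homotopy kernels. -/
def toHKernel : HKernel f where
  obj := K.obj
  ι := K.ι
  κ := K.htpy
  src_κ := rfl
  tgt_κ := rfl
  existsUnique := K.existsUnique
  exists_htpy x y φ h₀ h₁ h := K.exists_htpy x y φ h₀ h₁ _ h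

end ChKernel

end Chain

open HCategory

section Chain

variable {D : Type u} [Category.{v} D] [Abelian D] {p : ℕ}

/-! ### Homotopy cokernels of chain maps -/

/-- Explicit homotopy cokernels of a chain map `f`: in degree `n`, the object corepresents the
pairs of maps defined on `Y_n` and `X_{n-1}`, with a compatibility condition if `n = p`. -/
structure ChCokernel {X Y : BoundedCh D p} (f : X ⟶ Y) where
  obj : BoundedCh D p
  π : Y ⟶ obj
  γ (n : ℕ) : X.obj.X n ⟶ obj.obj.X (n + 1)
  γ_d_zero : γ 0 ≫ obj.obj.d 1 0 = f.hom.f 0 ≫ π.hom.f 0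
  γ_d_succ (n : ℕ) : γ (n + 1) ≫ obj.obj.d (n + 2) (n + 1) =
    f.hom.f (n + 1) ≫ π.hom.f (n + 1) - X.obj.d (n + 1) n ≫ γ n
  hom_ext_zero {W : D} {a b : obj.obj.X 0 ⟶ W} : π.hom.f 0 ≫ a = π.hom.f 0 ≫ b → a = b
  hom_ext_succ {n : ℕ} {W : D} {a b : obj.obj.X (n + 1) ⟶ W} :
    π.hom.f (n + 1) ≫ a = π.hom.f (n + 1) ≫ b → γ n ≫ a = γ n ≫ b → a = b
  exists_desc_zero {W : D} (a : Y.obj.X 0 ⟶ W) : (p = 0 → f.hom.f 0 ≫ a = 0) →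
    ∃ m : obj.obj.X 0 ⟶ W, π.hom.f 0 ≫ m = a
  exists_desc_succ {n : ℕ} {W : D} (a : Y.obj.X (n + 1) ⟶ W) (b : X.obj.X n ⟶ W) :
    (n + 1 = p → f.hom.f (n + 1) ≫ a = X.obj.d (n + 1) n ≫ b) → (p < n + 1 → b = 0) →
      ∃ m : obj.obj.X (n + 1) ⟶ W, π.hom.f (n + 1) ≫ m = a ∧ γ n ≫ m = b

section Cok

variable {X Y : BoundedCh D p} (f : X ⟶ Y)

/-- The map whose cokernel is the degree `0` part of the homotopy cokernel. -/
def cokMapZero : X.obj.X 0 ⟶ Y.obj.X 0 := if p = 0 then f.hom.f 0 else 0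

/-- The map whose cokernel is the degree `n + 1` part of the homotopy cokernel. -/
def cokMapSucc (n : ℕ) : (Y.obj.X (n + 1) ⊞ X.obj.X n) ⊞ X.obj.X (n + 1) ⟶
    Y.obj.X (n + 1) ⊞ X.obj.X n :=
  -- The first summand kills everything above degree p, where X_p would otherwise survive in degree
  -- p + 1; the second makes f and the differential of X agree in degree p.
  biprod.desc (if p < n + 1 then 𝟙 _ else 0)
    (if n + 1 = p then biprod.lift (f.hom.f (n + 1)) (-X.obj.d (n + 1) n) else 0)

/-- The degree `n` part of the homotopy cokernel. -/
def cokX : ℕ → D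
  | 0 => cokernel (cokMapZero f)
  | n + 1 => cokernel (cokMapSucc f n)

/-- The injection of the homotopy cokernel. -/
def cokπ : ∀ n : ℕ, Y.obj.X n ⟶ cokX f n
  | 0 => cokernel.π (cokMapZero f)
  | n + 1 => biprod.inl ≫ cokernel.π (cokMapSucc f n)

/-- The structural homotopy of the homotopy cokernel. -/
def cokγ (n : ℕ) : X.obj.X n ⟶ cokX f (n + 1) := biprod.inr ≫ cokernel.π (cokMapSucc f n)

variable {f} in
lemma cok_hom_ext_zero {W : D} {a b : cokX f 0 ⟶ W} (h : cokπ f 0 ≫ a = cokπ f 0 ≫ b) : a = b :=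
  (cancel_epi (cokernel.π (cokMapZero f))).1 h

variable {f} in
lemma cok_hom_ext_succ {n : ℕ} {W : D} {a b : cokX f (n + 1) ⟶ W}
    (h : cokπ f (n + 1) ≫ a = cokπ f (n + 1) ≫ b) (h' : cokγ f n ≫ a = cokγ f n ≫ b) : a = b := by
  refine (cancel_epi (cokernel.π (cokMapSucc f n))).1 (biprod.hom_ext' _ _ ?_ ?_)
  · exact (Category.assoc _ _ _).symm.trans (h.trans (Category.assoc _ _ _))
  · exact (Category.assoc _ _ _).symm.trans (h'.trans (Category.assoc _ _ _))

lemma exists_cok_desc_zero {W : D} (a : Y.obj.X 0 ⟶ W) (h : p = 0 → f.hom.f 0 ≫ a = 0) :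
    ∃ m : cokX f 0 ⟶ W, cokπ f 0 ≫ m = a := by
  refine ⟨cokernel.desc (cokMapZero f) a ?_, cokernel.π_desc _ _ _⟩
  rw [cokMapZero]
  split_ifs with hp
  · exact h hp
  · exact zero_comp

lemma exists_cok_desc_succ {n : ℕ} {W : D} (a : Y.obj.X (n + 1) ⟶ W) (b : X.obj.X n ⟶ W)
    (h : n + 1 = p → f.hom.f (n + 1) ≫ a = X.obj.d (n + 1) n ≫ b) (h' : p < n + 1 → b = 0) :
    ∃ m : cokX f (n + 1) ⟶ W, cokπ f (n + 1) ≫ m = a ∧ cokγ f n ≫ m = b := by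
  have hz : cokMapSucc f n ≫ biprod.desc a b = 0 := by
    refine biprod.hom_ext' _ _ ?_ ?_
    · rw [cokMapSucc, biprod.inl_desc_assoc, comp_zero]
      split_ifs with hn
      · rw [h' hn, (Y.property _ hn).eq_of_src a 0, Category.id_comp]
        exact biprod.hom_ext' _ _ (by simp) (by simp)
      · exact zero_comp
    · rw [cokMapSucc, biprod.inr_desc_assoc, comp_zero]
      split_ifs with hn
      · simp [h hn]
      · exact zero_comp
  refine ⟨cokernel.desc _ (biprod.desc a b) hz, ?_, ?_⟩
  · exact (Category.assoc _ _ _).trans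
      ((congrArg (biprod.inl ≫ ·) (cokernel.π_desc _ _ hz)).trans (biprod.inl_desc _ _))
  · exact (Category.assoc _ _ _).trans
      ((congrArg (biprod.inr ≫ ·) (cokernel.π_desc _ _ hz)).trans (biprod.inr_desc _ _))

lemma isZero_cokX {n : ℕ} (hn : p < n) : IsZero (cokX f n) := by
  cases n with
  | zero => omega
  | succ n =>
    have h : 𝟙 _ ≫ cokernel.π (cokMapSucc f n) = 0 := by
      have h' : biprod.inl ≫ cokMapSucc f n = 𝟙 _ := by
        rw [cokMapSucc, biprod.inl_desc, if_pos hn]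
      rw [← h', Category.assoc, cokernel.condition, comp_zero]
    rw [Category.id_comp] at h
    rw [IsZero.iff_id_eq_zero]
    exact (cancel_epi (cokernel.π (cokMapSucc f n))).1 (by
      rw [h]
      exact zero_comp.trans zero_comp.symm)

lemma cokπ_of_eq_succ {n : ℕ} (hn : p = n + 1) :
    f.hom.f (n + 1) ≫ cokπ f (n + 1) = X.obj.d (n + 1) n ≫ cokγ f n := by
  have h' : biprod.inr ≫ cokMapSucc f n =
      f.hom.f (n + 1) ≫ biprod.inl - X.obj.d (n + 1) n ≫ biprod.inr := by
    rw [cokMapSucc, biprod.inr_desc, if_pos hn.symm, biprod.lift_eq, Preadditive.neg_comp,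
      sub_eq_add_neg]
  have h : (f.hom.f (n + 1) ≫ biprod.inl - X.obj.d (n + 1) n ≫ biprod.inr) ≫
      cokernel.π (cokMapSucc f n) = 0 := by
    rw [← h', Category.assoc, cokernel.condition, comp_zero]
  rw [Preadditive.sub_comp, sub_eq_zero, Category.assoc, Category.assoc] at h
  exact h

lemma cokπ_of_eq_zero (hp : p = 0) : f.hom.f 0 ≫ cokπ f 0 = 0 := by
  have h := cokernel.condition (cokMapZero f)
  have h' : cokMapZero f = f.hom.f 0 := if_pos hp
  rw [← h']
  exact h

/-- The differential of `X` followed by the structural homotopy. -/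
def cokδ : ∀ n : ℕ, X.obj.X n ⟶ cokX f n
  -- With this value, the differential on the X-part is fπ − δ in every degree, with no separate
  -- case at 0.
  | 0 => 0
  | n + 1 => X.obj.d (n + 1) n ≫ cokγ f n

lemma d_cokδ (n : ℕ) : X.obj.d (n + 1) n ≫ cokδ f n = 0 := by
  cases n with
  | zero => exact comp_zero
  | succ n =>
    change _ ≫ _ ≫ _ = _
    rw [← Category.assoc, HomologicalComplex.d_comp_d, zero_comp]

/-- A map out of the zero object in degrees above p needs a zero X-component, so fπ − δ must vanish
from degree p on. In degree p this is the quotient relation. -/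
lemma cokπ_of_le {n : ℕ} (hn : p ≤ n) : f.hom.f n ≫ cokπ f n = cokδ f n := by
  rcases hn.eq_or_lt with rfl | hn
  · cases p with
    | zero => exact cokπ_of_eq_zero f rfl
    | succ n => exact cokπ_of_eq_succ f rfl
  · exact (isZero_cokX f hn).eq_of_tgt _ _

lemma exists_cokD (n : ℕ) : ∃ m : cokX f (n + 1) ⟶ cokX f n,
    cokπ f (n + 1) ≫ m = Y.obj.d (n + 1) n ≫ cokπ f n ∧
    cokγ f n ≫ m = f.hom.f n ≫ cokπ f n - cokδ f n := by
  refine exists_cok_desc_succ f _ _ (fun hn => ?_) (fun hn => ?_)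
  · rw [Preadditive.comp_sub, d_cokδ, sub_zero, ← Category.assoc, BoundedCh.comm, Category.assoc]
  · rw [cokπ_of_le f (by omega), sub_self]

/-- The differential of the homotopy cokernel. -/
def cokD (n : ℕ) : cokX f (n + 1) ⟶ cokX f n := (exists_cokD f n).choose

lemma cokπ_D (n : ℕ) : cokπ f (n + 1) ≫ cokD f n = Y.obj.d (n + 1) n ≫ cokπ f n :=
  (exists_cokD f n).choose_spec.1

lemma cokγ_D (n : ℕ) : cokγ f n ≫ cokD f n = f.hom.f n ≫ cokπ f n - cokδ f n :=
  (exists_cokD f n).choose_spec.2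

lemma cokδ_D (n : ℕ) : cokδ f (n + 1) ≫ cokD f n = X.obj.d (n + 1) n ≫ f.hom.f n ≫ cokπ f n := by
  change (_ ≫ _) ≫ _ = _
  rw [Category.assoc, cokγ_D, Preadditive.comp_sub, d_cokδ, sub_zero]

lemma cokD_cokD (n : ℕ) : cokD f (n + 1) ≫ cokD f n = 0 := by
  refine cok_hom_ext_succ ?_ ?_
  · rw [← Category.assoc, cokπ_D, Category.assoc, cokπ_D, ← Category.assoc,
      HomologicalComplex.d_comp_d, zero_comp, comp_zero]
  · rw [← Category.assoc, cokγ_D, Preadditive.sub_comp, cokδ_D, Category.assoc, cokπ_D,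
      ← Category.assoc, ← Category.assoc, BoundedCh.comm, sub_self, comp_zero]

/-- Explicit homotopy cokernels exist. -/
def chCokernel : ChCokernel f where
  obj := BoundedCh.mk' (cokX f) (cokD f) (cokD_cokD f) fun _ => isZero_cokX f
  π := BoundedCh.homMk' (cokπ f) fun n => by
    rw [BoundedCh.mk'_d]
    exact cokπ_D f n
  γ := cokγ f
  γ_d_zero := by
    rw [BoundedCh.mk'_d]
    exact (cokγ_D f 0).trans (sub_zero _)
  γ_d_succ n := by
    rw [BoundedCh.mk'_d]
    exact cokγ_D f (n + 1)
  hom_ext_zero := cok_hom_ext_zero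
  hom_ext_succ := cok_hom_ext_succ
  exists_desc_zero := exists_cok_desc_zero f
  exists_desc_succ := exists_cok_desc_succ f

end Cok

namespace ChCokernel

variable {X Y : BoundedCh D p} {f : X ⟶ Y} (C : ChCokernel f)

/-- The structural homotopy. -/
def htpy : ChHtpy X C.obj :=
  ChHtpy.mk' 0 (f ≫ C.π) C.γ
    (by rw [BoundedCh.zero_f, add_zero, BoundedCh.comp_f, C.γ_d_zero])
    (fun n => by rw [C.γ_d_succ, BoundedCh.zero_f, add_zero, add_sub_cancel, BoundedCh.comp_f])

lemma htpy_c (n : ℕ) : C.htpy.c n = C.γ n := ChHtpy.mk'_c _ _ _ _ _ _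

lemma existsUnique {W : BoundedCh D p} (x : Y ⟶ W) (ξ : Htpy X W) (h₀ : src ξ = 0)
    (h₁ : tgt ξ = f ≫ x) : ∃! m : C.obj ⟶ W, C.π ≫ m = x ∧ wr (C.htpy : Htpy X C.obj) m = ξ := by
  have hs (n) : (ChHtpy.src ξ).hom.f n = 0 := by
    rw [show ChHtpy.src ξ = 0 from h₀, BoundedCh.zero_f]
  have ht (n) : (ChHtpy.tgt ξ).hom.f n = f.hom.f n ≫ x.hom.f n := by
    rw [show ChHtpy.tgt ξ = f ≫ x from h₁, BoundedCh.comp_f]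
  have c₀ : f.hom.f 0 ≫ x.hom.f 0 = ChHtpy.c ξ 0 ≫ W.obj.d 1 0 := by
    have := ChHtpy.comm_zero ξ
    rwa [hs, ht, add_zero] at this
  have c₁ (n) : f.hom.f (n + 1) ≫ x.hom.f (n + 1) = X.obj.d (n + 1) n ≫ ChHtpy.c ξ n +
      ChHtpy.c ξ (n + 1) ≫ W.obj.d (n + 2) (n + 1) := by
    have := ChHtpy.comm_succ ξ n
    rwa [hs, ht, add_zero] at this
  -- The top-degree constraint holds because ξ in degree p lands in W_{p+1} = 0.
  obtain ⟨m₀, hm₀⟩ := C.exists_desc_zero (x.hom.f 0) (fun hp => by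
    rw [c₀, ChHtpy.eq_zero_of_isZero (by omega) (ChHtpy.c ξ 0) 0, zero_comp])
  have hm (n : ℕ) := C.exists_desc_succ (n := n) (x.hom.f (n + 1)) (ChHtpy.c ξ n) (fun hn => by
    rw [c₁, ChHtpy.eq_zero_of_isZero (by omega) (ChHtpy.c ξ (n + 1)) 0, zero_comp, add_zero])
    (fun hn => ChHtpy.eq_zero_of_isZero hn _ _)
  choose m₁ hm₁ hm₂ using hm
  let m' : ∀ n, C.obj.obj.X n ⟶ W.obj.X n := fun n => match n with
    | 0 => m₀
    | n + 1 => m₁ n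
  have hm' (n) : C.π.hom.f n ≫ m' n = x.hom.f n := by
    cases n with
    | zero => exact hm₀
    | succ n => exact hm₁ n
  have hm'' (n) : C.γ n ≫ m' (n + 1) = ChHtpy.c ξ n := hm₂ n
  clear_value m'
  let m : C.obj ⟶ W := BoundedCh.homMk' m' fun n => by
    refine C.hom_ext_succ ?_ ?_
    · rw [← Category.assoc, ← Category.assoc, hm', BoundedCh.comm, BoundedCh.comm, Category.assoc,
        hm']
    · rw [← Category.assoc, ← Category.assoc, hm'']
      cases n with
      | zero => rw [C.γ_d_zero, Category.assoc, hm', c₀]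
      | succ n =>
        rw [C.γ_d_succ, Preadditive.sub_comp, Category.assoc, Category.assoc, hm', hm'', c₁,
          add_sub_cancel_left]
  have hm : C.π ≫ m = x := BoundedCh.hom_ext hm'
  refine ⟨m, ⟨hm, ChHtpy.ext ?_ ?_ fun n => ?_⟩, ?_⟩
  · change 𝟙 X ≫ (0 : X ⟶ C.obj) ≫ m = _
    rw [zero_comp, comp_zero]
    exact h₀.symm
  · change 𝟙 X ≫ (f ≫ C.π) ≫ m = _
    rw [Category.id_comp, Category.assoc, hm]
    exact h₁.symm
  · rw [ChHtpy.wr_c, htpy_c]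
    exact hm'' n
  · rintro k ⟨h₂, h₃⟩
    have e (n) : C.π.hom.f n ≫ k.hom.f n = C.π.hom.f n ≫ m.hom.f n := by
      rw [← BoundedCh.comp_f, ← BoundedCh.comp_f, h₂, hm]
    refine BoundedCh.hom_ext fun n => ?_
    cases n with
    | zero => exact C.hom_ext_zero (e 0)
    | succ n =>
      refine C.hom_ext_succ (e _) (Eq.trans ?_ (hm'' n).symm)
      rw [← h₃, ChHtpy.wr_c, htpy_c]

lemma exists_htpy {W : BoundedCh D p} (x y : C.obj ⟶ W) (φ : Htpy Y W) (h₀ : src φ = C.π ≫ x)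
    (h₁ : tgt φ = C.π ≫ y) (h₂ : tgt (wr (C.htpy : Htpy X C.obj) x) = src (wl f φ))
    (h : TwoHtpy (concat (wr (C.htpy : Htpy X C.obj) x) (wl f φ) h₂)
      (wr (C.htpy : Htpy X C.obj) y)) :
    ∃ ψ : Htpy C.obj W, src ψ = x ∧ tgt ψ = y ∧ wl C.π ψ = φ := by
  obtain ⟨-, -, h, hh⟩ := h
  have hs (n) : (ChHtpy.src φ).hom.f n = C.π.hom.f n ≫ x.hom.f n := by
    rw [show ChHtpy.src φ = C.π ≫ x from h₀, BoundedCh.comp_f]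
  have ht (n) : (ChHtpy.tgt φ).hom.f n = C.π.hom.f n ≫ y.hom.f n := by
    rw [show ChHtpy.tgt φ = C.π ≫ y from h₁, BoundedCh.comp_f]
  have hh' (n) : C.γ n ≫ y.hom.f (n + 1) = h n (n + 2) ≫ W.obj.d (n + 2) (n + 1) -
      X.obj.d n (n - 1) ≫ h (n - 1) (n + 1) +
      (f.hom.f n ≫ ChHtpy.c φ n + C.γ n ≫ x.hom.f (n + 1)) := by
    have h₂ := hh n
    change ChHtpy.c _ n - ChHtpy.c _ n = _ at h₂
    rw [ChHtpy.concat_c, ChHtpy.wr_c, ChHtpy.wr_c, ChHtpy.wl_c, htpy_c] at h₂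
    rw [← h₂, sub_add_cancel]
  -- The descended homotopy is φ on Y and the given 2-homotopy on X. The constraints in degree p and
  -- above are equations in objects of W of degree above p, which are zero.
  obtain ⟨m₀, hm₀⟩ := C.exists_desc_zero (ChHtpy.c φ 0) (fun hp =>
    ChHtpy.eq_zero_of_isZero (by omega) _ _)
  have hm (n : ℕ) := C.exists_desc_succ (n := n) (ChHtpy.c φ (n + 1)) (h n (n + 2))
    (fun hn => ChHtpy.eq_zero_of_isZero (by omega) _ _)
    (fun hn => ChHtpy.eq_zero_of_isZero (by omega) _ _)
  choose m₁ hm₁ hm₂ using hm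
  let m' : ∀ n, C.obj.obj.X n ⟶ W.obj.X (n + 1) := fun n => match n with
    | 0 => m₀
    | n + 1 => m₁ n
  have hm' (n) : C.π.hom.f n ≫ m' n = ChHtpy.c φ n := by
    cases n with
    | zero => exact hm₀
    | succ n => exact hm₁ n
  have hm'' (n) : C.γ n ≫ m' (n + 1) = h n (n + 2) := hm₂ n
  clear_value m'
  refine ⟨ChHtpy.mk' x y m' (C.hom_ext_zero ?_) fun n => C.hom_ext_succ ?_ ?_, rfl, rfl, ?_⟩
  · have := ChHtpy.comm_zero φ
    rw [hs, ht] at this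
    rw [this, Preadditive.comp_add, ← Category.assoc, hm']
  · have := ChHtpy.comm_succ φ n
    rw [hs, ht] at this
    rw [this, Preadditive.comp_add, Preadditive.comp_add, ← Category.assoc, ← Category.assoc, hm',
      BoundedCh.comm, Category.assoc, hm']
  · rw [Preadditive.comp_add, Preadditive.comp_add, ← Category.assoc, ← Category.assoc, hm'']
    cases n with
    | zero =>
      rw [hh', C.γ_d_zero, Category.assoc, hm', X.obj.shape 0 (0 - 1) (by simp), zero_comp]
      abel
    | succ n =>
      have e : C.γ (n + 1) ≫ y.hom.f (n + 2) = h (n + 1) (n + 3) ≫ W.obj.d (n + 3) (n + 2) -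
          X.obj.d (n + 1) n ≫ h n (n + 2) +
          (f.hom.f (n + 1) ≫ ChHtpy.c φ (n + 1) + C.γ (n + 1) ≫ x.hom.f (n + 2)) := hh' (n + 1)
      rw [e, C.γ_d_succ, Preadditive.sub_comp, Category.assoc, Category.assoc, hm', hm'']
      abel
  · refine ChHtpy.ext ?_ ?_ fun n => ?_
    · refine Eq.trans ?_ h₀.symm
      exact congrArg (C.π ≫ ·) (Category.comp_id x)
    · refine Eq.trans ?_ h₁.symm
      exact congrArg (C.π ≫ ·) (Category.comp_id y)
    · rw [ChHtpy.wl_c, ChHtpy.mk'_c, hm']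

/-- Explicit homotopy cokernels are homotopy cokernels. -/
def toHCokernel : HCokernel f where
  obj := C.obj
  π := C.π
  γ := C.htpy
  src_γ := rfl
  tgt_γ := rfl
  existsUnique := C.existsUnique
  exists_htpy x y φ h₀ h₁ h := C.exists_htpy x y φ h₀ h₁ _ h

end ChCokernel

lemma ChHtpy.isZero_X {X : BoundedCh D p} (hX : IsZero X) (n : ℕ) : IsZero (X.obj.X n) := by
  rw [IsZero.iff_id_eq_zero]
  exact congrArg (fun f : X ⟶ X => f.hom.f n) (hX.eq_of_src (𝟙 X) 0)

variable (D p) in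
/-- Bounded chain complexes form a pointed homotopical category. -/
abbrev boundedChPointed : PointedHomotopicalCategory (BoundedCh D p) where
  htpy_to_zero hZ _ := ChHtpy.ext rfl (hZ.eq_of_tgt _ _)
    fun n => (ChHtpy.isZero_X hZ (n + 1)).eq_of_tgt _ _
  htpy_from_zero hZ _ := ChHtpy.ext rfl (hZ.eq_of_src _ _)
    fun n => (ChHtpy.isZero_X hZ n).eq_of_src _ _
  hker f := (chKernel f).toHKernel
  hcok f := (chCokernel f).toHCokernel

end Chain

open HCategory

/-! ### Homology of bounded complexes by generalized elements. -/

section Chain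

variable {D : Type u} [Category.{v} D] [Abelian D] {p : ℕ}

/-- At n = 0 both sides are 0 by truncated subtraction, and the differential from 0 to 0 vanishes;
this allows writing d n (n − 1) in all degrees. -/
lemma next_down (n : ℕ) : (ComplexShape.down ℕ).next n = n - 1 := by
  cases n <;> simp

/-- An epimorphism `g` through which all maps vanishing on `f` factor is a cokernel of `f`. -/
lemma IsExactPair.of_exists_desc {X Y Z : D} {f : X ⟶ Y} {g : Y ⟶ Z} [Epi g] (h₀ : f ≫ g = 0)
    (h : ∀ {W : D} (a : Y ⟶ W), f ≫ a = 0 → ∃ m : Z ⟶ W, g ≫ m = a) : IsExactPair f g := by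
  refine ⟨h₀, ShortComplex.exact_of_g_is_cokernel _ (CokernelCofork.IsColimit.ofπ _ _
    (fun a ha => (h a ha).choose) (fun a ha => (h a ha).choose_spec) fun a ha m hm => ?_)⟩
  rw [← cancel_epi g, (h a ha).choose_spec]
  exact hm

/-- A criterion stronger than necessary: cycles are lifted on the nose, not up to a boundary. It
suffices in the two extreme degrees. -/
lemma isExactPair_homologyMap {X Y Z : ChainComplex D ℕ} (φ : X ⟶ Y) (ψ : Y ⟶ Z) (n : ℕ)
    (h₀ : HomologicalComplex.homologyMap φ n ≫ HomologicalComplex.homologyMap ψ n = 0)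
    (h : ∀ ⦃T : D⦄ (y : T ⟶ Y.X n) (z : T ⟶ Z.X (n + 1)), y ≫ ψ.f n = z ≫ Z.d (n + 1) n →
      y ≫ Y.d n (n - 1) = 0 →
      ∃ (T' : D) (π : T' ⟶ T) (_ : Epi π) (x : T' ⟶ X.X n),
        x ≫ X.d n (n - 1) = 0 ∧ π ≫ y = x ≫ φ.f n) :
    IsExactPair (HomologicalComplex.homologyMap φ n) (HomologicalComplex.homologyMap ψ n) := by
  refine IsExactPair.of_exists_lift h₀ fun T t ht => ?_
  obtain ⟨T₁, π₁, _, y, hy, hy'⟩ :=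
    Y.eq_liftCycles_homologyπ_up_to_refinements t (n - 1) (next_down n)
  have hz : Z.liftCycles (y ≫ ψ.f n) (n - 1) (next_down n)
      (by rw [Category.assoc, ψ.comm, reassoc_of% hy, zero_comp]) ≫ Z.homologyπ n = 0 := by
    rw [← HomologicalComplex.liftCycles_comp_cyclesMap (hk := hy), Category.assoc,
      ← HomologicalComplex.homologyπ_naturality, ← reassoc_of% hy', ht, comp_zero]
  obtain ⟨T₂, π₂, _, z, hz⟩ := (Z.liftCycles_comp_homologyπ_eq_zero_iff_up_to_refinements (n + 1) n
    (n - 1) (ChainComplex.prev ℕ n) (next_down n) _ _).1 hz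
  obtain ⟨T₃, π₃, _, x, hx, hx'⟩ := h (π₂ ≫ y) z (by rw [Category.assoc, hz])
    (by rw [Category.assoc, hy, comp_zero])
  refine ⟨T₃, π₃ ≫ π₂ ≫ π₁, inferInstance,
    X.liftCycles x (n - 1) (next_down n) hx ≫ X.homologyπ n, ?_⟩
  rw [Category.assoc (X.liftCycles _ _ _ _), HomologicalComplex.homologyπ_naturality,
    HomologicalComplex.liftCycles_comp_cyclesMap_assoc, Category.assoc, Category.assoc, hy',
    HomologicalComplex.comp_liftCycles_assoc, HomologicalComplex.comp_liftCycles_assoc]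
  congr 1
  rw [← cancel_mono (Y.iCycles n), HomologicalComplex.liftCycles_i,
    HomologicalComplex.liftCycles_i, hx']

/-! ### Exactness of the homology of chain complexes -/

variable (D p) in
/-- The `n`-th homology functor of bounded chain complexes, for a natural number `n`. -/
abbrev chHomology (n : ℕ) : BoundedCh D p ⥤ D :=
  (boundedProp D p).ι ⋙ HomologicalComplex.homologyFunctor D (ComplexShape.down ℕ) n

lemma chHomology_map_eq (n : ℕ) {X Y : BoundedCh D p} {f g : X ⟶ Y} (h : Homotopic f g) :
    (chHomology D p n).map f = (chHomology D p n).map g := by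
  obtain ⟨α, rfl, rfl⟩ := h
  exact (Homotopy.homologyMap_eq (ChHtpy.htpy α) n).symm

lemma chHomology_map_zero (n : ℕ) (X Y : BoundedCh D p) :
    (chHomology D p n).map (0 : X ⟶ Y) = 0 :=
  HomologicalComplex.homologyMap_zero _ _ _

lemma ChKernel.exact_zero {X Y : BoundedCh D p} {f : X ⟶ Y} (K : ChKernel f) :
    IsExactPair ((chHomology D p 0).map K.ι) ((chHomology D p 0).map f) := by
  refine isExactPair_homologyMap K.ι.hom f.hom 0 ?_ fun T y z hyz _ => ?_
  · have h : (chHomology D p 0).map (0 : K.obj ⟶ Y) = (chHomology D p 0).map (K.ι ≫ f) :=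
      chHomology_map_eq 0 ⟨K.toHKernel.κ, rfl, rfl⟩
    rw [chHomology_map_zero] at h
    exact ((chHomology D p 0).map_comp _ _).symm.trans h.symm
  -- The pair formed by y and a chain bounding its image is itself an element of the homotopy kernel
  -- in degree 0.
  · refine ⟨T, 𝟙 T, inferInstance, K.lift y z fun _ => hyz, ?_, ?_⟩
    · rw [HomologicalComplex.shape _ _ _ (by simp), comp_zero]
    · exact (Category.id_comp _).trans (K.lift_ι _ _ _).symm

/-- In positive degree p the homotopy cokernel is the cokernel of (f, −d) : X_p → Y_p ⊕ X_{p-1}. If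
it kills (y, 0), then y comes from an x with dx = 0. -/
lemma ChCokernel.exists_of_comp_π_eq_zero {X Y : BoundedCh D p} {f : X ⟶ Y} (C : ChCokernel f)
    {T : D} (y : T ⟶ Y.obj.X p) (hy : y ≫ C.π.hom.f p = 0) :
    ∃ (T' : D) (π : T' ⟶ T) (_ : Epi π) (x : T' ⟶ X.obj.X p),
      x ≫ X.obj.d p (p - 1) = 0 ∧ π ≫ y = x ≫ f.hom.f p := by
  cases p with
  | zero =>
    have : Epi (C.π.hom.f 0) := ⟨fun _ _ => C.hom_ext_zero⟩
    have h₀ : f.hom.f 0 ≫ C.π.hom.f 0 = 0 := by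
      rw [← C.γ_d_zero, ChHtpy.eq_zero_of_isZero Nat.zero_lt_one (C.γ 0) 0, zero_comp]
    obtain ⟨T', π, hπ, x, hx⟩ := (IsExactPair.of_exists_desc h₀ fun a ha =>
      C.exists_desc_zero a fun _ => ha).exists_lift y hy
    exact ⟨T', π, hπ, x, by rw [X.obj.shape _ _ (by simp), comp_zero], hx⟩
  | succ q =>
    have : Epi (biprod.desc (C.π.hom.f (q + 1)) (C.γ q)) := ⟨fun a b hab => C.hom_ext_succ
      (by simpa using biprod.inl ≫= hab) (by simpa using biprod.inr ≫= hab)⟩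
    have h₀ : biprod.lift (f.hom.f (q + 1)) (-X.obj.d (q + 1) q) ≫
        biprod.desc (C.π.hom.f (q + 1)) (C.γ q) = 0 := by
      rw [biprod.lift_desc, Preadditive.neg_comp, ← sub_eq_add_neg, ← C.γ_d_succ,
        ChHtpy.eq_zero_of_isZero (Nat.lt_succ_self _) (C.γ (q + 1)) 0, zero_comp]
    obtain ⟨T', π, hπ, x, hx⟩ := (IsExactPair.of_exists_desc h₀ fun {W} a ha => by
      obtain ⟨m, h₁, h₂⟩ := C.exists_desc_succ (biprod.inl ≫ a) (biprod.inr ≫ a) (fun _ => by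
        rw [biprod.lift_eq, Preadditive.add_comp, Preadditive.neg_comp, Preadditive.neg_comp,
          ← sub_eq_add_neg, sub_eq_zero, Category.assoc, Category.assoc] at ha
        exact ha) (fun h => (lt_irrefl _ h).elim)
      exact ⟨m, biprod.hom_ext' _ _ (by simpa using h₁) (by simpa using h₂)⟩).exists_lift
        (y ≫ biprod.inl) (by rw [Category.assoc, biprod.inl_desc, hy])
    refine ⟨T', π, hπ, x, ?_, ?_⟩
    · have h := hx =≫ biprod.snd
      simp only [Category.assoc, biprod.inl_snd, comp_zero, biprod.lift_snd,
        Preadditive.comp_neg] at h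
      exact neg_eq_zero.1 h.symm
    · have h := hx =≫ biprod.fst
      simpa only [Category.assoc, biprod.inl_fst, Category.comp_id, biprod.lift_fst] using h

lemma ChCokernel.exact_last {X Y : BoundedCh D p} {f : X ⟶ Y} (C : ChCokernel f) :
    IsExactPair ((chHomology D p p).map f) ((chHomology D p p).map C.π) := by
  refine isExactPair_homologyMap f.hom C.π.hom p ?_ fun T y z hyz _ => ?_
  · have h : (chHomology D p p).map (0 : X ⟶ C.obj) = (chHomology D p p).map (f ≫ C.π) :=
      chHomology_map_eq p ⟨C.toHCokernel.γ, rfl, rfl⟩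
    rw [chHomology_map_zero] at h
    exact ((chHomology D p p).map_comp _ _).symm.trans h.symm
  · exact C.exists_of_comp_π_eq_zero y (by
      rw [hyz, ChHtpy.eq_zero_of_isZero (Nat.lt_succ_self _) z 0, zero_comp])

/-! ### The map `H_n(W) ⟶ H_{n+1}(B)` induced by a homotopy `0 ≃ 0 : W ⟶ B` -/

section LoopHomology

variable {W B : BoundedCh D p}

lemma c_zero_d (ξ : Htpy W B) (h₀ : src ξ = 0) (h₁ : tgt ξ = 0) :
    ChHtpy.c ξ 0 ≫ B.obj.d 1 0 = 0 := by
  have h := ChHtpy.comm_zero ξ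
  rw [show ChHtpy.src ξ = 0 from h₀, show ChHtpy.tgt ξ = 0 from h₁, BoundedCh.zero_f,
    add_zero] at h
  exact h.symm

lemma d_c_add_c_d (ξ : Htpy W B) (h₀ : src ξ = 0) (h₁ : tgt ξ = 0) (n : ℕ) :
    W.obj.d (n + 1) n ≫ ChHtpy.c ξ n + ChHtpy.c ξ (n + 1) ≫ B.obj.d (n + 2) (n + 1) = 0 := by
  have h := ChHtpy.comm_succ ξ n
  rw [show ChHtpy.src ξ = 0 from h₀, show ChHtpy.tgt ξ = 0 from h₁, BoundedCh.zero_f,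
    add_zero] at h
  exact h.symm

/-- The morphism of short complexes induced by a homotopy `0 ≃ 0`. -/
def loopSc (ξ : Htpy W B) (h₀ : src ξ = 0) (h₁ : tgt ξ = 0) (n : ℕ) :
    W.obj.sc n ⟶ B.obj.sc (n + 1) where
  -- A homotopy 0 ≃ 0 anticommutes with the differentials, so negating the two outer components
  -- gives commuting squares.
  τ₁ := -(ChHtpy.htpy ξ).hom ((ComplexShape.down ℕ).prev n) ((ComplexShape.down ℕ).prev (n + 1))
  τ₂ := ChHtpy.c ξ n
  τ₃ := -(ChHtpy.htpy ξ).hom ((ComplexShape.down ℕ).next n) ((ComplexShape.down ℕ).next (n + 1))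
  comm₁₂ := by
    change (-(ChHtpy.htpy ξ).hom _ _) ≫ B.obj.d _ _ = W.obj.d _ _ ≫ _
    rw [ChainComplex.prev, ChainComplex.prev, Preadditive.neg_comp, neg_eq_iff_add_eq_zero]
    exact (add_comm _ _).trans (d_c_add_c_d ξ h₀ h₁ n)
  comm₂₃ := by
    change _ ≫ B.obj.d _ _ = W.obj.d _ _ ≫ (-(ChHtpy.htpy ξ).hom _ _)
    rw [ChainComplex.next_nat_succ, next_down, Preadditive.comp_neg, eq_neg_iff_add_eq_zero]
    cases n with
    | zero =>
      rw [W.obj.shape _ _ (by simp), zero_comp, add_zero]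
      exact c_zero_d ξ h₀ h₁
    | succ n => exact (add_comm _ _).trans (d_c_add_c_d ξ h₀ h₁ n)

/-- The map `H_n(W) ⟶ H_{n+1}(B)` induced by a homotopy `0 ≃ 0 : W ⟶ B`. -/
def loopHom (ξ : Htpy W B) (h₀ : src ξ = 0) (h₁ : tgt ξ = 0) (n : ℕ) :
    (chHomology D p n).obj W ⟶ (chHomology D p (n + 1)).obj B :=
  ShortComplex.homologyMap (loopSc ξ h₀ h₁ n)

/-- With `loopHom_map`, this yields both the naturality of ω and σ and their compatibility with unit
and counit, since all these maps are characterized by whiskering universal homotopies. -/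
lemma map_loopHom {V : BoundedCh D p} (a : V ⟶ W) (ξ : Htpy W B) (ζ : Htpy V B) (h : wl a ξ = ζ)
    (h₀ : src ξ = 0) (h₁ : tgt ξ = 0) (k₀ : src ζ = 0) (k₁ : tgt ζ = 0) (n : ℕ) :
    (chHomology D p n).map a ≫ loopHom ξ h₀ h₁ n = loopHom ζ k₀ k₁ n := by
  subst h
  have e (i j : ℕ) : a.hom.f i ≫ (ChHtpy.htpy ξ).hom i j =
      (ChHtpy.htpy (wl a ξ)).hom i j := congrArg (a.hom.f i ≫ ·) (Category.comp_id _).symm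
  have e' : (HomologicalComplex.shortComplexFunctor D (ComplexShape.down ℕ) n).map a.hom ≫
      loopSc ξ h₀ h₁ n =
      loopSc (wl a ξ) k₀ k₁ n := ShortComplex.hom_ext _ _
    ((Preadditive.comp_neg _ _).trans (congrArg (- ·) (e _ _))) (e _ _)
    ((Preadditive.comp_neg _ _).trans (congrArg (- ·) (e _ _)))
  rw [loopHom, loopHom, ← e', ShortComplex.homologyMap_comp]
  rfl

lemma loopHom_map {V : BoundedCh D p} (b : B ⟶ V) (ξ : Htpy W B) (ζ : Htpy W V) (h : wr ξ b = ζ)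
    (h₀ : src ξ = 0) (h₁ : tgt ξ = 0) (k₀ : src ζ = 0) (k₁ : tgt ζ = 0) (n : ℕ) :
    loopHom ξ h₀ h₁ n ≫ (chHomology D p (n + 1)).map b = loopHom ζ k₀ k₁ n := by
  subst h
  have e (i j : ℕ) : (ChHtpy.htpy ξ).hom i j ≫ b.hom.f j =
      (ChHtpy.htpy (wr ξ b)).hom i j := (Category.id_comp _).symm
  have e' : loopSc ξ h₀ h₁ n ≫
      (HomologicalComplex.shortComplexFunctor D (ComplexShape.down ℕ) (n + 1)).map b.hom =
      loopSc (wr ξ b) k₀ k₁ n := ShortComplex.hom_ext _ _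
    ((Preadditive.neg_comp _ _).trans (congrArg (- ·) (e _ _))) (e _ _)
    ((Preadditive.neg_comp _ _).trans (congrArg (- ·) (e _ _)))
  rw [loopHom, loopHom, ← e', ShortComplex.homologyMap_comp]
  rfl

lemma mono_loopHom (ξ : Htpy W B) (h₀ : src ξ = 0) (h₁ : tgt ξ = 0) (n : ℕ)
    (h : ∀ ⦃T : D⦄ (x : T ⟶ W.obj.X n) (y : T ⟶ B.obj.X (n + 2)),
      x ≫ ChHtpy.c ξ n = y ≫ B.obj.d (n + 2) (n + 1) →
      ∃ (T' : D) (π : T' ⟶ T) (_ : Epi π) (x₁ : T' ⟶ W.obj.X (n + 1)),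
        π ≫ x = x₁ ≫ W.obj.d (n + 1) n) : Mono (loopHom ξ h₀ h₁ n) := by
  refine (ShortComplex.mono_homologyMap_iff_up_to_refinements _).2 ?_
  change ∀ ⦃T : D⦄ (x : T ⟶ W.obj.X n), _ → ∀ (y : T ⟶ B.obj.X _),
    x ≫ ChHtpy.c ξ n = y ≫ B.obj.d _ _ →
    ∃ (T' : D) (π : T' ⟶ T) (_ : Epi π) (x₁ : T' ⟶ W.obj.X _), π ≫ x = x₁ ≫ W.obj.d _ _
  rw [ChainComplex.prev, ChainComplex.prev]
  exact fun T x _ y hxy => h x y hxy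

lemma epi_loopHom (ξ : Htpy W B) (h₀ : src ξ = 0) (h₁ : tgt ξ = 0) (n : ℕ)
    (h : ∀ ⦃T : D⦄ (y : T ⟶ B.obj.X (n + 1)), y ≫ B.obj.d (n + 1) n = 0 →
      ∃ (T' : D) (π : T' ⟶ T) (_ : Epi π) (x : T' ⟶ W.obj.X n),
        x ≫ W.obj.d n (n - 1) = 0 ∧ π ≫ y = x ≫ ChHtpy.c ξ n) : Epi (loopHom ξ h₀ h₁ n) := by
  refine (ShortComplex.epi_homologyMap_iff_up_to_refinements _).2 ?_
  change ∀ ⦃T : D⦄ (y : T ⟶ B.obj.X (n + 1)), y ≫ B.obj.d _ _ = 0 →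
    ∃ (T' : D) (π : T' ⟶ T) (_ : Epi π) (x : T' ⟶ W.obj.X n) (_ : x ≫ W.obj.d _ _ = 0)
      (y₁ : T' ⟶ B.obj.X _), π ≫ y = x ≫ ChHtpy.c ξ n + y₁ ≫ B.obj.d _ _
  rw [ChainComplex.next_nat_succ, next_down]
  intro T y hy
  obtain ⟨T', π, hπ, x, hx, hxy⟩ := h y hy
  exact ⟨T', π, hπ, x, hx, 0, by rw [hxy, zero_comp, add_zero]⟩

end LoopHomology

/-- Up to sign of the differential, the loop complex is B shifted down, with B_1 replaced by its
cycles in degree 0. -/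
lemma ChKernel.isIso_loopHom {Z B : BoundedCh D p} (hZ : IsZero Z) {f : Z ⟶ B} (K : ChKernel f)
    (ξ : Htpy K.obj B) (hξ : ξ = K.htpy) (h₀ : src ξ = 0) (h₁ : tgt ξ = 0) (n : ℕ) :
    IsIso (loopHom ξ h₀ h₁ n) := by
  have hc (n) : ChHtpy.c ξ n = K.κ n := by rw [hξ, htpy_c]
  have hf (n) : f.hom.f n = 0 := (ChHtpy.isZero_X hZ n).eq_of_src _ _
  have : Mono (loopHom ξ h₀ h₁ n) := by
    refine mono_loopHom _ _ _ _ fun T x y hxy => ?_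
    rw [hc] at hxy
    -- The sign compensates the one by which κ anticommutes with d.
    obtain ⟨m, -, hm⟩ := K.exists_lift (n := n + 1) 0 (-y) (by simp)
    refine ⟨T, 𝟙 T, inferInstance, m, K.hom_ext ?_ ?_⟩
    · exact (ChHtpy.isZero_X hZ n).eq_of_tgt _ _
    · rw [Category.id_comp, hxy, Category.assoc, K.d_κ, hf, comp_zero, zero_sub,
        Preadditive.comp_neg, ← Category.assoc, hm, Preadditive.neg_comp, neg_neg]
  have : Epi (loopHom ξ h₀ h₁ n) := by
    refine epi_loopHom _ _ _ _ fun T y hy => ?_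
    obtain ⟨m, -, hm⟩ := K.exists_lift 0 y (fun _ => by rw [hy, zero_comp])
    refine ⟨T, 𝟙 T, inferInstance, m, ?_, by rw [hc, hm, Category.id_comp]⟩
    cases n with
    | zero => rw [HomologicalComplex.shape _ _ _ (by simp), comp_zero]
    | succ n =>
      have h : (m ≫ K.obj.obj.d (n + 1) n) ≫ K.κ n = 0 := by
        rw [Category.assoc, K.d_κ, hf, comp_zero, zero_sub,
          Preadditive.comp_neg, ← Category.assoc, hm, hy, neg_zero]
      exact K.hom_ext ((ChHtpy.isZero_X hZ n).eq_of_tgt _ _) (h.trans zero_comp.symm)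
  exact isIso_of_mono_of_epi _

/-- The suspension is X shifted up, with X_{p-1} replaced by its quotient by boundaries in degree p.
In either case ker γ_n consists of boundaries, as `hex` records, so homology below degree p is kept.
-/
lemma ChCokernel.isIso_loopHom {X Z : BoundedCh D p} (hZ : IsZero Z) {f : X ⟶ Z}
    (C : ChCokernel f) (ξ : Htpy X C.obj) (hξ : ξ = C.htpy) (h₀ : src ξ = 0) (h₁ : tgt ξ = 0)
    {n : ℕ} (hn : n < p) : IsIso (loopHom ξ h₀ h₁ n) := by
  have hc (n) : ChHtpy.c ξ n = C.γ n := by rw [hξ, htpy_c]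
  have hZ' (n) : IsZero (Z.obj.X n) := ChHtpy.isZero_X hZ n
  have hf (n) : f.hom.f n = 0 := (hZ' n).eq_of_tgt _ _
  have hγ (n) : Epi (C.γ n) :=
    ⟨fun _ _ h => C.hom_ext_succ ((hZ' _).eq_of_src _ _) h⟩
  have hγ' (n) (hn : n + 1 < p) : Mono (C.γ n) := by
    obtain ⟨m, -, hm⟩ := C.exists_desc_succ 0 (𝟙 (X.obj.X n)) (by omega) (by omega)
    exact mono_of_mono_fac hm
  have hd (n) : C.γ (n + 1) ≫ C.obj.obj.d (n + 2) (n + 1) = -(X.obj.d (n + 1) n ≫ C.γ n) := by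
    rw [C.γ_d_succ, hf, zero_comp, zero_sub]
  have hex {T : D} (x : T ⟶ X.obj.X n) (hx : x ≫ C.γ n = 0) :
      ∃ (T' : D) (π : T' ⟶ T) (_ : Epi π) (x₁ : T' ⟶ X.obj.X (n + 1)),
        π ≫ x = x₁ ≫ X.obj.d (n + 1) n := by
    rcases Nat.lt_or_ge (n + 1) p with h | h
    · have := hγ' n h
      exact ⟨T, 𝟙 T, inferInstance, 0, by rw [zero_of_comp_mono _ hx, comp_zero, zero_comp]⟩
    · have := hγ n
      have h₀ : X.obj.d (n + 1) n ≫ C.γ n = 0 := by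
        rw [← neg_eq_zero, ← hd, ChHtpy.eq_zero_of_isZero (by omega) (C.γ (n + 1)) 0, zero_comp]
      refine (IsExactPair.of_exists_desc h₀ fun a ha => ?_).exists_lift x hx
      obtain ⟨m, -, hm⟩ := C.exists_desc_succ 0 a (by simp [ha]) (by omega)
      exact ⟨m, hm⟩
  have : Mono (loopHom ξ h₀ h₁ n) := by
    refine mono_loopHom _ _ _ _ fun T x y hxy => ?_
    rw [hc] at hxy
    have := hγ (n + 1)
    obtain ⟨T₁, π₁, _, x₁, hx₁⟩ := surjective_up_to_refinements_of_epi (C.γ (n + 1)) y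
    -- Writing y = γ(x₁), anticommutation turns γ(x) = dy into γ(x + dx₁) = 0.
    obtain ⟨T₂, π₂, _, x₂, hx₂⟩ := hex (π₁ ≫ x + x₁ ≫ X.obj.d (n + 1) n) (by
      rw [Preadditive.add_comp, Category.assoc, hxy, ← Category.assoc, hx₁, Category.assoc, hd,
        Preadditive.comp_neg, Category.assoc, neg_add_cancel])
    refine ⟨T₂, π₂ ≫ π₁, inferInstance, x₂ - π₂ ≫ x₁, ?_⟩
    rw [Preadditive.sub_comp, ← hx₂, Preadditive.comp_add, Category.assoc, Category.assoc,
      add_sub_cancel_right]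
  have : Epi (loopHom ξ h₀ h₁ n) := by
    refine epi_loopHom _ _ _ _ fun T y hy => ?_
    have := hγ n
    obtain ⟨T₁, π₁, _, x, hx⟩ := surjective_up_to_refinements_of_epi (C.γ n) y
    refine ⟨T₁, π₁, inferInstance, x, ?_, by rw [hc, hx]⟩
    cases n with
    | zero => rw [HomologicalComplex.shape _ _ _ (by simp), comp_zero]
    | succ n =>
      have := hγ' n hn
      have h : (x ≫ X.obj.d (n + 1) n) ≫ C.γ n = 0 := by
        rw [Category.assoc, ← neg_eq_zero, ← Preadditive.comp_neg, ← hd, ← Category.assoc, ← hx,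
          Category.assoc, hy, comp_zero]
      exact zero_of_comp_mono (C.γ n) h
  exact isIso_of_mono_of_epi _

end Chain

open HCategory

section Chain

open scoped ZeroObject

variable {D : Type u} [Category.{v} D] [Abelian D] {p : ℕ}

/-! ### Nilpotency of loops and suspension for bounded chain complexes -/

lemma BoundedCh.isZero_of_isZero_X {X : BoundedCh D p} (h : ∀ n, IsZero (X.obj.X n)) :
    IsZero X := by
  rw [IsZero.iff_id_eq_zero]
  exact BoundedCh.hom_ext fun n => (h n).eq_of_src _ _

lemma ChKernel.isZero_X {Z B : BoundedCh D p} (hZ : IsZero Z) {f : Z ⟶ B} (K : ChKernel f)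
    {n : ℕ} (hn : IsZero (B.obj.X (n + 1))) : IsZero (K.obj.obj.X n) := by
  rw [IsZero.iff_id_eq_zero]
  exact K.hom_ext ((ChHtpy.isZero_X hZ n).eq_of_tgt _ _) (hn.eq_of_tgt _ _)

lemma ChCokernel.isZero_X_zero {X Z : BoundedCh D p} (hZ : IsZero Z) {f : X ⟶ Z}
    (C : ChCokernel f) : IsZero (C.obj.obj.X 0) := by
  rw [IsZero.iff_id_eq_zero]
  exact C.hom_ext_zero ((ChHtpy.isZero_X hZ 0).eq_of_src _ _)

lemma ChCokernel.isZero_X_succ {X Z : BoundedCh D p} (hZ : IsZero Z) {f : X ⟶ Z}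
    (C : ChCokernel f) {n : ℕ} (hn : IsZero (X.obj.X n)) : IsZero (C.obj.obj.X (n + 1)) := by
  rw [IsZero.iff_id_eq_zero]
  exact C.hom_ext_succ ((ChHtpy.isZero_X hZ _).eq_of_src _ _) (hn.eq_of_src _ _)

section

attribute [local instance] boundedChPointed

/-- Each loop lowers the top possible degree by one; in `isZero_iterate_susp` each suspension raises
the bottom one. -/
lemma isZero_iterate_loop (X : BoundedCh D p) (k n : ℕ) (h : p < n + k) :
    IsZero (((loop (BoundedCh D p)).obj^[k] X).obj.X n) := by
  induction k generalizing n with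
  | zero => exact X.property n h
  | succ k ih =>
    rw [Function.iterate_succ_apply']
    exact (chKernel _).isZero_X (isZero_zero _) (ih (n + 1) (by omega))

lemma isZero_iterate_susp (X : BoundedCh D p) (k n : ℕ) (h : n < k) :
    IsZero (((susp (BoundedCh D p)).obj^[k] X).obj.X n) := by
  induction k generalizing n with
  | zero => omega
  | succ k ih =>
    rw [Function.iterate_succ_apply']
    cases n with
    | zero => exact (chCokernel _).isZero_X_zero (isZero_zero _)
    | succ n => exact (chCokernel _).isZero_X_succ (isZero_zero _) (ih n (by omega))

lemma loopSuspNilpotent_boundedCh : LoopSuspNilpotent (BoundedCh D p) p := fun X =>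
  ⟨BoundedCh.isZero_of_isZero_X fun n => isZero_iterate_loop X _ n (by omega),
    BoundedCh.isZero_of_isZero_X fun n => by
      rcases Nat.lt_or_ge p n with h | h
      · exact ((susp (BoundedCh D p)).obj^[p + 1] X).property n h
      · exact isZero_iterate_susp X _ n (by omega)⟩

/-! ### The homology theory of bounded chain complexes -/

variable (D p) in
/-- The isomorphisms `H_n(ΩB) ≅ H_{n+1}(B)`. -/
def chLoopIso (n : ℕ) : loop (BoundedCh D p) ⋙ chHomology D p n ≅ chHomology D p (n + 1) :=
  NatIso.ofComponents
    (fun B =>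
      have : IsIso (loopHom (loopHtpy B) (src_loopHtpy B) (tgt_loopHtpy B) n) :=
        ChKernel.isIso_loopHom (isZero_zero _) _ (loopHtpy B) rfl _ _ n
      asIso (loopHom (loopHtpy B) (src_loopHtpy B) (tgt_loopHtpy B) n))
    fun {X Y} f =>
      have h₀ : src (wr (loopHtpy X) f) = 0 := by rw [src_wr, src_loopHtpy, zero_comp]
      have h₁ : tgt (wr (loopHtpy X) f) = 0 := by rw [tgt_wr, tgt_loopHtpy, zero_comp]
      -- Both composites are induced by the same homotopy, the universal loop of X followed by f.
      (map_loopHom _ _ _ (loop_map_loopHtpy f) _ _ h₀ h₁ n).trans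
        (loopHom_map f _ _ rfl _ _ h₀ h₁ n).symm

variable (D p) in
/-- The isomorphisms `H_n(B) ≅ H_{n+1}(ΣB)`. -/
def chSuspIso (n : ℕ) (hn : n < p) :
    chHomology D p n ≅ susp (BoundedCh D p) ⋙ chHomology D p (n + 1) :=
  NatIso.ofComponents
    (fun B =>
      have : IsIso (loopHom (suspHtpy B) (src_suspHtpy B) (tgt_suspHtpy B) n) :=
        ChCokernel.isIso_loopHom (isZero_zero _) _ (suspHtpy B) rfl _ _ hn
      asIso (loopHom (suspHtpy B) (src_suspHtpy B) (tgt_suspHtpy B) n))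
    fun {X Y} f =>
      have h₀ : src (wl f (suspHtpy Y)) = 0 := by rw [src_wl, src_suspHtpy, comp_zero]
      have h₁ : tgt (wl f (suspHtpy Y)) = 0 := by rw [tgt_wl, tgt_suspHtpy, comp_zero]
      (map_loopHom f _ _ rfl _ _ h₀ h₁ n).trans
        (loopHom_map _ _ _ (suspHtpy_susp_map f) _ _ h₀ h₁ n).symm

variable (D p) in
/-- The homology theory of bounded chain complexes. -/
def chHomologyTheory : HomologyTheory (BoundedCh D p) D p where
  H := boundedHomology D p
  homotopy_invariance n _ _ _ _ h := chHomology_map_eq n h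
  exact_hker f := (chKernel f).exact_zero
  exact_hcok f := (chCokernel f).exact_last
  ω n := chLoopIso D p n
  σ n := chSuspIso D p n n.isLt
  unit_ω n X := map_loopHom _ _ _ (loopUnit_loopHtpy X) _ _ _ _ n
  σ_counit n X := loopHom_map _ _ _ (suspHtpy_loopCounit X) _ _ _ _ n

end

end Chain

open HCategory

open scoped ZeroObject

/-! ### The sequence 0 → M → 0, for any choice of homotopy kernels and cokernels. -/

section Contractible

variable {A : Type u} [Category.{v} A] [HCategory.{w} A] [HasZeroMorphisms A] [HasZeroObject A]
  [PointedHomotopicalCategory A]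

/-- Homotopies out of a zero object carry no data, so M itself has the universal property. -/
lemma HCokernel.isIso_π {Z M : A} (hZ : IsZero Z) {f : Z ⟶ M} (C : HCokernel f) : IsIso C.π := by
  have h₁ : tgt (HCategory.refl (0 : Z ⟶ M)) = f ≫ 𝟙 M := hZ.eq_of_src _ _
  have h := C.π_desc (𝟙 M) (HCategory.refl 0) (src_refl _) h₁
  refine ⟨_, h, C.hom_ext ?_ ?_⟩
  · rw [← Category.assoc, h, Category.id_comp, Category.comp_id]
  · rw [htpy_from_zero hZ (wr C.γ _), htpy_from_zero hZ (wr C.γ (𝟙 _))]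
    exact congrArg HCategory.refl (hZ.eq_of_src _ _)

lemma HKernel.isIso_ι {Z M : A} (hZ : IsZero Z) {f : M ⟶ Z} (K : HKernel f) : IsIso K.ι := by
  have h₁ : tgt (HCategory.refl (0 : M ⟶ Z)) = 𝟙 M ≫ f := hZ.eq_of_tgt _ _
  have h := K.lift_ι (𝟙 M) (HCategory.refl 0) (src_refl _) h₁
  refine ⟨_, K.hom_ext ?_ ?_, h⟩
  · rw [Category.assoc, h, Category.id_comp, Category.comp_id]
  · rw [htpy_to_zero hZ (wl _ K.κ), htpy_to_zero hZ (wl (𝟙 _) K.κ)]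
    exact congrArg HCategory.refl (hZ.eq_of_tgt _ _)

/-- The homotopy cokernel of an isomorphism is contractible. -/
lemma HCokernel.homotopic_zero_id {X Y : A} {f : X ⟶ Y} [IsIso f] (C : HCokernel f) :
    Homotopic 0 (𝟙 C.obj) := by
  obtain ⟨ψ, h₀, h₁, -⟩ := C.exists_htpy 0 (𝟙 C.obj) (wl (inv f) C.γ)
    (by rw [src_wl, C.src_γ, comp_zero, comp_zero])
    (by rw [tgt_wl, C.tgt_γ, IsIso.inv_hom_id_assoc, Category.comp_id])
    (two_trans (two_refl_concat_of_eq (wr_zero _) _)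
      (two_of_eq (by rw [wl_wl, IsIso.hom_inv_id, wl_id, wr_id])))
  exact ⟨ψ, h₀, h₁⟩

/-- The h-differential sequence `0 ⟶ M ⟶ 0`. -/
def HDiffSeq.ofObj (M : A) : HDiffSeq A where
  X := 0
  M := M
  Y := 0
  f := 0
  g := 0
  α := HCategory.refl 0
  src_α := src_refl _
  tgt_α := by rw [tgt_refl, comp_zero]

lemma HDiffSeq.isIso_π_ofObj (M : A) : IsIso (hcok (ofObj M).f).π :=
  HCokernel.isIso_π (isZero_zero A) _

lemma HDiffSeq.homotopic_zero_id_ofObj (M : A) :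
    Homotopic 0 (𝟙 (hcok (hker (ofObj M).g).ι).obj) := by
  have : IsIso (hker (ofObj M).g).ι := HKernel.isIso_ι (isZero_zero A) _
  exact HCokernel.homotopic_zero_id _

/-- Here Cf is isomorphic to M and C(kg) is contractible, so a homotopy equivalence v between them
contracts M. -/
lemma HDiffSeq.homotopic_zero_id_of_hExact {M : A} (h : (ofObj M).HExact) :
    Homotopic 0 (𝟙 M) := by
  obtain ⟨-, b, hb, -⟩ := h
  have h₁ := ((homotopic_zero_id_ofObj M).whisker (ofObj M).v b)
  rw [Category.id_comp, zero_comp, comp_zero] at h₁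
  have := isIso_π_ofObj M
  have h₂ := (h₁.trans hb).whisker (hcok (ofObj M).f).π (inv (hcok (ofObj M).f).π)
  rw [Category.id_comp, zero_comp, comp_zero, IsIso.hom_inv_id] at h₂
  exact h₂

end Contractible

/-! ### A short exact sequence as a complex: acyclic, and contractible only if split. -/

section Chain

variable {D : Type u} [Category.{v} D] [Abelian D] {p : ℕ}

lemma isZero_chHomology_of_contractible {X : BoundedCh D p} (h : Homotopic 0 (𝟙 X)) (n : ℕ) :
    IsZero ((chHomology D p n).obj X) := by
  rw [IsZero.iff_id_eq_zero, ← CategoryTheory.Functor.map_id, ← chHomology_map_eq n h,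
    chHomology_map_zero]

/-- The objects of a short complex, in degrees `2, 1, 0`. -/
def shortX (E : ShortComplex D) : ℕ → D
  | 0 => E.X₃
  | 1 => E.X₂
  | 2 => E.X₁
  | _ + 3 => 0

/-- The maps of a short complex, in degrees `2, 1, 0`. -/
def shortD (E : ShortComplex D) : ∀ n, shortX E (n + 1) ⟶ shortX E n
  | 0 => E.g
  | 1 => E.f
  | _ + 2 => 0

lemma shortD_shortD (E : ShortComplex D) (n : ℕ) : shortD E (n + 1) ≫ shortD E n = 0 :=
  match n with
  | 0 => E.zero
  | 1 => zero_comp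
  | _ + 2 => zero_comp

/-- A short complex as a bounded chain complex, in degrees `2, 1, 0`. -/
def shortCh (hp : 2 ≤ p) (E : ShortComplex D) : BoundedCh D p :=
  BoundedCh.mk' (shortX E) (shortD E) (shortD_shortD E) fun n hn => by
    obtain ⟨k, rfl⟩ := Nat.exists_eq_add_of_lt (hp.trans_lt hn)
    rw [show 2 + k + 1 = k + 3 by omega]
    exact isZero_zero D

lemma shortCh_d (hp : 2 ≤ p) (E : ShortComplex D) (n : ℕ) :
    (shortCh hp E).obj.d (n + 1) n = shortD E n := BoundedCh.mk'_d _ _ _ _ _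

lemma shortCh_exactAt (hp : 2 ≤ p) {E : ShortComplex D} (hE : E.ShortExact) (n : ℕ) :
    (shortCh hp E).obj.ExactAt n := by
  rw [HomologicalComplex.exactAt_iff' _ (n + 1) n (n - 1) (ChainComplex.prev ℕ n) (next_down n)]
  match n with
  | 0 =>
    refine (ShortComplex.exact_iff_epi _ ((shortCh hp E).obj.shape 0 0 (by simp))).2 ?_
    change Epi ((shortCh hp E).obj.d 1 0)
    rw [shortCh_d]
    exact hE.epi_g
  | 1 =>
    exact ShortComplex.exact_of_iso (ShortComplex.isoMk (S₁ := E)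
      (S₂ := (shortCh hp E).obj.sc' 2 1 0) (Iso.refl E.X₁) (Iso.refl E.X₂) (Iso.refl E.X₃)
      (((Category.id_comp _).trans (shortCh_d hp E 1)).trans (Category.comp_id E.f).symm)
      (((Category.id_comp _).trans (shortCh_d hp E 0)).trans (Category.comp_id E.g).symm)) hE.exact
  | 2 =>
    refine (ShortComplex.exact_iff_mono _ (shortCh_d hp E 2)).2 ?_
    change Mono ((shortCh hp E).obj.d 2 1)
    rw [shortCh_d]
    exact hE.mono_f
  | n + 3 => exact ShortComplex.exact_of_isZero_X₂ _ (isZero_zero D)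

/-- In degree 2 a contraction satisfies 1 = E.f ≫ r plus a term through the zero object in degree 3.
-/
lemma exists_retraction_of_homotopic (hp : 2 ≤ p) {E : ShortComplex D}
    (h : Homotopic 0 (𝟙 (shortCh hp E))) : ∃ r : E.X₂ ⟶ E.X₁, E.f ≫ r = 𝟙 E.X₁ := by
  obtain ⟨α, h₀, h₁⟩ := h
  refine ⟨ChHtpy.c α 1, ?_⟩
  have h := ChHtpy.comm_succ α 1
  have h₃ : IsZero ((shortCh hp E).obj.X 3) := isZero_zero D
  rw [show ChHtpy.src α = 0 from h₀, show ChHtpy.tgt α = 𝟙 _ from h₁, BoundedCh.zero_f, add_zero,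
    h₃.eq_of_tgt (ChHtpy.c α (1 + 1)) 0, zero_comp, add_zero, shortCh_d] at h
  exact h.symm

lemma exists_wExact_not_hExact (hp : 2 ≤ p) {E : ShortComplex D} (hE : E.ShortExact)
    (hE' : IsEmpty E.Splitting) [PointedHomotopicalCategory (BoundedCh D p)] :
    ∃ S : HDiffSeq (BoundedCh D p), S.WExact (boundedHomology D p) ∧ ¬ S.HExact := by
  refine ⟨HDiffSeq.ofObj (shortCh hp E), fun n => ?_, fun h => ?_⟩
  · have h₁ : IsZero ((chHomology D p n).obj (shortCh hp E)) :=
      (HomologicalComplex.exactAt_iff_isZero_homology _ _).1 (shortCh_exactAt hp hE n)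
    have := HDiffSeq.isIso_π_ofObj (shortCh hp E)
    have h₂ := h₁.of_iso
      ((chHomology D p n).mapIso (asIso (hcok (HDiffSeq.ofObj (shortCh hp E)).f).π)).symm
    have h₃ := isZero_chHomology_of_contractible
      (HDiffSeq.homotopic_zero_id_ofObj (shortCh hp E)) n
    exact ⟨0, h₂.eq_of_src _ _, h₃.eq_of_src _ _⟩
  · obtain ⟨r, hr⟩ := exists_retraction_of_homotopic hp (HDiffSeq.homotopic_zero_id_of_hExact h)
    have := hE.epi_g
    exact hE'.false (ShortComplex.Splitting.ofExactOfRetraction E hE.exact r hr hE.epi_g)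

end Chain

end HomotopicalCat

end

theorem mainTheorem4 {D : Type u'} [Category.{v'} D] [Abelian D] (p : ℕ) :
    -- the general setting: equivalence of the six conditions, and h-exact implies w-exact
    (∀ (A : Type u) [Category.{v} A] [HCategory.{w} A] [HasZeroMorphisms A] [HasZeroObject A]
        [PointedHomotopicalCategory A],
      LoopSuspNilpotent A p →
      ∀ (T : HomologyTheory A D p) (S : HDiffSeq A),
        List.TFAE [
          IsWeakEquiv T.H S.v,
          (∀ n : Fin (p + 1), n ≠ Fin.last p → IsIso ((T.H n).map S.uα)) ∧
            Epi ((T.H (Fin.last p)).map S.uα),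
          IsWeaklyNull T.H (hcok S.uα).obj,
          IsWeakEquiv T.H S.u,
          (∀ n : Fin (p + 1), n ≠ 0 → IsIso ((T.H n).map S.vα)) ∧
            Mono ((T.H 0).map S.vα),
          IsWeaklyNull T.H (hker S.vα).obj] ∧
        (S.HExact → S.WExact T.H)) ∧
    -- bounded chain complexes with their usual homology are an instance of the general setting
    (∃ _ : PointedHomotopicalCategory (BoundedCh D p),
      LoopSuspNilpotent (BoundedCh D p) p ∧
      ∃ T : HomologyTheory (BoundedCh D p) D p, T.H = boundedHomology D p) ∧
    -- there, w-exact does not imply h-exact (whatever the choice of h-kernels and h-cokernels)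
    (2 ≤ p → (∃ E : ShortComplex D, E.ShortExact ∧ IsEmpty E.Splitting) →
      ∀ [PointedHomotopicalCategory (BoundedCh D p)],
        ∃ S : HDiffSeq (BoundedCh D p), S.WExact (boundedHomology D p) ∧ ¬ S.HExact) := by
  refine ⟨fun A _ _ _ _ _ hA T S => ⟨T.tfae_weak_exactness S hA,
      -- Only the half of h-exactness concerning v is needed, by the equivalences just proved.
      fun h => T.isWeakEquiv_of_isHomotopyEquiv h.2⟩,
    ⟨boundedChPointed D p, loopSuspNilpotent_boundedCh, chHomologyTheory D p, rfl⟩,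
    fun hp hE _ => ?_⟩
  obtain ⟨E, hE, hE'⟩ := hE
  exact exists_wExact_not_hExact hp hE hE'
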